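/- Let $n\ge 2$ and let $\mathbb T^{n-2}=\mathbb R^{n-2}/\Lambda$ for a lattice $\Lambda$ of full rank. For $r_0>0$ put $f(r)=r^2\bigl(1-(r_0/r)^n\bigr)$; the Horowitz–Myers metric of parameter $r_0$ is $$ \bar g=\frac{dr^2}{f}+f\,d\theta^2+r^2\delta_{AB}\,dx^A dx^B ,\qquad r>r_0, $$ where $\theta$ has period $\beta=4\pi/(nr_0)$; it extends to a smooth metric on $\mathbb R^2\times\mathbb T^{n-2}$, the axis of $\mathbb R^2$ being $r=r_0$. It has scalar curvature $-n(n-1)$ and the static potential $V=r$. Let $\bar D$ be its Levi-Civita connection. Let $g$ be a smooth Riemannian metric on $\mathbb R^2\times\mathbb T^{n-2}$ which, away from the axis of $\mathbb R^2$, has the form $$ g=e^{2u}dr^2+e^{2v}d\theta^2+g_{AB}\,dx^A dx^B ,\qquad r\in(a,\infty), $$ where $u$, $v$, $g_{AB}$ depend only on $r$, the radial coordinate $r$ is a smooth increasing function of the polar radius of $\mathbb R^2$, and $\theta=\frac{\beta}{2\pi}\varphi$ with $\varphi$ the polar angle. Suppose that $g$ has a well-defined total mass $m$ with respect to $\bar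 g$. This means the following. In the $\bar g$-orthonormal frame $f_1=\sqrt f\,\partial_r$, $f_2=f^{-1/2}\partial_\theta$, $f_A=r^{-1}\partial_A$, put $e_{ij}=g(f_i,f_j)-\delta_{ij}$; then on some end $\{r>R_0\}$ $$ \int \Bigl(\sum_{i,j}e_{ij}^2+\sum_{i,j,k}(f_k(e_{ij}))^2\Bigr)\,r\,d\mu_{\bar g}<\infty ,\qquad \int |R(g)-R(\bar g)|\,r\,d\mu_{\bar g}<\infty , $$ $g$ and $\bar g$ are uniformly equivalent there, and the limit $$ m=\lim_{R\to\infty}\int_{r=R}\Bigl[V g^{mj}g^{i\ell}\bigl(\bar D_m g_{j\ell}-\bar D_\ell g_{jm}\bigr)+\bigl(g^{mj}g^{ki}-g^{ij}g^{km}\bigr)(g_{jm}-\bar g_{jm})\bar D_kV\Bigr]d\sigma_i $$ exists, where $d\sigma_i=\sqrt{\det\bar g}\;\partial_i\lrcorner(dx^1\wedge\dots\wedge dx^n)$. If the scalar curvature of $g$ satisfies $R\ge -n(n-1)$, then $m\ge 0$. Moreover $m=0$ if and only if $g$ coincides, up to the choice of the radial coordinate, with its asymptotic Horowitz–Myers metric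 $\bar g$, that is, $g=\Psi^*\bar g$ with $\Psi(r,\theta,x)=(\psi(r),\theta,x)$ for a smooth increasing diffeomorphism $\psi:(a,\infty)\to(r_0,\infty)$. -/

import Mathlib

open Matrix MeasureTheory Filter Topology Set
open scoped ContDiff

noncomputable section

namespace HorowitzMyers

/-! ### Riemannian geometry in a coordinate chart

A metric is a matrix-valued function of the coordinates `x : I → ℝ`. -/

section Coordinates

variable {I : Type*} [Fintype I] [DecidableEq I]

/-- The partial derivative `∂ₖ F` at `x`. -/
def pderiv (k : I) (F : (I → ℝ) → ℝ) (x : I → ℝ) : ℝ :=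
  deriv (fun t => F (Function.update x k t)) (x k)

/-- The Christoffel symbol `Γᵏᵢⱼ` of the metric `g`. -/
def christoffel (g : (I → ℝ) → Matrix I I ℝ) (k i j : I) (x : I → ℝ) : ℝ :=
  (1 / 2) * ∑ l, (g x)⁻¹ k l *
    (pderiv i (fun y => g y j l) x + pderiv j (fun y => g y i l) x
      - pderiv l (fun y => g y i j) x)

/-- The Ricci tensor `Rᵢⱼ = ∂ₖ Γᵏᵢⱼ - ∂ⱼ Γᵏᵢₖ + Γᵏₖₗ Γˡᵢⱼ - Γᵏⱼₗ Γˡᵢₖ`. -/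
def ricci (g : (I → ℝ) → Matrix I I ℝ) (i j : I) (x : I → ℝ) : ℝ :=
  ∑ k, (pderiv k (christoffel g k i j) x - pderiv j (christoffel g k i k) x
    + ∑ l, (christoffel g k k l x * christoffel g l i j x
      - christoffel g k j l x * christoffel g l i k x))

/-- The scalar curvature `R = gⁱʲ Rᵢⱼ`. -/
def scalarCurvature (g : (I → ℝ) → Matrix I I ℝ) (x : I → ℝ) : ℝ :=
  ∑ i, ∑ j, (g x)⁻¹ i j * ricci g i j x

/-- The covariant derivative `(∇ₖ h)ᵢⱼ` of a covariant two-tensor `h`, with respect to the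
Levi-Civita connection of `b`. -/
def covDeriv (b h : (I → ℝ) → Matrix I I ℝ) (k i j : I) (x : I → ℝ) : ℝ :=
  pderiv k (fun y => h y i j) x
    - ∑ p, (christoffel b p k i x * h x p j + christoffel b p k j x * h x i p)

/-- The pull-back `Φ* g` of a metric by a map between coordinate domains. -/
def pullback (Φ : (I → ℝ) → (I → ℝ)) (g : (I → ℝ) → Matrix I I ℝ) (x : I → ℝ) :
    Matrix I I ℝ :=
  let J : Matrix I I ℝ := Matrix.of fun i j => pderiv j (fun y => Φ y i) x
  Jᵀ * g (Φ x) * J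

/-- The component `Uⁱ` of the mass integrand of `g` relative to the background `b` with the
static potential `V`:
`V gᵐʲ gⁱˡ (∇ₘ gⱼₗ - ∇ₗ gⱼₘ) + (gᵐʲ gᵏⁱ - gⁱʲ gᵏᵐ) (gⱼₘ - bⱼₘ) ∂ₖ V`, where `∇` is the
Levi-Civita connection of `b`. -/
def massVector (V : (I → ℝ) → ℝ) (b g : (I → ℝ) → Matrix I I ℝ) (i : I) (x : I → ℝ) : ℝ :=
  (∑ m, ∑ j, ∑ l, V x * (g x)⁻¹ m j * (g x)⁻¹ i l *
      (covDeriv b g m j l x - covDeriv b g l j m x))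
  + ∑ m, ∑ j, ∑ k, ((g x)⁻¹ m j * (g x)⁻¹ k i - (g x)⁻¹ i j * (g x)⁻¹ k m) *
      (g x j m - b x j m) * pderiv k V x

end Coordinates

/-! ### The manifold `ℝ² × 𝕋ᵈ` of dimension `n = d + 2`

The coordinates are `(r, θ, x¹, …, xᵈ)`, or `(y¹, y², x¹, …, xᵈ)` with Cartesian coordinates on
`ℝ²`. The torus is `ℝᵈ / Λ`, where the lattice `Λ` is spanned by a basis of `ℝᵈ`. -/

/-- The index set of the coordinates. -/
abbrev Idx (d : ℕ) : Type := Fin 2 ⊕ Fin d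

/-- The index of the radial coordinate. -/
abbrev rad (d : ℕ) : Idx d := Sum.inl 0

/-- The index of the angular coordinate. -/
abbrev ang (d : ℕ) : Idx d := Sum.inl 1

/-- The point with coordinates `(r, θ, x)`. -/
def point {d : ℕ} (r θ : ℝ) (x : Fin d → ℝ) : Idx d → ℝ := Sum.elim ![r, θ] x

/-- The metric `e^{2u} dr² + e^{2v} dθ² + γ_{AB} dx^A dx^B` with coefficients depending only
on `r`. -/
def radialMetric {d : ℕ} (u v : ℝ → ℝ) (γ : ℝ → Matrix (Fin d) (Fin d) ℝ)
    (x : Idx d → ℝ) : Matrix (Idx d) (Idx d) ℝ :=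
  Matrix.fromBlocks
    (Matrix.diagonal ![Real.exp (2 * u (x (rad d))), Real.exp (2 * v (x (rad d)))]) 0
    0 (γ (x (rad d)))

/-- The function `f(r) = r² (1 - (r₀ / r)ⁿ)` with `n = d + 2`. -/
def hmF (d : ℕ) (r₀ r : ℝ) : ℝ := r ^ 2 * (1 - (r₀ / r) ^ (d + 2))

/-- The Horowitz-Myers metric `dr² / f + f dθ² + r² δ_{AB} dx^A dx^B`, on `r > r₀`. -/
def hmMetric (d : ℕ) (r₀ : ℝ) (x : Idx d → ℝ) : Matrix (Idx d) (Idx d) ℝ :=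
  Matrix.fromBlocks
    (Matrix.diagonal ![1 / hmF d r₀ (x (rad d)), hmF d r₀ (x (rad d))]) 0
    0 ((x (rad d)) ^ 2 • (1 : Matrix (Fin d) (Fin d) ℝ))

/-- The period `β = 4π / (n r₀)` of the angular coordinate `θ`, with `n = d + 2`. -/
def hmPeriod (d : ℕ) (r₀ : ℝ) : ℝ := 4 * Real.pi / ((d + 2) * r₀)

/-- The map `(ρ, φ, x) ↦ (χ(ρ), c φ, x)`. -/
def radialMap {d : ℕ} (χ : ℝ → ℝ) (c : ℝ) (x : Idx d → ℝ) : Idx d → ℝ :=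
  point (χ (x (rad d))) (c * x (ang d)) (fun A => x (Sum.inr A))

/-- Polar coordinates on the first factor: `(ρ, φ, x) ↦ (ρ cos φ, ρ sin φ, x)`. -/
def polarMap {d : ℕ} (x : Idx d → ℝ) : Idx d → ℝ :=
  point (x (rad d) * Real.cos (x (ang d))) (x (rad d) * Real.sin (x (ang d)))
    (fun A => x (Sum.inr A))

/-- `χ` restricts to an increasing smooth diffeomorphism from `(a, ∞)` onto `(b, ∞)`. -/
structure IsRadialDiffeo (χ : ℝ → ℝ) (a b : ℝ) : Prop where
  smooth : ContDiffOn ℝ ∞ χ (Ioi a)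
  deriv_pos : ∀ r, a < r → 0 < deriv χ r
  bijOn : BijOn χ (Ioi a) (Ioi b)

/-- The metric `e^{2u} dr² + e^{2v} dθ² + γ_{AB} dx^A dx^B`, with `r ∈ (a, ∞)` and with `θ` of
period `hmPeriod d r₀`, is a smooth Riemannian metric on `ℝ² × 𝕋ᵈ`: for a suitable smooth
increasing function `r = χ(ρ)` of the polar radius `ρ` of `ℝ²`, and with the polar angle
`φ = 2π θ / hmPeriod d r₀`, it is the expression in polar coordinates of a metric `G` that is
smooth and positive definite on the whole of `ℝ² × 𝕋ᵈ`, including the axis `ρ = 0`.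
(`G` is written on the cover `ℝ² × ℝᵈ`; its translation invariance along the second factor
follows from `polar`.) -/
structure IsSmoothMetric {d : ℕ} (r₀ a : ℝ) (u v : ℝ → ℝ)
    (γ : ℝ → Matrix (Fin d) (Fin d) ℝ) : Prop where
  u_smooth : ContDiffOn ℝ ∞ u (Ioi a)
  v_smooth : ContDiffOn ℝ ∞ v (Ioi a)
  γ_smooth : ∀ A B, ContDiffOn ℝ ∞ (fun r => γ r A B) (Ioi a)
  γ_posDef : ∀ r, a < r → (γ r).PosDef
  polar : ∃ (χ : ℝ → ℝ) (G : (Idx d → ℝ) → Matrix (Idx d) (Idx d) ℝ),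
    IsRadialDiffeo χ 0 a ∧
    (∀ i j, ContDiff ℝ ∞ (fun y => G y i j)) ∧
    (∀ y, (G y).PosDef) ∧
    ∀ x : Idx d → ℝ, 0 < x (rad d) →
      pullback polarMap G x =
        pullback (radialMap χ (hmPeriod d r₀ / (2 * Real.pi))) (radialMetric u v γ) x

/-! ### Asymptotics and mass -/

/-- The length factors of the orthonormal frame
`f₁ = √f ∂ᵣ`, `f₂ = (1/√f) ∂_θ`, `f_A = (1/r) ∂_A` of the Horowitz-Myers metric. -/
def hmFrame (d : ℕ) (r₀ : ℝ) (x : Idx d → ℝ) : Idx d → ℝ :=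
  point (√(hmF d r₀ (x (rad d)))) (1 / √(hmF d r₀ (x (rad d)))) (fun _ => 1 / x (rad d))

/-- The frame components `e_{ij} = g(f_i, f_j) - δ_{ij}` of the difference between `g` and the
Horowitz-Myers metric. -/
def frameDiff {d : ℕ} (r₀ : ℝ) (g : (Idx d → ℝ) → Matrix (Idx d) (Idx d) ℝ)
    (i j : Idx d) (x : Idx d → ℝ) : ℝ :=
  hmFrame d r₀ x i * hmFrame d r₀ x j * g x i j - (1 : Matrix (Idx d) (Idx d) ℝ) i j

/-- The static potential `V = r` of the Horowitz-Myers metric. -/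
def hmPotential (d : ℕ) (x : Idx d → ℝ) : ℝ := x (rad d)

/-- The Riemannian density `√(det g)`. -/
def volDensity {d : ℕ} (g : (Idx d → ℝ) → Matrix (Idx d) (Idx d) ℝ) (x : Idx d → ℝ) : ℝ :=
  √((g x).det)

/-- The integral of a nonnegative function over the end `{r > R₀}` of `ℝ² × ℝᵈ/Λ`, with respect
to the Riemannian measure of the Horowitz-Myers metric. -/
def endIntegral {d : ℕ} (Λ : Module.Basis (Fin d) ℝ (Fin d → ℝ)) (r₀ R₀ : ℝ)
    (F : (Idx d → ℝ) → ℝ) : ENNReal :=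
  ∫⁻ r in Ioi R₀, ∫⁻ θ in Ioc 0 (hmPeriod d r₀), ∫⁻ x in ZSpan.fundamentalDomain Λ,
    ENNReal.ofReal (F (point r θ x) * volDensity (hmMetric d r₀) (point r θ x))

/-- The integral over `{r = R}` of the mass integrand of `g` with respect to the Horowitz-Myers
metric, `∫ Uⁱ dσᵢ` with `dσᵢ = √(det b) ∂ᵢ ⌟ (dr ∧ dθ ∧ dx¹ ∧ ⋯ ∧ dxᵈ)`, `b` the
background; only `i = r` contributes. -/
def massIntegral {d : ℕ} (Λ : Module.Basis (Fin d) ℝ (Fin d → ℝ)) (r₀ : ℝ)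
    (g : (Idx d → ℝ) → Matrix (Idx d) (Idx d) ℝ) (R : ℝ) : ℝ :=
  ∫ θ in Ioc 0 (hmPeriod d r₀), ∫ x in ZSpan.fundamentalDomain Λ,
    massVector (hmPotential d) (hmMetric d r₀) g (rad d) (point R θ x)
      * volDensity (hmMetric d r₀) (point R θ x)

/-- `g` has the well-defined total mass `M` with respect to the Horowitz-Myers metric of
parameter `r₀`: the Chruściel-Herzlich asymptotic conditions hold on some end `{r > R₀}`, and the
mass integrals converge to `M`. -/
structure HasTotalMass {d : ℕ} (Λ : Module.Basis (Fin d) ℝ (Fin d → ℝ)) (r₀ : ℝ)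
    (g : (Idx d → ℝ) → Matrix (Idx d) (Idx d) ℝ) (M : ℝ) : Prop where
  asymptotic : ∃ R₀ : ℝ, r₀ < R₀ ∧
    endIntegral Λ r₀ R₀ (fun x => ((∑ i, ∑ j, frameDiff r₀ g i j x ^ 2)
      + ∑ k, ∑ i, ∑ j, (hmFrame d r₀ x k * pderiv k (frameDiff r₀ g i j) x) ^ 2)
        * hmPotential d x) < ⊤ ∧
    endIntegral Λ r₀ R₀ (fun x =>
      |scalarCurvature g x - scalarCurvature (hmMetric d r₀) x| * hmPotential d x) < ⊤ ∧
    ∃ C : ℝ, 0 < C ∧ ∀ x : Idx d → ℝ, R₀ < x (rad d) →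
      (C • g x - hmMetric d r₀ x).PosSemidef ∧ (C • hmMetric d r₀ x - g x).PosSemidef
  tendsto : Tendsto (massIntegral Λ r₀ g) atTop (𝓝 M)

/-- `g`, given on `r > a`, coincides with the Horowitz-Myers metric of parameter `r₀`, up to the
choice of the radial coordinate: `g` is the pull-back of the latter by
`(r, θ, x) ↦ (ψ(r), θ, x)` for an increasing smooth diffeomorphism `ψ : (a, ∞) → (r₀, ∞)`. -/
def CoincidesWithHM {d : ℕ} (r₀ a : ℝ) (g : (Idx d → ℝ) → Matrix (Idx d) (Idx d) ℝ) : Prop :=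
  ∃ ψ : ℝ → ℝ, IsRadialDiffeo ψ a r₀ ∧
    ∀ x : Idx d → ℝ, a < x (rad d) → g x = pullback (radialMap ψ 1) (hmMetric d r₀) x

end HorowitzMyers

end

open HorowitzMyers

set_option linter.unusedSectionVars false

noncomputable section

namespace HorowitzMyers

/-! ### Calculus of positive definite matrices depending on one real parameter. -/

section Family
variable {I : Type*} [Fintype I] [DecidableEq I]

/-! Write n = d + 2, let H be the mean curvature of the level sets of r, A their second fundamental
form and κ their coordinate volume. These level sets are flat, so R = -2 e^{-u} H' - H² - |A|², and
the bound on R is a Riccati inequality for H (`riccati_le`).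

On a Horowitz-Myers metric H = (n c + d / c) / 2 with c = (1 - (r₀/r)ⁿ)^{-1/2}, and W = e^{n v} c^d
(c² - 1) is identically r₀ⁿ. For a general metric, c is defined from H by the same relation wherever
H > n - 1. Completing a square (`slope_identity`) turns the Riccati inequality into W' ≤ 0, the
defect being a square plus the trace-free part of A on the torus.

At the axis W tends to r₀ⁿ; this is where smoothness of the metric and the period of θ enter
(`exists_tendsto_hmQuantity_axis`). At infinity 2 rⁿ (H - (n - 1)), and with it W, tends to r₀ⁿ -
m/κ (`exists_filter_tendsto`, `tendsto_hmQuantity`). Monotonicity gives m ≥ 0. If H ≤ n - 1 at some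
radius, this persists outwards (`trapped_persists`), and the same limit gives m ≥ κ r₀ⁿ > 0.

The decay hypotheses are integrals, so pointwise decay is available only along some filter F ≤
`atTop`. This suffices: the mass limit exists along `atTop`, and W is monotone. Along F the frame
differences are o(r^{-n/2}), so quadratic errors in the mass integrand disappear.

If m = 0, then W is constant and every discarded term vanishes. The resulting first-order equations
are integrated with the radius ψ = e^v c (`coincides_of_hmQuantity_eq`). -/

/-- The entrywise derivative of a matrix-valued function of a real variable. -/
def matDeriv (m : ℝ → Matrix I I ℝ) (r : ℝ) : Matrix I I ℝ :=
  Matrix.of fun i j => deriv (fun t => m t i j) r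

theorem contDiffOn_det {s : Set ℝ} {m : ℝ → Matrix I I ℝ}
    (h : ∀ i j, ContDiffOn ℝ ∞ (fun r => m r i j) s) :
    ContDiffOn ℝ ∞ (fun r => (m r).det) s := by
  simp only [Matrix.det_apply']
  exact ContDiffOn.sum fun σ _ => contDiffOn_const.mul (contDiffOn_prod fun i _ => h _ _)

theorem contDiffOn_inv_apply {s : Set ℝ} {m : ℝ → Matrix I I ℝ}
    (h : ∀ i j, ContDiffOn ℝ ∞ (fun r => m r i j) s) (hd : ∀ r ∈ s, (m r).det ≠ 0) (i j : I) :
    ContDiffOn ℝ ∞ (fun r => (m r)⁻¹ i j) s := by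
  simp only [Matrix.inv_def, Ring.inverse_eq_inv', Matrix.smul_apply, smul_eq_mul,
    Matrix.adjugate_apply]
  refine ((contDiffOn_det h).inv hd).mul (contDiffOn_det fun k l => ?_)
  by_cases hk : k = j
  · subst hk; simpa using contDiffOn_const
  · simpa [Matrix.updateRow_ne hk] using h k l

theorem contDiffOn_matDeriv {s : Set ℝ} (hs : IsOpen s) {m : ℝ → Matrix I I ℝ}
    (h : ∀ i j, ContDiffOn ℝ ∞ (fun r => m r i j) s) (i j : I) :
    ContDiffOn ℝ ∞ (fun r => matDeriv m r i j) s :=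
  ((contDiffOn_infty_iff_deriv_of_isOpen hs).1 (h i j)).2

theorem hasDerivAt_of_contDiffOn {s : Set ℝ} (hs : IsOpen s) {φ : ℝ → ℝ}
    (h : ContDiffOn ℝ ∞ φ s) {r : ℝ} (hr : r ∈ s) : HasDerivAt φ (deriv φ r) r :=
  ((h.contDiffAt (hs.mem_nhds hr)).differentiableAt (by simp)).hasDerivAt

/-- A smooth family of positive definite matrices on an open set of parameters, in which the
index `ρ` is orthogonal to the others. -/
structure IsRadialFamily (ρ : I) (m : ℝ → Matrix I I ℝ) (s : Set ℝ) : Prop where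
  isOpen : IsOpen s
  smooth : ∀ i j, ContDiffOn ℝ ∞ (fun r => m r i j) s
  posDef : ∀ r ∈ s, (m r).PosDef
  ortho : ∀ r ∈ s, ∀ j, j ≠ ρ → m r ρ j = 0

variable {ρ : I} {m : ℝ → Matrix I I ℝ} {s : Set ℝ}

namespace IsRadialFamily

variable (h : IsRadialFamily ρ m s)
include h

theorem det_ne_zero {r : ℝ} (hr : r ∈ s) : (m r).det ≠ 0 := (h.posDef r hr).det_pos.ne'

theorem symm {r : ℝ} (hr : r ∈ s) (i j : I) : m r i j = m r j i := by
  simpa using ((h.posDef r hr).isHermitian.apply j i)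

theorem inv_symm {r : ℝ} (hr : r ∈ s) (i j : I) : (m r)⁻¹ i j = (m r)⁻¹ j i := by
  simpa using ((h.posDef r hr).inv.isHermitian.apply j i)

theorem row_apply {r : ℝ} (hr : r ∈ s) (j : I) :
    m r ρ j = if j = ρ then m r ρ ρ else 0 := by
  split_ifs with hj
  · rw [hj]
  · exact h.ortho r hr j hj

theorem inv_mul_diag {r : ℝ} (hr : r ∈ s) : (m r)⁻¹ ρ ρ * m r ρ ρ = 1 := by
  have := congrFun₂ (Matrix.mul_nonsing_inv (m r) (h.det_ne_zero hr).isUnit) ρ ρ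
  rw [Matrix.mul_apply, Finset.sum_congr rfl fun k _ => by rw [h.row_apply hr k]] at this
  simpa [mul_comm] using this

theorem inv_row_apply {r : ℝ} (hr : r ∈ s) (j : I) :
    (m r)⁻¹ ρ j = if j = ρ then (m r)⁻¹ ρ ρ else 0 := by
  split_ifs with hj
  · rw [hj]
  have := congrFun₂ (Matrix.mul_nonsing_inv (m r) (h.det_ne_zero hr).isUnit) ρ j
  rw [Matrix.mul_apply, Finset.sum_congr rfl fun k _ => by rw [h.row_apply hr k]] at this
  have h0 : m r ρ ρ ≠ 0 := right_ne_zero_of_mul_eq_one (h.inv_mul_diag hr)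
  simpa [Ne.symm hj, h0] using this

theorem deriv_symm {r : ℝ} (hr : r ∈ s) (i j : I) : matDeriv m r i j = matDeriv m r j i := by
  refine Filter.EventuallyEq.deriv_eq ?_
  filter_upwards [h.isOpen.mem_nhds hr] with t ht using h.symm ht i j

theorem deriv_row_apply {r : ℝ} (hr : r ∈ s) (j : I) :
    matDeriv m r ρ j = if j = ρ then matDeriv m r ρ ρ else 0 := by
  split_ifs with hj
  · rw [hj]
  · have : (fun t => m t ρ j) =ᶠ[𝓝 r] fun _ => 0 := by
      filter_upwards [h.isOpen.mem_nhds hr] with t ht using h.ortho t ht j hj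
    simp [matDeriv, this.deriv_eq]

theorem hasDerivAt {r : ℝ} (hr : r ∈ s) (i j : I) :
    HasDerivAt (fun t => m t i j) (matDeriv m r i j) r :=
  hasDerivAt_of_contDiffOn h.isOpen (h.smooth i j) hr

theorem matDeriv_hasDerivAt {r : ℝ} (hr : r ∈ s) (i j : I) :
    HasDerivAt (fun t => matDeriv m t i j) (matDeriv (matDeriv m) r i j) r :=
  hasDerivAt_of_contDiffOn h.isOpen (contDiffOn_matDeriv h.isOpen h.smooth i j) hr

/-- Differentiate m⁻¹ m = 1. The entries of m⁻¹ are already known to be smooth, as cofactors over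
the determinant. -/
theorem inv_hasDerivAt {r : ℝ} (hr : r ∈ s) (i j : I) :
    HasDerivAt (fun t => (m t)⁻¹ i j) (-((m r)⁻¹ * matDeriv m r * (m r)⁻¹) i j) r := by
  have hi : ∀ i j, HasDerivAt (fun t => (m t)⁻¹ i j)
      (matDeriv (fun t => (m t)⁻¹) r i j) r := fun i j =>
    hasDerivAt_of_contDiffOn h.isOpen
      (contDiffOn_inv_apply h.smooth (fun r hr => h.det_ne_zero hr) i j) hr
  have key : matDeriv (fun t => (m t)⁻¹) r * m r + (m r)⁻¹ * matDeriv m r = 0 := by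
    ext i j
    have h1 : HasDerivAt (fun t => ∑ k, (m t)⁻¹ i k * m t k j)
        (∑ k, (matDeriv (fun t => (m t)⁻¹) r i k * m r k j
          + (m r)⁻¹ i k * matDeriv m r k j)) r :=
      HasDerivAt.fun_sum fun k _ => (hi i k).mul (h.hasDerivAt hr k j)
    have h2 : (fun t => ∑ k, (m t)⁻¹ i k * m t k j) =ᶠ[𝓝 r]
        fun _ => (1 : Matrix I I ℝ) i j := by
      filter_upwards [h.isOpen.mem_nhds hr] with t ht
      rw [← Matrix.nonsing_inv_mul (m t) (h.det_ne_zero ht).isUnit, Matrix.mul_apply]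
    have h3 := h1.unique ((hasDerivAt_const r _).congr_of_eventuallyEq h2)
    simpa [Matrix.mul_apply, Finset.sum_add_distrib] using h3
  have h4 : matDeriv (fun t => (m t)⁻¹) r = -((m r)⁻¹ * matDeriv m r * (m r)⁻¹) := by
    have := congrArg (· * (m r)⁻¹) key
    simp only [Matrix.add_mul, Matrix.zero_mul, Matrix.mul_assoc,
      Matrix.mul_nonsing_inv (m r) (h.det_ne_zero hr).isUnit, Matrix.mul_one] at this
    rw [eq_neg_of_add_eq_zero_left this, Matrix.mul_assoc]
  have := hi i j
  rwa [h4] at this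

end IsRadialFamily
end Family

/-! ### Curvature of a metric that depends on one coordinate, orthogonal to the others. -/

section Curvature
variable {I : Type*} [Fintype I] [DecidableEq I]

theorem pderiv_comp_apply (ρ k : I) (φ : ℝ → ℝ) (x : I → ℝ) :
    pderiv k (fun y => φ (y ρ)) x = if k = ρ then deriv φ (x ρ) else 0 := by
  unfold pderiv
  split_ifs with hk
  · subst hk; simp
  · simp [Function.update_of_ne (Ne.symm hk)]

/-- The mixed components `m⁻¹ m'`. -/
def mixedDeriv (m : ℝ → Matrix I I ℝ) (r : ℝ) : Matrix I I ℝ := (m r)⁻¹ * matDeriv m r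

/-- The Christoffel symbols of the metric `x ↦ m (x ρ)`. -/
def radialChristoffel (ρ : I) (m : ℝ → Matrix I I ℝ) (k i j : I) (r : ℝ) : ℝ :=
  (1 / 2) * ((if i = ρ then mixedDeriv m r k j else 0) + (if j = ρ then mixedDeriv m r k i else 0)
    - if k = ρ then (m r)⁻¹ ρ ρ * matDeriv m r i j else 0)

variable {ρ : I} {m : ℝ → Matrix I I ℝ} {s : Set ℝ}

namespace IsRadialFamily
variable (h : IsRadialFamily ρ m s)
include h

theorem inv_row_sum {r : ℝ} (hr : r ∈ s) (X : I → ℝ) :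
    ∑ k, (m r)⁻¹ ρ k * X k = (m r)⁻¹ ρ ρ * X ρ :=
  Finset.sum_eq_single ρ (fun k _ hk => by rw [h.inv_row_apply hr, if_neg hk, zero_mul]) (by simp)

theorem deriv_col_apply {r : ℝ} (hr : r ∈ s) (j : I) :
    matDeriv m r j ρ = if j = ρ then matDeriv m r ρ ρ else 0 := by
  rw [h.deriv_symm hr, h.deriv_row_apply hr]

theorem mixedDeriv_row {r : ℝ} (hr : r ∈ s) (j : I) :
    mixedDeriv m r ρ j = if j = ρ then mixedDeriv m r ρ ρ else 0 := by
  simp only [mixedDeriv, Matrix.mul_apply, h.inv_row_sum hr]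
  rw [h.deriv_row_apply hr]; simp

theorem mixedDeriv_diag {r : ℝ} (hr : r ∈ s) :
    mixedDeriv m r ρ ρ = (m r)⁻¹ ρ ρ * matDeriv m r ρ ρ := by
  simp only [mixedDeriv, Matrix.mul_apply, h.inv_row_sum hr]

theorem mixedDeriv_col {r : ℝ} (hr : r ∈ s) (j : I) :
    mixedDeriv m r j ρ = if j = ρ then mixedDeriv m r ρ ρ else 0 := by
  split_ifs with hj
  · rw [hj]
  simp only [mixedDeriv, Matrix.mul_apply]
  refine Finset.sum_eq_zero fun k _ => ?_
  rw [h.deriv_col_apply hr]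
  split_ifs with hk
  · rw [hk, h.inv_symm hr, h.inv_row_apply hr, if_neg hj, zero_mul]
  · rw [mul_zero]

theorem mixedDeriv_row_sum {r : ℝ} (hr : r ∈ s) (X : I → ℝ) :
    ∑ k, mixedDeriv m r ρ k * X k = mixedDeriv m r ρ ρ * X ρ :=
  Finset.sum_eq_single ρ (fun k _ hk => by rw [h.mixedDeriv_row hr, if_neg hk, zero_mul]) (by simp)

/-- Only ∂_ρ acts nontrivially on the coefficients, and the ρ-row of the inverse metric is diagonal,
so each of the three terms keeps a single Kronecker delta. -/
theorem christoffel_eq {x : I → ℝ} (hx : x ρ ∈ s) (k i j : I) :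
    christoffel (fun y => m (y ρ)) k i j x = radialChristoffel ρ m k i j (x ρ) := by
  simp only [christoffel, radialChristoffel]
  simp_rw [fun k i j => pderiv_comp_apply ρ k (fun t => m t i j) x]
  congr 1
  simp only [mul_sub, mul_add, Finset.sum_sub_distrib, Finset.sum_add_distrib, mul_ite, mul_zero,
    Finset.sum_ite_irrel, Finset.sum_const_zero, Finset.sum_ite_eq', Finset.mem_univ, if_true]
  congr 2
  · simp only [mixedDeriv, Matrix.mul_apply]
    congr 1
    exact Finset.sum_congr rfl fun l _ => congrArg _ (h.deriv_symm hx j l)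
  · simp only [mixedDeriv, Matrix.mul_apply]
    congr 1
    exact Finset.sum_congr rfl fun l _ => congrArg _ (h.deriv_symm hx i l)
  · rw [h.inv_symm hx k, h.inv_row_apply hx]
    split_ifs <;> simp [matDeriv]

theorem mixedDeriv_hasDerivAt {r : ℝ} (hr : r ∈ s) (i j : I) :
    HasDerivAt (fun t => mixedDeriv m t i j)
      (((m r)⁻¹ * matDeriv (matDeriv m) r - mixedDeriv m r * mixedDeriv m r) i j) r := by
  have h1 : HasDerivAt (fun t => ∑ k, (m t)⁻¹ i k * matDeriv m t k j)
      (∑ k, ((-((m r)⁻¹ * matDeriv m r * (m r)⁻¹)) i k * matDeriv m r k j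
          + (m r)⁻¹ i k * matDeriv (matDeriv m) r k j)) r :=
      HasDerivAt.fun_sum fun k _ => (h.inv_hasDerivAt hr i k).mul (h.matDeriv_hasDerivAt hr k j)
  change HasDerivAt (fun t => ((m t)⁻¹ * matDeriv m t) i j) _ r
  simp only [Matrix.mul_apply]
  refine h1.congr_deriv ?_
  rw [Finset.sum_add_distrib, ← Matrix.mul_apply, ← Matrix.mul_apply, ← Matrix.add_apply]
  simp only [mixedDeriv, Matrix.mul_assoc, Matrix.neg_mul]
  rw [sub_eq_neg_add]

theorem trace_mixedDeriv_hasDerivAt {r : ℝ} (hr : r ∈ s) :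
    HasDerivAt (fun t => (mixedDeriv m t).trace)
      (((m r)⁻¹ * matDeriv (matDeriv m) r).trace
        - (mixedDeriv m r * mixedDeriv m r).trace) r := by
  rw [← Matrix.trace_sub]
  exact HasDerivAt.fun_sum fun i _ => h.mixedDeriv_hasDerivAt hr i i

theorem radialChristoffel_row {r : ℝ} (hr : r ∈ s) (i j : I) :
    radialChristoffel ρ m ρ i j r = (if i = ρ ∧ j = ρ then mixedDeriv m r ρ ρ else 0)
      - (1 / 2) * ((m r)⁻¹ ρ ρ * matDeriv m r i j) := by
  simp only [radialChristoffel, if_true]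
  rw [h.mixedDeriv_row hr i, h.mixedDeriv_row hr j]
  by_cases hi : i = ρ <;> by_cases hj : j = ρ <;> simp [hi, hj] <;> ring

theorem sum_radialChristoffel {r : ℝ} (hr : r ∈ s) (i : I) :
    ∑ k, radialChristoffel ρ m k i k r
      = (1 / 2) * if i = ρ then (mixedDeriv m r).trace else 0 := by
  simp only [radialChristoffel, ← Finset.mul_sum, Finset.sum_sub_distrib, Finset.sum_add_distrib,
    Finset.sum_ite_irrel, Finset.sum_const_zero, Finset.sum_ite_eq', Finset.mem_univ, if_true]
  rw [h.mixedDeriv_row hr i, h.deriv_symm hr i ρ, h.deriv_row_apply hr i]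
  by_cases hi : i = ρ <;> simp [hi, h.mixedDeriv_diag hr, Matrix.trace]

theorem radialChristoffel_symm {r : ℝ} (hr : r ∈ s) (k i j : I) :
    radialChristoffel ρ m k i j r = radialChristoffel ρ m k j i r := by
  simp only [radialChristoffel, h.deriv_symm hr i j]
  ring

/-- The quadratic term Γᵏⱼₗ Γˡᵢₖ of the Ricci tensor. -/
theorem sum_radialChristoffel_mul {r : ℝ} (hr : r ∈ s) (i j : I) :
    ∑ k, ∑ l, radialChristoffel ρ m k j l r * radialChristoffel ρ m l i k r
      = (1 / 4) * ((if i = ρ ∧ j = ρ then (mixedDeriv m r * mixedDeriv m r).trace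
          + 2 * mixedDeriv m r ρ ρ ^ 2 else 0)
        - 2 * ((m r)⁻¹ ρ ρ * (matDeriv m r * mixedDeriv m r) i j)) := by
  have hDN : ∀ i j, (matDeriv m r * mixedDeriv m r) i j = (matDeriv m r * mixedDeriv m r) j i := by
    have : (matDeriv m r * mixedDeriv m r)ᵀ = matDeriv m r * mixedDeriv m r := by
      have h1 : (matDeriv m r)ᵀ = matDeriv m r := by ext i j; exact h.deriv_symm hr j i
      have h2 : ((m r)⁻¹)ᵀ = (m r)⁻¹ := by ext i j; exact h.inv_symm hr j i
      simp [mixedDeriv, Matrix.transpose_mul, h1, h2, Matrix.mul_assoc]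
    intro i j; exact congrFun₂ this j i
  have e1 : ∀ i j, ∑ x, mixedDeriv m r x j * matDeriv m r i x
      = (matDeriv m r * mixedDeriv m r) i j := fun i j => by
    rw [Matrix.mul_apply]; exact Finset.sum_congr rfl fun x _ => mul_comm _ _
  have e2 : ∀ i j, ∑ x, matDeriv m r i x * mixedDeriv m r x j
      = (matDeriv m r * mixedDeriv m r) i j := fun i j => (Matrix.mul_apply ..).symm
  have e3 : ∑ x, ∑ y, mixedDeriv m r x y * mixedDeriv m r y x
      = (mixedDeriv m r * mixedDeriv m r).trace := by
    simp [Matrix.trace, Matrix.mul_apply]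
  -- Each symbol has three summands; these are the nine products, with the deltas arranged so that
  -- the sums over k and l collapse.
  have key : ∀ k l, radialChristoffel ρ m k j l r * radialChristoffel ρ m l i k r
     = (1 / 4) * (
        (if j = ρ then if i = ρ then mixedDeriv m r k l * mixedDeriv m r l k else 0 else 0)
      + (if j = ρ then if k = ρ then mixedDeriv m r ρ l * mixedDeriv m r l i else 0 else 0)
      - (if j = ρ then if l = ρ then mixedDeriv m r k ρ * ((m r)⁻¹ ρ ρ * matDeriv m r i k) else 0 else 0)
      + (if i = ρ then if l = ρ then mixedDeriv m r k j * mixedDeriv m r ρ k else 0 else 0)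
      + (if l = ρ then if k = ρ then mixedDeriv m r ρ j * mixedDeriv m r ρ i else 0 else 0)
      - (if l = ρ then mixedDeriv m r k j * ((m r)⁻¹ ρ ρ * matDeriv m r i k) else 0)
      - (if i = ρ then if k = ρ then (m r)⁻¹ ρ ρ * matDeriv m r j l * mixedDeriv m r l ρ else 0 else 0)
      - (if k = ρ then (m r)⁻¹ ρ ρ * matDeriv m r j l * mixedDeriv m r l i else 0)
      + (if l = ρ then if k = ρ then (m r)⁻¹ ρ ρ * matDeriv m r j ρ * ((m r)⁻¹ ρ ρ * matDeriv m r i ρ)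
          else 0 else 0)) := by
    intro k l
    simp only [radialChristoffel]
    by_cases hi : i = ρ <;> by_cases hj : j = ρ <;> by_cases hk : k = ρ <;> by_cases hl : l = ρ <;>
      simp only [hi, hj, hk, hl, if_true, if_false] <;> ring
  simp_rw [key]
  simp only [← Finset.mul_sum, Finset.sum_sub_distrib, Finset.sum_add_distrib,
    Finset.sum_ite_irrel, Finset.sum_const_zero, Finset.sum_ite_eq', Finset.mem_univ, if_true, e3,
    mul_left_comm _ ((m r)⁻¹ ρ ρ), mul_assoc, e1, e2]
  have f1 : ∀ i, ∑ x, mixedDeriv m r ρ x * mixedDeriv m r x i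
     = if i = ρ then mixedDeriv m r ρ ρ ^ 2 else 0 := by
    intro i
    rw [h.mixedDeriv_row_sum hr, h.mixedDeriv_row hr i, mul_ite, mul_zero, sq]
  have f2 : ∀ j, ∑ x, mixedDeriv m r x j * mixedDeriv m r ρ x
     = if j = ρ then mixedDeriv m r ρ ρ ^ 2 else 0 := by
    intro j; rw [← f1 j]; exact Finset.sum_congr rfl fun x _ => mul_comm _ _
  have f3 : ∀ i, (matDeriv m r * mixedDeriv m r) i ρ
     = if i = ρ then matDeriv m r ρ ρ * mixedDeriv m r ρ ρ else 0 := by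
    intro i
    rw [Matrix.mul_apply, Finset.sum_eq_single ρ
      (fun k _ hk => by rw [h.mixedDeriv_col hr, if_neg hk, mul_zero]) (by simp),
      h.deriv_col_apply hr i, ite_mul, zero_mul]
  rw [f1, f2, f3 i, f3 j, h.deriv_col_apply hr i, h.deriv_col_apply hr j, h.mixedDeriv_row hr i, h.mixedDeriv_row hr j, hDN j i,
    h.mixedDeriv_diag hr]
  by_cases hi : i = ρ <;> by_cases hj : j = ρ <;> simp only [hi, hj, if_true, if_false, and_true,
    and_false, mul_zero, zero_mul] <;> ring

/-- No normalisation of m_{ρρ} is made; the terms with the (ρ, ρ) entry of m⁻¹ m' account for the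
lapse. -/
theorem ricci_eq {x : I → ℝ} (hx : x ρ ∈ s) (i j : I) :
    ricci (fun y => m (y ρ)) i j x =
      (if i = ρ ∧ j = ρ then deriv (fun t => mixedDeriv m t ρ ρ) (x ρ)
        - (1 / 2) * deriv (fun t => (mixedDeriv m t).trace) (x ρ)
        + (1 / 2) * (mixedDeriv m (x ρ)).trace * mixedDeriv m (x ρ) ρ ρ
        - (1 / 4) * (mixedDeriv m (x ρ) * mixedDeriv m (x ρ)).trace
        - (1 / 2) * mixedDeriv m (x ρ) ρ ρ ^ 2 else 0)
      + (m (x ρ))⁻¹ ρ ρ * ((1 / 2) * mixedDeriv m (x ρ) ρ ρ * matDeriv m (x ρ) i j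
        - (1 / 2) * matDeriv (matDeriv m) (x ρ) i j
        - (1 / 4) * (mixedDeriv m (x ρ)).trace * matDeriv m (x ρ) i j
        + (1 / 2) * (matDeriv m (x ρ) * mixedDeriv m (x ρ)) i j) := by
  have hnb : ∀ᶠ t in 𝓝 (x ρ), t ∈ s := h.isOpen.mem_nhds hx
  have hP : ∀ q k i j, pderiv q (christoffel (fun y => m (y ρ)) k i j) x
      = if q = ρ then deriv (radialChristoffel ρ m k i j) (x ρ) else 0 := by
    intro q k i j
    rw [← pderiv_comp_apply]
    refine Filter.EventuallyEq.deriv_eq ?_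
    have : Tendsto (fun t => Function.update x q t ρ) (𝓝 (x q)) (𝓝 (x ρ)) := by
      have : Continuous fun t => Function.update x q t ρ := by fun_prop
      simpa using this.tendsto (x q)
    filter_upwards [this hnb] with t ht using h.christoffel_eq ht k i j
  have hd1 : deriv (fun t => radialChristoffel ρ m ρ i j t) (x ρ)
      = (if i = ρ ∧ j = ρ then deriv (fun t => mixedDeriv m t ρ ρ) (x ρ) else 0)
        - (1 / 2) * (-((m (x ρ))⁻¹ ρ ρ * mixedDeriv m (x ρ) ρ ρ) * matDeriv m (x ρ) i j
          + (m (x ρ))⁻¹ ρ ρ * matDeriv (matDeriv m) (x ρ) i j) := by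
    have e : (fun t => radialChristoffel ρ m ρ i j t) =ᶠ[𝓝 (x ρ)] fun t =>
        (if i = ρ ∧ j = ρ then mixedDeriv m t ρ ρ else 0)
          - (1 / 2) * ((m t)⁻¹ ρ ρ * matDeriv m t i j) := by
      filter_upwards [hnb] with t ht using h.radialChristoffel_row ht i j
    rw [e.deriv_eq]
    -- The (ρ, ρ) entry of -(m⁻¹ m' m⁻¹), where only the diagonal entry of the ρ-row contributes.
    have hw : HasDerivAt (fun t => (m t)⁻¹ ρ ρ)
        (-((m (x ρ))⁻¹ ρ ρ * mixedDeriv m (x ρ) ρ ρ)) (x ρ) := by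
      refine (h.inv_hasDerivAt hx ρ ρ).congr_deriv ?_
      change -((mixedDeriv m (x ρ) * (m (x ρ))⁻¹) ρ ρ) = _
      rw [Matrix.mul_apply, h.mixedDeriv_row_sum hx, mul_comm]
    have h2 := (hw.mul (h.matDeriv_hasDerivAt hx i j)).const_mul (1 / 2 : ℝ)
    by_cases hij : i = ρ ∧ j = ρ
    · simp only [hij]
      simp only [hij] at h2
      exact ((h.mixedDeriv_hasDerivAt hx ρ ρ).differentiableAt.hasDerivAt.sub h2).deriv
    · simp only [hij, if_false]
      exact ((hasDerivAt_const _ (0 : ℝ)).sub h2).deriv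
  have hd2 : ∑ k, pderiv j (christoffel (fun y => m (y ρ)) k i k) x
      = if i = ρ ∧ j = ρ then (1 / 2) * deriv (fun t => (mixedDeriv m t).trace) (x ρ) else 0 := by
    simp_rw [hP, Finset.sum_ite_irrel]
    by_cases hj : j = ρ
    · have hd : ∀ k, DifferentiableAt ℝ (radialChristoffel ρ m k i k) (x ρ) := by
        intro k
        have a1 := fun a b => (h.mixedDeriv_hasDerivAt hx a b).differentiableAt
        have a2 := ((h.inv_hasDerivAt hx ρ ρ).mul (h.matDeriv_hasDerivAt hx i k)).differentiableAt
        unfold radialChristoffel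
        refine ((DifferentiableAt.add ?_ ?_).sub ?_).const_mul _ <;>
          split_ifs <;> first | exact a1 _ _ | exact a2 | exact differentiableAt_const _
      simp only [hj, if_true, and_true]
      rw [← deriv_fun_sum fun k _ => hd k]
      have e : (fun t => ∑ k, radialChristoffel ρ m k i k t) =ᶠ[𝓝 (x ρ)] fun t =>
          (1 / 2) * if i = ρ then (mixedDeriv m t).trace else 0 := by
        filter_upwards [hnb] with t ht using h.sum_radialChristoffel ht i
      rw [e.deriv_eq]
      by_cases hi : i = ρ
      · simp only [hi, if_true]
        exact ((h.trace_mixedDeriv_hasDerivAt hx).differentiableAt.hasDerivAt.const_mul _).deriv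
      · simp [hi]
    · simp [hj]
  have hd3 : ∑ k, ∑ l, christoffel (fun y => m (y ρ)) k k l x
        * christoffel (fun y => m (y ρ)) l i j x
      = (1 / 2) * (mixedDeriv m (x ρ)).trace * radialChristoffel ρ m ρ i j (x ρ) := by
    rw [Finset.sum_comm]
    simp_rw [h.christoffel_eq hx, ← Finset.sum_mul]
    simp_rw [fun k l => h.radialChristoffel_symm hx k k l, h.sum_radialChristoffel hx]
    simp
  have hd4 := h.sum_radialChristoffel_mul hx i j
  simp_rw [← h.christoffel_eq hx] at hd4
  unfold ricci
  simp only [Finset.sum_add_distrib, Finset.sum_sub_distrib]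
  rw [hd2, hd3, hd4]
  simp_rw [hP]
  simp only [Finset.sum_ite_eq', Finset.mem_univ, if_true]
  rw [hd1, h.radialChristoffel_row hx i j]
  by_cases hij : i = ρ ∧ j = ρ
  · simp only [hij]; simp; ring
  · simp only [hij, if_false]; ring

theorem sum_inv_mul {r : ℝ} (hr : r ∈ s) (X : Matrix I I ℝ) :
    ∑ i, ∑ j, (m r)⁻¹ i j * X i j = ((m r)⁻¹ * X).trace := by
  simp only [Matrix.trace, Matrix.diag, Matrix.mul_apply]
  rw [Finset.sum_comm]
  exact Finset.sum_congr rfl fun i _ => Finset.sum_congr rfl fun j _ => by rw [h.inv_symm hr]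

/-- Trace of `ricci_eq`. The second derivative m'' enters only through tr(m⁻¹ m'') = (tr m⁻¹ m')' +
tr (m⁻¹ m')², so the result involves m⁻¹ m' alone. -/
theorem scalarCurvature_eq {x : I → ℝ} (hx : x ρ ∈ s) :
    scalarCurvature (fun y => m (y ρ)) x = (m (x ρ))⁻¹ ρ ρ *
      (deriv (fun t => mixedDeriv m t ρ ρ) (x ρ)
        + mixedDeriv m (x ρ) ρ ρ * (mixedDeriv m (x ρ)).trace
        - deriv (fun t => (mixedDeriv m t).trace) (x ρ)
        - (1 / 4) * (mixedDeriv m (x ρ)).trace ^ 2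
        - (1 / 4) * (mixedDeriv m (x ρ) * mixedDeriv m (x ρ)).trace
        - (1 / 2) * mixedDeriv m (x ρ) ρ ρ ^ 2) := by
  have htr : ((m (x ρ))⁻¹ * matDeriv (matDeriv m) (x ρ)).trace
      = deriv (fun t => (mixedDeriv m t).trace) (x ρ)
        + (mixedDeriv m (x ρ) * mixedDeriv m (x ρ)).trace := by
    rw [(h.trace_mixedDeriv_hasDerivAt hx).deriv]; ring
  unfold scalarCurvature
  simp_rw [h.ricci_eq hx]
  generalize hA : deriv (fun t => mixedDeriv m t ρ ρ) (x ρ)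
        - (1 / 2) * deriv (fun t => (mixedDeriv m t).trace) (x ρ)
        + (1 / 2) * (mixedDeriv m (x ρ)).trace * mixedDeriv m (x ρ) ρ ρ
        - (1 / 4) * (mixedDeriv m (x ρ) * mixedDeriv m (x ρ)).trace
        - (1 / 2) * mixedDeriv m (x ρ) ρ ρ ^ 2 = A
  have s1 : ∑ i, ∑ j, (m (x ρ))⁻¹ i j * (if i = ρ ∧ j = ρ then A else 0)
      = (m (x ρ))⁻¹ ρ ρ * A := by
    simp [ite_and]
  have s2 := h.sum_inv_mul hx ((m (x ρ))⁻¹ ρ ρ • (((1 / 2) * mixedDeriv m (x ρ) ρ ρ) • matDeriv m (x ρ)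
        - (1 / 2 : ℝ) • matDeriv (matDeriv m) (x ρ)
        - ((1 / 4) * (mixedDeriv m (x ρ)).trace) • matDeriv m (x ρ)
        + (1 / 2 : ℝ) • (matDeriv m (x ρ) * mixedDeriv m (x ρ))))
  simp only [Matrix.smul_apply, Matrix.add_apply, Matrix.sub_apply, smul_eq_mul] at s2
  have s3 : ∀ X : I → I → ℝ,
      ∑ i, ∑ j, (m (x ρ))⁻¹ i j * ((if i = ρ ∧ j = ρ then A else 0) + X i j)
        = (m (x ρ))⁻¹ ρ ρ * A + ∑ i, ∑ j, (m (x ρ))⁻¹ i j * X i j := fun X => by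
    simp only [mul_add, Finset.sum_add_distrib, s1]
  rw [s3, s2]
  simp only [Matrix.mul_smul, Matrix.mul_add, Matrix.mul_sub, Matrix.trace_smul, Matrix.trace_add,
    Matrix.trace_sub, smul_eq_mul, htr, ← Matrix.mul_assoc]
  rw [← hA]
  have e1 : (m (x ρ))⁻¹ * matDeriv m (x ρ) = mixedDeriv m (x ρ) := rfl
  rw [e1]
  ring

end IsRadialFamily
end Curvature

/-! ### The radial mass integrand of one such metric relative to another. -/

section Mass
variable {I : Type*} [Fintype I] [DecidableEq I] {ρ : I} {b m : ℝ → Matrix I I ℝ} {s s' : Set ℝ}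

namespace IsRadialFamily
variable (h : IsRadialFamily ρ m s)
include h

/-- The trace of ∇_ρ m with respect to m, the second of the two contractions in the mass integrand.
The background symbols Γᵖ_{ρ j} are half of b⁻¹ b', and each of the two of them contributes half of
its trace. -/
theorem trace_inv_mul_covDeriv_rad (hb : IsRadialFamily ρ b s') {x : I → ℝ} (hx : x ρ ∈ s)
    (hx' : x ρ ∈ s') :
    ∑ k, ∑ j, (m (x ρ))⁻¹ k j * covDeriv (fun y => b (y ρ)) (fun y => m (y ρ)) ρ j k x
      = (mixedDeriv m (x ρ)).trace - (mixedDeriv b (x ρ)).trace := by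
  have hΓ : ∀ p j, radialChristoffel ρ b p ρ j (x ρ) = (1 / 2) * mixedDeriv b (x ρ) p j := by
    intro p j
    simp only [radialChristoffel, if_true]
    rw [hb.deriv_row_apply hx', hb.mixedDeriv_col hx']
    by_cases hp : p = ρ <;> by_cases hj : j = ρ <;> simp [hp, hj, hb.mixedDeriv_diag hx']
  have hc : ∀ j k, covDeriv (fun y => b (y ρ)) (fun y => m (y ρ)) ρ j k x
      = (matDeriv m (x ρ) - (1 / 2 : ℝ) • ((m (x ρ) * mixedDeriv b (x ρ))ᵀ
        + m (x ρ) * mixedDeriv b (x ρ))) j k := by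
    intro j k
    simp only [covDeriv, pderiv_comp_apply ρ ρ (fun t => m t j k), hb.christoffel_eq hx', hΓ,
      if_true, Matrix.sub_apply, Matrix.smul_apply, Matrix.add_apply, Matrix.transpose_apply,
      Matrix.mul_apply, Finset.sum_add_distrib, smul_eq_mul, mul_add, Finset.mul_sum]
    congr 2
    · exact Finset.sum_congr rfl fun p _ => by rw [h.symm hx p k]; ring
    · exact Finset.sum_congr rfl fun p _ => by ring
  simp_rw [hc]
  rw [Finset.sum_congr rfl fun k _ => Finset.sum_congr rfl fun j _ => by rw [h.inv_symm hx k j]]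
  rw [Finset.sum_comm, h.sum_inv_mul hx]
  have e1 : (m (x ρ))⁻¹ * (m (x ρ) * mixedDeriv b (x ρ)) = mixedDeriv b (x ρ) := by
    rw [← Matrix.mul_assoc, Matrix.nonsing_inv_mul _ (h.det_ne_zero hx).isUnit, Matrix.one_mul]
  have e2 : ((m (x ρ))⁻¹)ᵀ = (m (x ρ))⁻¹ := by ext i j; exact h.inv_symm hx j i
  have e3 : ((m (x ρ))⁻¹ * (m (x ρ) * mixedDeriv b (x ρ))ᵀ).trace
      = (mixedDeriv b (x ρ)).trace := by
    rw [← Matrix.trace_transpose, Matrix.transpose_mul, Matrix.transpose_transpose, e2,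
      Matrix.trace_mul_comm, e1]
  rw [Matrix.mul_sub, Matrix.mul_smul, Matrix.mul_add, Matrix.trace_sub, Matrix.trace_smul,
    Matrix.trace_add, e3, e1, ← mixedDeriv, smul_eq_mul]
  ring

/-- The divergence-type contraction. Here the symbols Γ^ρ_{kj}, which carry the second fundamental
form of the background, also contribute; they give the term with tr(m⁻¹ b'). -/
theorem trace_inv_mul_covDeriv (hb : IsRadialFamily ρ b s') {x : I → ℝ} (hx : x ρ ∈ s)
    (hx' : x ρ ∈ s') :
    ∑ k, ∑ j, (m (x ρ))⁻¹ k j * covDeriv (fun y => b (y ρ)) (fun y => m (y ρ)) k j ρ x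
      = mixedDeriv m (x ρ) ρ ρ - mixedDeriv b (x ρ) ρ ρ
        + (1 / 2) * (b (x ρ))⁻¹ ρ ρ * m (x ρ) ρ ρ * ((m (x ρ))⁻¹ * matDeriv b (x ρ)).trace
        - (1 / 2) * (mixedDeriv b (x ρ)).trace := by
  have hΓ : ∀ p k, radialChristoffel ρ b p k ρ (x ρ) = (1 / 2) * mixedDeriv b (x ρ) p k := by
    intro p j
    simp only [radialChristoffel, if_true]
    rw [hb.deriv_col_apply hx', hb.mixedDeriv_col hx']
    by_cases hp : p = ρ <;> by_cases hj : j = ρ <;> simp [hp, hj, hb.mixedDeriv_diag hx']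
  have hc : ∀ k j, covDeriv (fun y => b (y ρ)) (fun y => m (y ρ)) k j ρ x
      = (if k = ρ ∧ j = ρ then matDeriv m (x ρ) ρ ρ - m (x ρ) ρ ρ * mixedDeriv b (x ρ) ρ ρ else 0)
        + ((1 / 2 * (b (x ρ))⁻¹ ρ ρ * m (x ρ) ρ ρ) • matDeriv b (x ρ)
          - (1 / 2 : ℝ) • (m (x ρ) * mixedDeriv b (x ρ))ᵀ) k j := by
    intro k j
    have e1 : ∑ p, radialChristoffel ρ b p k j (x ρ) * m (x ρ) p ρ
        = radialChristoffel ρ b ρ k j (x ρ) * m (x ρ) ρ ρ :=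
      Finset.sum_eq_single ρ (fun p _ hp => by
        rw [h.symm hx, h.ortho _ hx p hp, mul_zero]) (by simp)
    have e2 : deriv (fun t => m t j ρ) (x ρ) = if j = ρ then matDeriv m (x ρ) ρ ρ else 0 :=
      h.deriv_col_apply hx j
    simp only [covDeriv, pderiv_comp_apply ρ k (fun t => m t j ρ), hb.christoffel_eq hx', hΓ,
      Matrix.sub_apply, Matrix.smul_apply, Matrix.transpose_apply,
      Matrix.mul_apply, Finset.sum_add_distrib, smul_eq_mul, Finset.mul_sum, e1, e2,
      hb.radialChristoffel_row hx']
    rw [Finset.sum_congr rfl fun p _ => show 1 / 2 * mixedDeriv b (x ρ) p k * m (x ρ) j p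
      = 1 / 2 * (m (x ρ) j p * mixedDeriv b (x ρ) p k) by ring]
    by_cases hk : k = ρ <;> by_cases hj : j = ρ <;> simp only [hk, hj, if_true, if_false, and_true,
      and_false] <;> ring
  have s3 : ∀ (A : ℝ) (X : Matrix I I ℝ),
      ∑ i, ∑ j, (m (x ρ))⁻¹ i j * ((if i = ρ ∧ j = ρ then A else 0) + X i j)
        = (m (x ρ))⁻¹ ρ ρ * A + ∑ i, ∑ j, (m (x ρ))⁻¹ i j * X i j := fun A X => by
    simp only [mul_add, Finset.sum_add_distrib]
    congr 1
    simp [ite_and]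
  simp_rw [hc]
  rw [s3, h.sum_inv_mul hx]
  have e1 : (m (x ρ))⁻¹ * (m (x ρ) * mixedDeriv b (x ρ)) = mixedDeriv b (x ρ) := by
    rw [← Matrix.mul_assoc, Matrix.nonsing_inv_mul _ (h.det_ne_zero hx).isUnit, Matrix.one_mul]
  have e2 : ((m (x ρ))⁻¹)ᵀ = (m (x ρ))⁻¹ := by ext i j; exact h.inv_symm hx j i
  have e3 : ((m (x ρ))⁻¹ * (m (x ρ) * mixedDeriv b (x ρ))ᵀ).trace
      = (mixedDeriv b (x ρ)).trace := by
    rw [← Matrix.trace_transpose, Matrix.transpose_mul, Matrix.transpose_transpose, e2,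
      Matrix.trace_mul_comm, e1]
  rw [Matrix.mul_sub, Matrix.mul_smul, Matrix.mul_smul, Matrix.trace_sub, Matrix.trace_smul,
    Matrix.trace_smul, e3, smul_eq_mul, smul_eq_mul, h.mixedDeriv_diag hx]
  linear_combination (-mixedDeriv b (x ρ) ρ ρ) * h.inv_mul_diag hx

theorem massVector_eq (hb : IsRadialFamily ρ b s') {x : I → ℝ} (hx : x ρ ∈ s)
    (hx' : x ρ ∈ s') :
    massVector (fun y => y ρ) (fun y => b (y ρ)) (fun y => m (y ρ)) ρ x
      = x ρ * (m (x ρ))⁻¹ ρ ρ * (mixedDeriv m (x ρ) ρ ρ - mixedDeriv b (x ρ) ρ ρ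
          + (1 / 2) * (mixedDeriv b (x ρ)).trace - (mixedDeriv m (x ρ)).trace)
        + (1 / 2) * x ρ * (b (x ρ))⁻¹ ρ ρ * ((m (x ρ))⁻¹ * matDeriv b (x ρ)).trace
        + (m (x ρ))⁻¹ ρ ρ * (((m (x ρ))⁻¹ * (m (x ρ) - b (x ρ))).trace
          - (m (x ρ))⁻¹ ρ ρ * (m (x ρ) ρ ρ - b (x ρ) ρ ρ)) := by
  have hV : ∀ k, pderiv k (fun y : I → ℝ => y ρ) x = if k = ρ then 1 else 0 := fun k => by
    simpa using pderiv_comp_apply ρ k (fun t => t) x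
  have t1 : ∀ k j : I, ∑ l, x ρ * (m (x ρ))⁻¹ k j * (m (x ρ))⁻¹ ρ l *
      (covDeriv (fun y => b (y ρ)) (fun y => m (y ρ)) k j l x
        - covDeriv (fun y => b (y ρ)) (fun y => m (y ρ)) l j k x)
      = x ρ * (m (x ρ))⁻¹ ρ ρ * ((m (x ρ))⁻¹ k j *
        covDeriv (fun y => b (y ρ)) (fun y => m (y ρ)) k j ρ x)
        - x ρ * (m (x ρ))⁻¹ ρ ρ * ((m (x ρ))⁻¹ k j *
          covDeriv (fun y => b (y ρ)) (fun y => m (y ρ)) ρ j k x) := by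
    intro k j
    rw [Finset.sum_eq_single ρ (fun l _ hl => by
      rw [h.inv_row_apply hx l, if_neg hl, mul_zero, zero_mul]) (by simp)]
    ring
  have t2 : ∀ k j : I, ∑ l, ((m (x ρ))⁻¹ k j * (m (x ρ))⁻¹ l ρ - (m (x ρ))⁻¹ ρ j * (m (x ρ))⁻¹ l k)
        * (m (x ρ) j k - b (x ρ) j k) * pderiv l (fun y : I → ℝ => y ρ) x
      = (m (x ρ))⁻¹ ρ ρ * ((m (x ρ))⁻¹ k j * (m (x ρ) - b (x ρ)) j k)
        - (if k = ρ then if j = ρ then (m (x ρ))⁻¹ ρ ρ * (m (x ρ))⁻¹ ρ ρ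
          * (m (x ρ) ρ ρ - b (x ρ) ρ ρ) else 0 else 0) := by
    intro k j
    rw [Finset.sum_eq_single ρ (fun l _ hl => by
      rw [hV, if_neg hl, mul_zero]) (by simp), hV, if_pos rfl, h.inv_row_apply hx j,
      h.inv_row_apply hx k, Matrix.sub_apply]
    by_cases hk : k = ρ <;> by_cases hj : j = ρ <;> simp only [hk, hj, if_true, if_false] <;> ring
  unfold massVector
  simp_rw [t1, t2, Finset.sum_sub_distrib, ← Finset.mul_sum, h.trace_inv_mul_covDeriv hb hx hx',
    h.trace_inv_mul_covDeriv_rad hb hx hx']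
  have e4 : ∑ k, ∑ j, (m (x ρ))⁻¹ k j * (m (x ρ) - b (x ρ)) j k
      = ((m (x ρ))⁻¹ * (m (x ρ) - b (x ρ))).trace := by
    simp only [Matrix.trace, Matrix.diag, Matrix.mul_apply]
  rw [e4]
  simp only [Finset.sum_ite_irrel, Finset.sum_const_zero, Finset.sum_ite_eq', Finset.mem_univ,
    if_true]
  linear_combination (1 / 2) * x ρ * (b (x ρ))⁻¹ ρ ρ * ((m (x ρ))⁻¹ * matDeriv b (x ρ)).trace
    * h.inv_mul_diag hx

end IsRadialFamily
end Mass

/-! ### Block-diagonal metrics: curvature and mass in terms of u, v and γ. -/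

section Block
variable {d : ℕ}

/-- The block-diagonal matrix function `A dr² + B dθ² + γ`. -/
def blockMat (A B : ℝ → ℝ) (γ : ℝ → Matrix (Fin d) (Fin d) ℝ) (r : ℝ) :
    Matrix (Idx d) (Idx d) ℝ :=
  Matrix.fromBlocks (Matrix.diagonal ![A r, B r]) 0 0 (γ r)

theorem fromBlocks_posDef {a b : ℝ} (ha : 0 < a) (hb : 0 < b) {c : Matrix (Fin d) (Fin d) ℝ}
    (hc : c.PosDef) :
    (Matrix.fromBlocks (Matrix.diagonal ![a, b]) 0 0 c : Matrix (Idx d) (Idx d) ℝ).PosDef := by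
  have h1 : (Matrix.diagonal ![a, b]).PosDef :=
    Matrix.PosDef.diagonal fun i => by fin_cases i <;> simpa
  have := h1.isUnit
  have hi : Invertible (Matrix.diagonal ![a, b]) := this.invertible
  refine Matrix.PosDef.of_dotProduct_mulVec_pos ?_ fun x hx => ?_
  · rw [Matrix.isHermitian_fromBlocks_iff]
    exact ⟨h1.isHermitian, by simp, by simp, hc.isHermitian⟩
  · obtain ⟨y, z, rfl⟩ : ∃ y z, x = Sum.elim y z :=
      ⟨x ∘ Sum.inl, x ∘ Sum.inr, (Sum.elim_comp_inl_inr x).symm⟩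
    simp only [Matrix.fromBlocks_mulVec]
    simp only [Sum.elim_comp_inl, Sum.elim_comp_inr, Matrix.zero_mulVec, add_zero, zero_add,
      star_trivial, sumElim_dotProduct_sumElim]
    have p1 : 0 ≤ y ⬝ᵥ (Matrix.diagonal ![a, b]) *ᵥ y := by
      simpa using h1.posSemidef.dotProduct_mulVec_nonneg y
    have p2 : 0 ≤ z ⬝ᵥ c *ᵥ z := by simpa using hc.posSemidef.dotProduct_mulVec_nonneg z
    by_cases hy : y = 0
    · have hz : z ≠ 0 := by
        rintro rfl; apply hx; rw [hy]; ext i; cases i <;> rfl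
      have := hc.dotProduct_mulVec_pos hz
      simp only [star_trivial] at this
      linarith
    · have := h1.dotProduct_mulVec_pos hy
      simp only [star_trivial] at this
      linarith

theorem blockMat_isRadialFamily {A B : ℝ → ℝ} {γ : ℝ → Matrix (Fin d) (Fin d) ℝ} {s : Set ℝ}
    (hs : IsOpen s) (hA : ContDiffOn ℝ ∞ A s) (hB : ContDiffOn ℝ ∞ B s)
    (hγ : ∀ i j, ContDiffOn ℝ ∞ (fun r => γ r i j) s) (hA0 : ∀ r ∈ s, 0 < A r)
    (hB0 : ∀ r ∈ s, 0 < B r) (hγ0 : ∀ r ∈ s, (γ r).PosDef) :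
    IsRadialFamily (rad d) (blockMat A B γ) s where
  isOpen := hs
  smooth i j := by
    rcases i with i | i <;> rcases j with j | j
    · fin_cases i <;> fin_cases j
      · simpa [blockMat] using hA
      · simpa [blockMat] using contDiffOn_const
      · simpa [blockMat] using contDiffOn_const
      · simpa [blockMat] using hB
    · simpa [blockMat] using contDiffOn_const
    · simpa [blockMat] using contDiffOn_const
    · simpa [blockMat] using hγ i j
  posDef r hr := fromBlocks_posDef (hA0 r hr) (hB0 r hr) (hγ0 r hr)
  ortho r _ j hj := by
    rcases j with j | j
    · fin_cases j
      · exact absurd rfl hj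
      · simp [blockMat]
    · simp [blockMat]

theorem inv_fromBlocks_diagonal {a b : ℝ} (ha : a ≠ 0) (hb : b ≠ 0)
    {c : Matrix (Fin d) (Fin d) ℝ} (hc : c.det ≠ 0) :
    (Matrix.fromBlocks (Matrix.diagonal ![a, b]) 0 0 c : Matrix (Idx d) (Idx d) ℝ)⁻¹
      = Matrix.fromBlocks (Matrix.diagonal ![a⁻¹, b⁻¹]) 0 0 c⁻¹ := by
  refine Matrix.inv_eq_right_inv ?_
  rw [Matrix.fromBlocks_multiply, Matrix.diagonal_mul_diagonal]
  simp only [Matrix.mul_zero, Matrix.zero_mul, add_zero, zero_add,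
    Matrix.mul_nonsing_inv c hc.isUnit]
  have : (fun i => ![a, b] i * ![a⁻¹, b⁻¹] i) = fun _ => (1 : ℝ) := by
    funext i; fin_cases i <;> simp [ha, hb]
  rw [this, Matrix.diagonal_one, Matrix.fromBlocks_one]

theorem matDeriv_blockMat (A B : ℝ → ℝ) (γ : ℝ → Matrix (Fin d) (Fin d) ℝ) (r : ℝ) :
    matDeriv (blockMat A B γ) r
      = Matrix.fromBlocks (Matrix.diagonal ![deriv A r, deriv B r]) 0 0 (matDeriv γ r) := by
  ext i j
  rcases i with i | i <;> rcases j with j | j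
  · fin_cases i <;> fin_cases j <;> simp [matDeriv, blockMat]
  · simp [matDeriv, blockMat]
  · simp [matDeriv, blockMat]
  · simp [matDeriv, blockMat]

theorem mixedDeriv_blockMat {A B : ℝ → ℝ} {γ : ℝ → Matrix (Fin d) (Fin d) ℝ} {r : ℝ}
    (ha : A r ≠ 0) (hb : B r ≠ 0) (hc : (γ r).det ≠ 0) :
    mixedDeriv (blockMat A B γ) r = Matrix.fromBlocks
      (Matrix.diagonal ![deriv A r / A r, deriv B r / B r]) 0 0 (mixedDeriv γ r) := by
  rw [mixedDeriv, matDeriv_blockMat, blockMat, inv_fromBlocks_diagonal ha hb hc,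
    Matrix.fromBlocks_multiply, Matrix.diagonal_mul_diagonal]
  simp only [Matrix.mul_zero, Matrix.zero_mul, add_zero, zero_add, mixedDeriv]
  congr 2
  funext i; fin_cases i <;> simp [div_eq_inv_mul]

theorem trace_fromBlocks_diagonal (a b : ℝ) (c : Matrix (Fin d) (Fin d) ℝ) :
    (Matrix.fromBlocks (Matrix.diagonal ![a, b]) 0 0 c : Matrix (Idx d) (Idx d) ℝ).trace
      = a + b + c.trace := by
  simp [Matrix.trace, Fintype.sum_sum_type, Fin.sum_univ_two]

theorem trace_fromBlocks_diagonal_mul (a b a' b' : ℝ) (c c' : Matrix (Fin d) (Fin d) ℝ) :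
    (Matrix.fromBlocks (Matrix.diagonal ![a, b]) 0 0 c
      * Matrix.fromBlocks (Matrix.diagonal ![a', b']) 0 0 c' : Matrix (Idx d) (Idx d) ℝ).trace
      = a * a' + b * b' + (c * c').trace := by
  rw [Matrix.fromBlocks_multiply, Matrix.diagonal_mul_diagonal]
  simp [Matrix.trace, Fintype.sum_sum_type, Fin.sum_univ_two]

/-- The mean curvature of the level sets of the radial coordinate. -/
def meanCurv (u v : ℝ → ℝ) (γ : ℝ → Matrix (Fin d) (Fin d) ℝ) (r : ℝ) : ℝ :=
  Real.exp (-u r) * (deriv v r + (1 / 2) * (mixedDeriv γ r).trace)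

theorem contDiffOn_trace_mixedDeriv {γ : ℝ → Matrix (Fin d) (Fin d) ℝ} {s : Set ℝ}
    (hs : IsOpen s) (hγ : ∀ i j, ContDiffOn ℝ ∞ (fun r => γ r i j) s)
    (hγ0 : ∀ r ∈ s, (γ r).PosDef) :
    ContDiffOn ℝ ∞ (fun r => (mixedDeriv γ r).trace) s := by
  simp only [Matrix.trace, Matrix.diag, mixedDeriv, Matrix.mul_apply]
  exact ContDiffOn.sum fun i _ => ContDiffOn.sum fun j _ =>
    (contDiffOn_inv_apply hγ (fun r hr => (hγ0 r hr).det_pos.ne') i j).mul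
      (contDiffOn_matDeriv hs hγ j i)

theorem contDiffOn_meanCurv {u v : ℝ → ℝ} {γ : ℝ → Matrix (Fin d) (Fin d) ℝ} {s : Set ℝ}
    (hs : IsOpen s) (hu : ContDiffOn ℝ ∞ u s) (hv : ContDiffOn ℝ ∞ v s)
    (hγ : ∀ i j, ContDiffOn ℝ ∞ (fun r => γ r i j) s) (hγ0 : ∀ r ∈ s, (γ r).PosDef) :
    ContDiffOn ℝ ∞ (meanCurv u v γ) s :=
  hu.neg.exp.mul (((contDiffOn_infty_iff_deriv_of_isOpen hs).1 hv).2.add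
    (contDiffOn_const.mul (contDiffOn_trace_mixedDeriv hs hγ hγ0)))

section
variable {u v : ℝ → ℝ} {γ : ℝ → Matrix (Fin d) (Fin d) ℝ} {s : Set ℝ}
    (hs : IsOpen s) (hu : ContDiffOn ℝ ∞ u s) (hv : ContDiffOn ℝ ∞ v s)
    (hγ : ∀ i j, ContDiffOn ℝ ∞ (fun r => γ r i j) s) (hγ0 : ∀ r ∈ s, (γ r).PosDef)
include hs hu hv hγ hγ0

theorem radialFamily_radialMetric :
    IsRadialFamily (rad d)
      (blockMat (fun r => Real.exp (2 * u r)) (fun r => Real.exp (2 * v r)) γ) s :=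
  blockMat_isRadialFamily hs (contDiffOn_const.mul hu).exp (contDiffOn_const.mul hv).exp hγ
    (fun _ _ => Real.exp_pos _) (fun _ _ => Real.exp_pos _) hγ0

theorem mixedDeriv_radialMetric {r : ℝ} (hr : r ∈ s) :
    mixedDeriv (blockMat (fun r => Real.exp (2 * u r)) (fun r => Real.exp (2 * v r)) γ) r
      = Matrix.fromBlocks (Matrix.diagonal ![2 * deriv u r, 2 * deriv v r]) 0 0
          (mixedDeriv γ r) := by
  rw [mixedDeriv_blockMat (A := fun r => Real.exp (2 * u r)) (B := fun r => Real.exp (2 * v r))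
    (Real.exp_ne_zero _) (Real.exp_ne_zero _) (hγ0 r hr).det_pos.ne']
  have e : ∀ {w : ℝ → ℝ}, ContDiffOn ℝ ∞ w s →
      deriv (fun r => Real.exp (2 * w r)) r / Real.exp (2 * w r) = 2 * deriv w r := by
    intro w hw
    rw [((hasDerivAt_of_contDiffOn hs hw hr).const_mul 2).exp.deriv]
    field_simp
  rw [e hu, e hv]

/-- The Gauss equation combined with the variation of H: the level sets are flat, so R = -2 ∂_ν H -
H² - |A|² with unit normal derivative ∂_ν = e^{-u} ∂ᵣ. -/
theorem scalarCurvature_radialMetric {x : Idx d → ℝ} (hx : x (rad d) ∈ s) :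
    scalarCurvature (radialMetric u v γ) x =
      - 2 * (Real.exp (-u (x (rad d))) * deriv (meanCurv u v γ) (x (rad d)))
      - meanCurv u v γ (x (rad d)) ^ 2
      - Real.exp (-u (x (rad d))) ^ 2 * (deriv v (x (rad d)) ^ 2
        + (1 / 4) * (mixedDeriv γ (x (rad d)) * mixedDeriv γ (x (rad d))).trace) := by
  have h := radialFamily_radialMetric hs hu hv hγ hγ0
  have h1 := h.scalarCurvature_eq hx
  change scalarCurvature (radialMetric u v γ) x = _ at h1
  rw [h1]
  set r := x (rad d)
  have hnb : ∀ᶠ t in 𝓝 r, t ∈ s := hs.mem_nhds hx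
  have d2u := hasDerivAt_of_contDiffOn hs ((contDiffOn_infty_iff_deriv_of_isOpen hs).1 hu).2 hx
  have d2v := hasDerivAt_of_contDiffOn hs ((contDiffOn_infty_iff_deriv_of_isOpen hs).1 hv).2 hx
  have dτ := hasDerivAt_of_contDiffOn hs (contDiffOn_trace_mixedDeriv hs hγ hγ0) hx
  have du := hasDerivAt_of_contDiffOn hs hu hx
  have e1 : deriv (fun t => mixedDeriv (blockMat (fun r => Real.exp (2 * u r))
      (fun r => Real.exp (2 * v r)) γ) t (rad d) (rad d)) r = 2 * deriv (deriv u) r := by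
    have : (fun t => mixedDeriv (blockMat (fun r => Real.exp (2 * u r))
      (fun r => Real.exp (2 * v r)) γ) t (rad d) (rad d)) =ᶠ[𝓝 r] fun t => 2 * deriv u t := by
      filter_upwards [hnb] with t ht
      rw [mixedDeriv_radialMetric hs hu hv hγ hγ0 ht]; simp
    rw [this.deriv_eq, (d2u.const_mul 2).deriv]
  have e2 : deriv (fun t => (mixedDeriv (blockMat (fun r => Real.exp (2 * u r))
      (fun r => Real.exp (2 * v r)) γ) t).trace) r
      = 2 * deriv (deriv u) r + 2 * deriv (deriv v) r
        + deriv (fun t => (mixedDeriv γ t).trace) r := by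
    have : (fun t => (mixedDeriv (blockMat (fun r => Real.exp (2 * u r))
      (fun r => Real.exp (2 * v r)) γ) t).trace) =ᶠ[𝓝 r]
        fun t => 2 * deriv u t + 2 * deriv v t + (mixedDeriv γ t).trace := by
      filter_upwards [hnb] with t ht
      rw [mixedDeriv_radialMetric hs hu hv hγ hγ0 ht, trace_fromBlocks_diagonal]
    rw [this.deriv_eq]
    exact (((d2u.const_mul 2).add (d2v.const_mul 2)).add dτ).deriv
  have e3 : deriv (meanCurv u v γ) r = _ := (du.neg.exp.mul (d2v.add (dτ.const_mul (1 / 2)))).deriv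
  rw [e1, e2, e3, mixedDeriv_radialMetric hs hu hv hγ hγ0 hx, trace_fromBlocks_diagonal,
    trace_fromBlocks_diagonal_mul, blockMat, inv_fromBlocks_diagonal (Real.exp_ne_zero _)
    (Real.exp_ne_zero _) (hγ0 r hx).det_pos.ne', meanCurv]
  have e4 : (Real.exp (2 * u r))⁻¹ = Real.exp (-u r) ^ 2 := by
    rw [← Real.exp_neg, ← Real.exp_nat_mul]; congr 1; push_cast; ring
  simp [e4]
  ring

end

/-! ### The Horowitz-Myers metric -/

theorem hmF_pos {r₀ r : ℝ} (h0 : 0 < r₀) (hr : r₀ < r) : 0 < hmF d r₀ r := by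
  have hr' := h0.trans hr
  have : (r₀ / r) ^ (d + 2) < 1 :=
    pow_lt_one₀ (by positivity) ((div_lt_one hr').2 hr) (by simp)
  exact mul_pos (by positivity) (by linarith)

theorem hmF_hasDerivAt {r₀ r : ℝ} (hr : r ≠ 0) :
    HasDerivAt (hmF d r₀) (r * (2 + d * (r₀ / r) ^ (d + 2))) r := by
  have h1 : HasDerivAt (fun t => r₀ / t) (-r₀ / r ^ 2) r := by
    simpa using (hasDerivAt_const r r₀).fun_div (hasDerivAt_id r) hr
  have h2 := (hasDerivAt_pow 2 r).mul ((h1.pow (d + 2)).const_sub 1)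
  refine h2.congr_deriv ?_
  change _ * (1 - (r₀ / r) ^ (d + 2)) + _ = _
  rw [show d + 2 - 1 = d + 1 by omega, pow_succ (r₀ / r) (d + 1)]
  push_cast
  field_simp
  ring

theorem contDiffOn_hmF {r₀ : ℝ} (h0 : 0 < r₀) : ContDiffOn ℝ ∞ (hmF d r₀) (Ioi r₀) := by
  refine (contDiffOn_id.pow 2).mul (contDiffOn_const.sub ((contDiffOn_const.div contDiffOn_id
    fun r hr => ?_).pow _))
  exact (h0.trans hr).ne'

/-- The Horowitz-Myers metric as a function of the radial coordinate. -/
def hmMat (d : ℕ) (r₀ : ℝ) : ℝ → Matrix (Idx d) (Idx d) ℝ :=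
  blockMat (fun r => 1 / hmF d r₀ r) (hmF d r₀) (fun r => r ^ 2 • (1 : Matrix (Fin d) (Fin d) ℝ))

theorem smul_one_posDef {c : ℝ} (hc : 0 < c) : (c • (1 : Matrix (Fin d) (Fin d) ℝ)).PosDef :=
  Matrix.PosDef.one.smul hc

theorem hmMat_isRadialFamily {r₀ : ℝ} (h0 : 0 < r₀) :
    IsRadialFamily (rad d) (hmMat d r₀) (Ioi r₀) := by
  refine blockMat_isRadialFamily isOpen_Ioi
    (contDiffOn_const.div (contDiffOn_hmF h0) fun r hr => (hmF_pos h0 hr).ne') (contDiffOn_hmF h0)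
    (fun i j => ?_) (fun r hr => one_div_pos.2 (hmF_pos h0 hr)) (fun r hr => hmF_pos h0 hr)
    (fun r hr => smul_one_posDef (pow_pos (h0.trans hr) 2))
  simp only [Matrix.smul_apply, smul_eq_mul]
  exact (contDiffOn_id.pow 2).mul contDiffOn_const

theorem matDeriv_sq_smul_one (r : ℝ) :
    matDeriv (fun r => r ^ 2 • (1 : Matrix (Fin d) (Fin d) ℝ)) r = (2 * r) • 1 := by
  ext i j
  simp only [matDeriv, Matrix.of_apply, Matrix.smul_apply, smul_eq_mul]
  rw [((hasDerivAt_pow 2 r).mul_const _).deriv]; simp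

/-- The radial component of the mass integrand. -/
theorem massVector_radialMetric {u v : ℝ → ℝ} {γ : ℝ → Matrix (Fin d) (Fin d) ℝ} {s : Set ℝ}
    (hs : IsOpen s) (hu : ContDiffOn ℝ ∞ u s) (hv : ContDiffOn ℝ ∞ v s)
    (hγ : ∀ i j, ContDiffOn ℝ ∞ (fun r => γ r i j) s) (hγ0 : ∀ r ∈ s, (γ r).PosDef)
    {r₀ : ℝ} (h0 : 0 < r₀) {x : Idx d → ℝ} {r : ℝ} (hxr : x (rad d) = r) (hx : r ∈ s)
    (hx' : r₀ < r) :
    massVector (hmPotential d) (hmMetric d r₀) (radialMetric u v γ) (rad d) x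
      = r * Real.exp (-u r) ^ 2 * (deriv (hmF d r₀) r / (2 * hmF d r₀ r) + d / r)
        - 2 * r * Real.exp (-u r) * meanCurv u v γ r
        + (1 / 2) * r * hmF d r₀ r * deriv (hmF d r₀) r * Real.exp (-v r) ^ 2
        + r ^ 2 * hmF d r₀ r * ((γ r)⁻¹).trace
        + Real.exp (-u r) ^ 2 * (d + 1 - hmF d r₀ r * Real.exp (-v r) ^ 2
          - r ^ 2 * ((γ r)⁻¹).trace) := by
  have h := radialFamily_radialMetric hs hu hv hγ hγ0
  have h1 := h.massVector_eq (hmMat_isRadialFamily h0) (x := x) (by rwa [hxr]) (by rwa [hxr])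
  change massVector (hmPotential d) (hmMetric d r₀) (radialMetric u v γ) (rad d) x = _ at h1
  rw [h1, hxr]
  have hf := hmF_pos (d := d) h0 hx'
  have hr : 0 < r := h0.trans hx'
  have dF := (hmF_hasDerivAt (d := d) (r₀ := r₀) hr.ne').differentiableAt.hasDerivAt
  have dA : deriv (fun r => 1 / hmF d r₀ r) r = - deriv (hmF d r₀) r / hmF d r₀ r ^ 2 := by
    rw [((hasDerivAt_const r (1 : ℝ)).fun_div dF hf.ne').deriv]; simp
  have hg2 : ((r ^ 2 • (1 : Matrix (Fin d) (Fin d) ℝ))⁻¹) = (r ^ 2)⁻¹ • 1 := by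
    refine Matrix.inv_eq_right_inv ?_
    rw [Matrix.smul_mul, Matrix.one_mul, smul_smul, mul_inv_cancel₀ (by positivity), one_smul]
  have hdet : (r ^ 2 • (1 : Matrix (Fin d) (Fin d) ℝ)).det ≠ 0 :=
    (smul_one_posDef (pow_pos hr 2)).det_pos.ne'
  -- The logarithmic derivatives of 1/f, f and r².
  have hNb : mixedDeriv (hmMat d r₀) r = Matrix.fromBlocks
      (Matrix.diagonal ![- (deriv (hmF d r₀) r / hmF d r₀ r), deriv (hmF d r₀) r / hmF d r₀ r]) 0 0
        ((2 / r) • 1) := by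
    rw [hmMat, mixedDeriv_blockMat (by positivity) hf.ne' hdet, dA, mixedDeriv,
      matDeriv_sq_smul_one, hg2]
    congr 3
    · field_simp
    · rw [Matrix.smul_mul, Matrix.one_mul, smul_smul]; congr 1; field_simp
  have e4 : ∀ y : ℝ, (Real.exp (2 * y))⁻¹ = Real.exp (-y) ^ 2 := fun y => by
    rw [← Real.exp_neg, ← Real.exp_nat_mul]; congr 1; push_cast; ring
  have hi : (blockMat (fun r => Real.exp (2 * u r)) (fun r => Real.exp (2 * v r)) γ r)⁻¹
      = Matrix.fromBlocks (Matrix.diagonal ![Real.exp (-u r) ^ 2, Real.exp (-v r) ^ 2]) 0 0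
        (γ r)⁻¹ := by
    rw [blockMat, inv_fromBlocks_diagonal (Real.exp_ne_zero _)
    (Real.exp_ne_zero _) (hγ0 r hx).det_pos.ne', e4, e4]
  have hib : (hmMat d r₀ r)⁻¹ (rad d) (rad d) = hmF d r₀ r := by
    rw [hmMat, blockMat, inv_fromBlocks_diagonal (by positivity) hf.ne' hdet]; simp
  have hD : ((blockMat (fun r => Real.exp (2 * u r)) (fun r => Real.exp (2 * v r)) γ r)⁻¹
      * matDeriv (hmMat d r₀) r).trace
      = -Real.exp (-u r) ^ 2 * (deriv (hmF d r₀) r / hmF d r₀ r ^ 2)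
        + Real.exp (-v r) ^ 2 * deriv (hmF d r₀) r + 2 * r * ((γ r)⁻¹).trace := by
    rw [hi, hmMat, matDeriv_blockMat, trace_fromBlocks_diagonal_mul, matDeriv_sq_smul_one, dA,
      Matrix.mul_smul, Matrix.mul_one, Matrix.trace_smul, smul_eq_mul]
    ring
  have hE : ((blockMat (fun r => Real.exp (2 * u r)) (fun r => Real.exp (2 * v r)) γ r)⁻¹
      * (blockMat (fun r => Real.exp (2 * u r)) (fun r => Real.exp (2 * v r)) γ r
        - hmMat d r₀ r)).trace
      = d + 2 - (Real.exp (-u r) ^ 2 / hmF d r₀ r + Real.exp (-v r) ^ 2 * hmF d r₀ r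
        + r ^ 2 * ((γ r)⁻¹).trace) := by
    rw [Matrix.mul_sub, Matrix.nonsing_inv_mul _ (h.det_ne_zero hx).isUnit, hi, Matrix.trace_sub,
      hmMat, blockMat, trace_fromBlocks_diagonal_mul, Matrix.mul_smul, Matrix.mul_one,
      Matrix.trace_smul, smul_eq_mul, Matrix.trace_one]
    simp
    ring
  rw [hib, hD, hE, hNb, mixedDeriv_radialMetric hs hu hv hγ hγ0 hx, trace_fromBlocks_diagonal,
    trace_fromBlocks_diagonal, hi, Matrix.trace_smul, Matrix.trace_one, meanCurv]
  have e5 : Real.exp (-u r) * Real.exp (u r) = 1 := by rw [← Real.exp_add]; simp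
  have e6 : Real.exp (2 * u r) = Real.exp (u r) ^ 2 := by
    rw [← Real.exp_nat_mul]; congr 1
  simp [hmMat, blockMat, e6]
  have e7 : Real.exp (-u r) = (Real.exp (u r))⁻¹ := Real.exp_neg _
  rw [e7]
  have := Real.exp_ne_zero (u r)
  field_simp
  ring

end Block

/-! ### From integral decay to pointwise decay along a filter. -/

section Asymptotics
variable {d : ℕ}

theorem volDensity_hmMetric {r₀ : ℝ} (h0 : 0 < r₀) {x : Idx d → ℝ} (hx : r₀ < x (rad d)) :
    volDensity (hmMetric d r₀) x = x (rad d) ^ d := by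
  have hf := hmF_pos (d := d) h0 hx
  have hr := h0.trans hx
  rw [volDensity, hmMetric, Matrix.det_fromBlocks_zero₂₁, Matrix.det_diagonal, Matrix.det_smul,
    Matrix.det_one, Fin.prod_univ_two]
  simp only [Matrix.cons_val_zero, Matrix.cons_val_one, Fintype.card_fin, mul_one]
  rw [one_div, inv_mul_cancel₀ hf.ne', one_mul, ← pow_mul, mul_comm, pow_mul,
    Real.sqrt_sq (by positivity)]

/-- The coordinate volume of the level sets of the radial coordinate. -/
def crossVolume (Λ : Module.Basis (Fin d) ℝ (Fin d → ℝ)) (r₀ : ℝ) : ℝ :=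
  hmPeriod d r₀ * volume.real (ZSpan.fundamentalDomain Λ)

theorem hmPeriod_pos {r₀ : ℝ} (h0 : 0 < r₀) : 0 < hmPeriod d r₀ := by
  unfold hmPeriod; positivity

theorem volume_fundamentalDomain_ne_top (Λ : Module.Basis (Fin d) ℝ (Fin d → ℝ)) :
    volume (ZSpan.fundamentalDomain Λ) ≠ ⊤ :=
  (ZSpan.fundamentalDomain_isBounded Λ).measure_lt_top.ne

theorem crossVolume_pos (Λ : Module.Basis (Fin d) ℝ (Fin d → ℝ)) {r₀ : ℝ} (h0 : 0 < r₀) :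
    0 < crossVolume Λ r₀ :=
  mul_pos (hmPeriod_pos h0) (ENNReal.toReal_pos (ZSpan.measure_fundamentalDomain_ne_zero Λ)
    (volume_fundamentalDomain_ne_top Λ))

theorem massIntegral_eq (Λ : Module.Basis (Fin d) ℝ (Fin d → ℝ)) {r₀ : ℝ} (h0 : 0 < r₀)
    (g : (Idx d → ℝ) → Matrix (Idx d) (Idx d) ℝ) {R U : ℝ} (hR : r₀ < R)
    (hU : ∀ x : Idx d → ℝ, x (rad d) = R →
      massVector (hmPotential d) (hmMetric d r₀) g (rad d) x = U) :
    massIntegral Λ r₀ g R = crossVolume Λ r₀ * (U * R ^ d) := by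
  have e : ∀ θ x, massVector (hmPotential d) (hmMetric d r₀) g (rad d) (point R θ x)
      * volDensity (hmMetric d r₀) (point R θ x) = U * R ^ d := fun θ x => by
    rw [hU _ rfl, volDensity_hmMetric h0 (by exact hR)]; rfl
  simp only [massIntegral, e, setIntegral_const, smul_eq_mul, Real.volume_real_Ioc,
    crossVolume]
  rw [sub_zero, max_eq_left (hmPeriod_pos h0).le]
  ring

/-- Otherwise φ(r)/r ≥ ε/r near infinity, and ∫ dr/r diverges. -/
theorem frequently_lt_of_lintegral_div {φ : ℝ → ℝ} {R₀ : ℝ}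
    (h : ∫⁻ r in Ioi R₀, ENNReal.ofReal (φ r / r) < ⊤) {ε : ℝ} (hε : 0 < ε) :
    ∃ᶠ r in atTop, φ r < ε := by
  intro hcon
  obtain ⟨R₁, hR₁⟩ := eventually_atTop.1 hcon
  set R := max (max R₀ R₁) 1
  have hRpos : 0 < R := lt_of_lt_of_le one_pos (le_max_right _ _)
  have h1 : ∫⁻ r in Ioi R, ENNReal.ofReal (ε * r⁻¹) < ⊤ := by
    refine lt_of_le_of_lt ?_ h
    refine (setLIntegral_mono' measurableSet_Ioi fun r hr => ?_).trans
      (lintegral_mono_set (Ioi_subset_Ioi ((le_max_left _ _).trans (le_max_left _ _))))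
    have hr' : R < r := hr
    refine ENNReal.ofReal_le_ofReal ?_
    rw [div_eq_mul_inv]
    refine mul_le_mul_of_nonneg_right ?_ (inv_nonneg.2 (hRpos.trans hr').le)
    exact not_lt.1 (hR₁ r (((le_max_right _ _).trans (le_max_left _ _)).trans hr'.le))
  have h2 : IntegrableOn (fun r : ℝ => ε * r⁻¹) (Ioi R) := by
    refine ⟨(measurable_const.mul measurable_inv).aestronglyMeasurable, ?_⟩
    rw [hasFiniteIntegral_iff_ofReal]
    · exact h1
    · filter_upwards [ae_restrict_mem measurableSet_Ioi] with r hr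
      have hr' : R < r := hr
      exact mul_nonneg hε.le (inv_nonneg.2 (hRpos.trans hr').le)
  refine not_integrableOn_Ioi_inv (a := R) ?_
  have := h2.const_mul ε⁻¹
  simpa [hε.ne', IntegrableOn] using this

/-- The squared size of the difference between a radial metric and the Horowitz-Myers metric. -/
def deviation (r₀ : ℝ) (u v : ℝ → ℝ) (γ : ℝ → Matrix (Fin d) (Fin d) ℝ) (r : ℝ) : ℝ :=
  (∑ i, ∑ j, frameDiff r₀ (radialMetric u v γ) i j (point r 0 0) ^ 2)
    + hmF d r₀ r * ∑ i, ∑ j,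
      deriv (fun t => frameDiff r₀ (radialMetric u v γ) i j (point t 0 0)) r ^ 2

/-- The weight V times the volume density is r · r^d = rⁿ/r, which produces the logarithmic measure
of `frequently_lt_of_lintegral_div`. Of the frame derivatives only the radial one is retained, and
the integrals over θ and x contribute a finite nonzero constant. -/
theorem lintegral_deviation_lt_top (Λ : Module.Basis (Fin d) ℝ (Fin d → ℝ)) {r₀ R₀ : ℝ}
    (h0 : 0 < r₀) (hR₀ : r₀ < R₀) {u v : ℝ → ℝ} {γ : ℝ → Matrix (Fin d) (Fin d) ℝ}
    (h : endIntegral Λ r₀ R₀ (fun x => ((∑ i, ∑ j, frameDiff r₀ (radialMetric u v γ) i j x ^ 2)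
      + ∑ k, ∑ i, ∑ j,
        (hmFrame d r₀ x k * pderiv k (frameDiff r₀ (radialMetric u v γ) i j) x) ^ 2)
        * hmPotential d x) < ⊤) :
    ∫⁻ r in Ioi R₀, ENNReal.ofReal (r ^ (d + 2) * deviation r₀ u v γ r / r) < ⊤ := by
  set c : ENNReal := volume (Ioc 0 (hmPeriod d r₀)) * volume (ZSpan.fundamentalDomain Λ)
  have hc0 : c ≠ 0 := mul_ne_zero (by simpa using hmPeriod_pos h0)
    (ZSpan.measure_fundamentalDomain_ne_zero Λ)
  have hc1 : c ≠ ⊤ := ENNReal.mul_ne_top (by simp) (volume_fundamentalDomain_ne_top Λ)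
  have key : (∫⁻ r in Ioi R₀, ENNReal.ofReal (r ^ (d + 2) * deviation r₀ u v γ r / r)) * c < ⊤ := by
    refine lt_of_le_of_lt ?_ h
    rw [← lintegral_mul_const' _ _ hc1]
    refine setLIntegral_mono' measurableSet_Ioi fun r hr => ?_
    have hr' : r₀ < r := hR₀.trans hr
    have hpos : 0 < r := h0.trans hr'
    have hf := hmF_pos (d := d) h0 hr'
    have hle : ∀ θ x, r ^ (d + 2) * deviation r₀ u v γ r / r
        ≤ ((∑ i, ∑ j, frameDiff r₀ (radialMetric u v γ) i j (point r θ x) ^ 2)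
        + ∑ k, ∑ i, ∑ j, (hmFrame d r₀ (point r θ x) k
          * pderiv k (frameDiff r₀ (radialMetric u v γ) i j) (point r θ x)) ^ 2)
        * hmPotential d (point r θ x) * volDensity (hmMetric d r₀) (point r θ x) := by
      intro θ x
      rw [volDensity_hmMetric h0 (by exact hr')]
      change _ ≤ _ * r * r ^ d
      have e : r ^ (d + 2) * deviation r₀ u v γ r / r = deviation r₀ u v γ r * r * r ^ d := by
        field_simp
        ring
      rw [e]
      refine mul_le_mul_of_nonneg_right (mul_le_mul_of_nonneg_right ?_ hpos.le) (by positivity)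
      unfold deviation
      refine add_le_add le_rfl ?_
      have hrad : hmF d r₀ r * ∑ i, ∑ j,
          deriv (fun t => frameDiff r₀ (radialMetric u v γ) i j (point t 0 0)) r ^ 2
          = ∑ i, ∑ j, (hmFrame d r₀ (point r θ x) (rad d)
            * pderiv (rad d) (frameDiff r₀ (radialMetric u v γ) i j) (point r θ x)) ^ 2 := by
        simp_rw [Finset.mul_sum]
        refine Finset.sum_congr rfl fun i _ => Finset.sum_congr rfl fun j _ => ?_
        have := pderiv_comp_apply (rad d) (rad d)
          (fun t => frameDiff r₀ (radialMetric u v γ) i j (point t 0 0)) (point r θ x)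
        rw [if_pos rfl] at this
        rw [mul_pow, show frameDiff r₀ (radialMetric u v γ) i j
          = fun y => frameDiff r₀ (radialMetric u v γ) i j (point (y (rad d)) 0 0) from rfl]
        rw [this]
        change _ = √(hmF d r₀ r) ^ 2 * _
        rw [Real.sq_sqrt hf.le]
        rfl
      rw [hrad]
      exact Finset.single_le_sum (f := fun k => ∑ i, ∑ j, (hmFrame d r₀ (point r θ x) k
        * pderiv k (frameDiff r₀ (radialMetric u v γ) i j) (point r θ x)) ^ 2)
        (fun k _ => Finset.sum_nonneg fun i _ => Finset.sum_nonneg fun j _ => sq_nonneg _)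
        (Finset.mem_univ (rad d))
    calc _ = ∫⁻ _ in Ioc 0 (hmPeriod d r₀), ∫⁻ _ in ZSpan.fundamentalDomain Λ,
          ENNReal.ofReal (r ^ (d + 2) * deviation r₀ u v γ r / r) := by
          simp only [setLIntegral_const, c]; ring
      _ ≤ _ := lintegral_mono fun θ => lintegral_mono fun x =>
          ENNReal.ofReal_le_ofReal (hle θ x)
  by_contra hcon
  rw [not_lt, top_le_iff] at hcon
  rw [hcon, ENNReal.top_mul hc0] at key
  exact lt_irrefl _ key

/-- Integrability does not give decay at every large r. The filter F plays the role of a sequence of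
radii along which the deviation is o(r⁻ⁿ). -/
theorem exists_filter_deviation (Λ : Module.Basis (Fin d) ℝ (Fin d → ℝ)) {r₀ M : ℝ}
    (h0 : 0 < r₀) {u v : ℝ → ℝ} {γ : ℝ → Matrix (Fin d) (Fin d) ℝ}
    (hM : HasTotalMass Λ r₀ (radialMetric u v γ) M) :
    ∃ F : Filter ℝ, F.NeBot ∧ F ≤ atTop ∧
      Tendsto (fun r => r ^ (d + 2) * deviation r₀ u v γ r) F (𝓝 0) := by
  obtain ⟨R₀, hR₀, h, -⟩ := hM.asymptotic
  have h1 := lintegral_deviation_lt_top Λ h0 hR₀ h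
  set φ : ℝ → ℝ := fun r => r ^ (d + 2) * deviation r₀ u v γ r
  refine ⟨atTop ⊓ comap φ (𝓝 0), ?_, inf_le_left, tendsto_comap.mono_left inf_le_right⟩
  have hφ : ∀ r, r₀ < r → 0 ≤ φ r := fun r hr => by
    have := hmF_pos (d := d) h0 hr
    have := h0.trans hr
    have s1 : ∀ X : Idx d → Idx d → ℝ, 0 ≤ ∑ i, ∑ j, X i j ^ 2 := fun X =>
      Finset.sum_nonneg fun i _ => Finset.sum_nonneg fun j _ => sq_nonneg _
    exact mul_nonneg (by positivity) (add_nonneg (s1 _) (mul_nonneg (by positivity) (s1 _)))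
  -- Nontriviality of the filter amounts to φ being frequently close to 0.
  rw [inf_neBot_iff_frequently_right]
  intro p hp
  obtain ⟨ε, hε, hp⟩ := Metric.eventually_nhds_iff.1 (eventually_comap.1 hp)
  refine ((frequently_lt_of_lintegral_div h1 hε).and_eventually
    (eventually_gt_atTop r₀)).mono fun r hr => ?_
  refine hp (y := φ r) ?_ r rfl
  rw [Real.dist_eq, sub_zero, abs_of_nonneg (hφ r hr.2)]
  exact hr.1

end Asymptotics

/-! ### Expansion of the mass integrand. -/

section MassLimit
variable {d : ℕ}

theorem tendsto_inv_apply_of_tendsto_one {F : Filter ℝ} {S : ℝ → Matrix (Fin d) (Fin d) ℝ}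
    (h : ∀ i j, Tendsto (fun r => S r i j) F (𝓝 ((1 : Matrix (Fin d) (Fin d) ℝ) i j))) (i j) :
    Tendsto (fun r => (S r)⁻¹ i j) F (𝓝 ((1 : Matrix (Fin d) (Fin d) ℝ) i j)) := by
  have hS : Tendsto S F (𝓝 1) := tendsto_pi_nhds.2 fun i => tendsto_pi_nhds.2 fun j => h i j
  have h1 : Tendsto (fun r => (S r).det) F (𝓝 1) := by
    have := ((continuous_id.matrix_det (A := fun M : Matrix (Fin d) (Fin d) ℝ => M)).tendsto 1).comp hS
    simpa [Function.comp_def] using this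
  have h2 : Tendsto (fun r => (S r).adjugate) F (𝓝 1) := by
    have := ((continuous_id.matrix_adjugate (A := fun M : Matrix (Fin d) (Fin d) ℝ => M)).tendsto 1).comp hS
    simpa [Function.comp_def] using this
  have h3 := (h1.inv₀ one_ne_zero).mul (tendsto_pi_nhds.1 (tendsto_pi_nhds.1 h2 i) j)
  simpa [Matrix.inv_def, Ring.inverse_eq_inv'] using h3

theorem tendsto_div_pow_atTop (r₀ : ℝ) :
    Tendsto (fun r : ℝ => (r₀ / r) ^ (d + 2)) atTop (𝓝 0) := by
  have h1 : Tendsto (fun r : ℝ => r₀ / r) atTop (𝓝 0) := tendsto_id.const_div_atTop r₀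
  simpa using h1.pow (d + 2)

theorem hmF_eq (r₀ r : ℝ) : hmF d r₀ r = r ^ 2 * (1 - (r₀ / r) ^ (d + 2)) := rfl

theorem sqrt_hmF {r₀ r : ℝ} (hr : 0 < r) :
    √(hmF d r₀ r) = r * √(1 - (r₀ / r) ^ (d + 2)) := by
  rw [hmF_eq, Real.sqrt_mul (by positivity), Real.sqrt_sq hr.le]

theorem tendsto_hmF_div_sq (r₀ : ℝ) :
    Tendsto (fun r : ℝ => hmF d r₀ r / r ^ 2) atTop (𝓝 1) := by
  have h := (tendsto_div_pow_atTop (d := d) r₀).const_sub 1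
  rw [sub_zero] at h
  refine h.congr' ?_
  filter_upwards [eventually_gt_atTop 0] with r hr
  rw [hmF_eq]; field_simp

theorem tendsto_sqrt_one_sub (r₀ : ℝ) :
    Tendsto (fun r : ℝ => √(1 - (r₀ / r) ^ (d + 2))) atTop (𝓝 1) := by
  have := ((tendsto_div_pow_atTop (d := d) r₀).const_sub 1).sqrt
  simpa using this

/-- The mean curvature of the level sets of `r` in the Horowitz-Myers metric. -/
def hmMeanCurv (d : ℕ) (r₀ r : ℝ) : ℝ :=
  √(hmF d r₀ r) * (deriv (hmF d r₀) r / (2 * hmF d r₀ r) + d / r)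

theorem hmMeanCurv_eq {r₀ r : ℝ} (h0 : 0 < r₀) (hr : r₀ < r) :
    hmMeanCurv d r₀ r = ((d + 1) - d / 2 * (r₀ / r) ^ (d + 2)) / √(1 - (r₀ / r) ^ (d + 2)) := by
  have hr0 := h0.trans hr
  have hf := hmF_pos (d := d) h0 hr
  have hz : 0 < 1 - (r₀ / r) ^ (d + 2) := by
    rw [hmF_eq] at hf; exact pos_of_mul_pos_right hf (by positivity)
  rw [hmMeanCurv, (hmF_hasDerivAt hr0.ne').deriv, sqrt_hmF hr0, hmF_eq]
  have hs := Real.sq_sqrt hz.le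
  have hs0 : √(1 - (r₀ / r) ^ (d + 2)) ≠ 0 := (Real.sqrt_pos.2 hz).ne'
  generalize (r₀ / r) ^ (d + 2) = z at *
  generalize √(1 - z) = s at *
  rw [← hs]
  field_simp
  rw [show z = 1 - s ^ 2 by linarith]
  ring

theorem tendsto_hmMeanCurv {r₀ : ℝ} (h0 : 0 < r₀) :
    Tendsto (hmMeanCurv d r₀) atTop (𝓝 (d + 1)) := by
  have h := (((tendsto_div_pow_atTop (d := d) r₀).const_mul ((d : ℝ) / 2)).const_sub
    ((d : ℝ) + 1)).div (tendsto_sqrt_one_sub (d := d) r₀) one_ne_zero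
  simp only [mul_zero, sub_zero, div_one] at h
  refine h.congr' ?_
  filter_upwards [eventually_gt_atTop r₀] with r hr
  rw [hmMeanCurv_eq h0 hr]; rfl

/-- With z = (r₀/r)ⁿ, the mean curvature is (d + 1 - d z/2)(1 - z)^{-1/2} = d + 1 + z/2 + O(z²), and
rⁿ z = r₀ⁿ. -/
theorem tendsto_pow_mul_hmMeanCurv {r₀ : ℝ} (h0 : 0 < r₀) :
    Tendsto (fun r => 2 * r ^ (d + 2) * (hmMeanCurv d r₀ r - (d + 1))) atTop
      (𝓝 (r₀ ^ (d + 2))) := by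
  have hσ := tendsto_sqrt_one_sub (d := d) r₀
  have h := ((((hσ.const_add 1).inv₀ (by norm_num)).const_mul ((d : ℝ) + 1)).sub_const
    ((d : ℝ) / 2)).div hσ one_ne_zero |>.const_mul (2 * r₀ ^ (d + 2))
  -- With s = √(1 - z), the identity 1 - s = z / (1 + s) makes the factor z explicit; this is the
  -- value at s = 1.
  have e : 2 * r₀ ^ (d + 2) * ((((d : ℝ) + 1) * (1 + 1)⁻¹ - d / 2) / 1) = r₀ ^ (d + 2) := by
    ring
  rw [e] at h
  refine h.congr' ?_
  filter_upwards [eventually_gt_atTop r₀] with r hr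
  have hr0 := h0.trans hr
  have hz : 0 < 1 - (r₀ / r) ^ (d + 2) := by
    have hf := hmF_pos (d := d) h0 hr
    rw [hmF_eq] at hf; exact pos_of_mul_pos_right hf (by positivity)
  rw [hmMeanCurv_eq h0 hr]
  have hzr : r₀ ^ (d + 2) = (r₀ / r) ^ (d + 2) * r ^ (d + 2) := by
    rw [← mul_pow]; field_simp
  have hs := Real.sq_sqrt hz.le
  have hs0 := Real.sqrt_pos.2 hz
  rw [hzr]
  simp only [Pi.div_apply]
  generalize (r₀ / r) ^ (d + 2) = z at *
  generalize √(1 - z) = s at *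
  have : 1 + s ≠ 0 := by positivity
  field_simp
  rw [show z = 1 - s ^ 2 by linarith]
  ring

/-- The quadratic nature of the error terms in the mass integrand. -/
theorem tendsto_massIntegrand {F : Filter ℝ} (hF : F ≤ atTop) {r₀ : ℝ} (h0 : 0 < r₀)
    {K p w T δ I : ℝ → ℝ}
    (hK : ∀ᶠ r in F, 1 ≤ K r ∧ K r ^ 2 = r ^ (d + 2))
    (hp : Tendsto (fun r => K r * p r) F (𝓝 0)) (hw : Tendsto (fun r => K r * w r) F (𝓝 0))
    (hT : Tendsto (fun r => K r * T r) F (𝓝 0)) (hδ : Tendsto (fun r => K r * δ r) F (𝓝 0))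
    (hI : ∀ᶠ r in F, I r =
      r * hmF d r₀ r * (1 + p r) ^ 2 * (deriv (hmF d r₀) r / (2 * hmF d r₀ r) + d / r)
      - 2 * r * √(hmF d r₀ r) * (1 + p r) * (hmMeanCurv d r₀ r + δ r)
      + (1 / 2) * r * deriv (hmF d r₀) r * (1 + w r) + hmF d r₀ r * (d + T r)
      - hmF d r₀ r * (1 + p r) ^ 2 * (w r + T r)) :
    Tendsto (fun r => I r * r ^ d + 2 * r ^ (d + 2) * δ r) F (𝓝 0) := by
  have small : ∀ {X : ℝ → ℝ}, Tendsto (fun r => K r * X r) F (𝓝 0) → Tendsto X F (𝓝 0) := by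
    intro X hX
    refine squeeze_zero_norm' ?_ (by simpa using hX.norm)
    filter_upwards [hK] with r hr
    simp only [Real.norm_eq_abs]
    rw [abs_of_nonneg (a := K r) (by linarith)]
    exact le_mul_of_one_le_left (abs_nonneg _) hr.1
  have hσ := (tendsto_sqrt_one_sub (d := d) r₀).mono_left hF
  have hH := (tendsto_hmMeanCurv (d := d) h0).mono_left hF
  -- The exact remainder. Products of two deviations absorb the factor K² = rⁿ. Terms linear in p or
  -- T cancel; the linear terms in w and δ survive only with a factor rⁿ z = r₀ⁿ, so they tend to 0
  -- as well.
  have hlim := ((((hσ.mul (hp.pow 2)).mul hH).sub (((hσ.mul hp).mul hδ).const_mul 2)).sub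
    ((((hσ.pow 2).mul ((small hp).const_add 2)).mul hp).mul (hw.add hT))).add
    (((small hw).const_mul (((d : ℝ) + 2) / 2 * r₀ ^ (d + 2))).add
      (((small hδ).const_mul (2 * r₀ ^ (d + 2))).div (hσ.const_add 1) (by norm_num)))
  simp only [ne_eq, OfNat.ofNat_ne_zero, not_false_eq_true, zero_pow, mul_zero, zero_mul, sub_zero,
    add_zero, zero_div] at hlim
  refine hlim.congr' ?_
  filter_upwards [hK, hI, hF (eventually_gt_atTop r₀)] with r hKr hIr hr
  have hr0 := h0.trans hr
  have hf := hmF_pos (d := d) h0 hr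
  have hz : 0 < 1 - (r₀ / r) ^ (d + 2) := by
    rw [hmF_eq] at hf; exact pos_of_mul_pos_right hf (by positivity)
  have hzr : r₀ ^ (d + 2) = (r₀ / r) ^ (d + 2) * (r ^ d * r ^ 2) := by
    rw [← pow_add, ← mul_pow]; field_simp
  have hs := Real.sq_sqrt hz.le
  have hs0 := Real.sqrt_pos.2 hz
  have hK2 : K r ^ 2 = r ^ d * r ^ 2 := by rw [hKr.2, pow_add]
  rw [hIr, hmMeanCurv, (hmF_hasDerivAt hr0.ne').deriv, sqrt_hmF hr0, hmF_eq, hzr, pow_add r d 2]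
  simp only [Pi.div_apply]
  generalize (r₀ / r) ^ (d + 2) = z at *
  generalize √(1 - z) = s at *
  generalize r ^ d = R at *
  have hs1 : 1 + s ≠ 0 := by positivity
  obtain rfl : z = 1 - s ^ 2 := by linarith
  have e1 : s * (K r * p r) ^ 2 = s * (R * r ^ 2) * p r ^ 2 := by rw [mul_pow, hK2]; ring
  have e2 : s * (K r * p r) * (K r * δ r) = s * (R * r ^ 2) * p r * δ r := by
    rw [← hK2]; ring
  have e3 : s ^ 2 * (2 + p r) * (K r * p r) * (K r * w r + K r * T r)
      = s ^ 2 * (2 + p r) * (R * r ^ 2) * p r * (w r + T r) := by rw [← hK2]; ring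
  rw [e1, e2, e3]
  have h12 : (1 : ℝ) - (1 - s ^ 2) = s ^ 2 := by ring
  rw [h12]
  field_simp
  ring

end MassLimit

/-! ### Frame components, and the mean curvature at infinity in terms of the mass. -/

section MassLimit
variable {d : ℕ}

/-- The frame components of the difference to the Horowitz-Myers metric, as functions of `r`. -/
def radialDiff (r₀ : ℝ) (u v : ℝ → ℝ) (γ : ℝ → Matrix (Fin d) (Fin d) ℝ) (i j : Idx d)
    (r : ℝ) : ℝ :=
  frameDiff r₀ (radialMetric u v γ) i j (point r 0 0)

section
variable {r₀ r : ℝ} (h0 : 0 < r₀) (hr : r₀ < r) (u v : ℝ → ℝ) (γ : ℝ → Matrix (Fin d) (Fin d) ℝ)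
include h0 hr

theorem radialDiff_rad :
    radialDiff r₀ u v γ (rad d) (rad d) r = hmF d r₀ r * Real.exp (2 * u r) - 1 := by
  have hf := hmF_pos (d := d) h0 hr
  simp [radialDiff, frameDiff, hmFrame, radialMetric, point, Real.mul_self_sqrt hf.le]

theorem radialDiff_ang :
    radialDiff r₀ u v γ (ang d) (ang d) r = Real.exp (2 * v r) / hmF d r₀ r - 1 := by
  have hf := hmF_pos (d := d) h0 hr
  simp [radialDiff, frameDiff, hmFrame, radialMetric, point, ← mul_inv, Real.mul_self_sqrt hf.le,
    div_eq_inv_mul]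

theorem radialDiff_inr (A B : Fin d) :
    radialDiff r₀ u v γ (Sum.inr A) (Sum.inr B) r
      = γ r A B / r ^ 2 - (1 : Matrix (Fin d) (Fin d) ℝ) A B := by
  simp [radialDiff, frameDiff, hmFrame, radialMetric, point, Matrix.one_apply, div_eq_inv_mul, sq]

end

/-- Each squared entry is at most the whole sum of squares, so it inherits the decay of the
deviation. -/
theorem radialDiff_tendsto {r₀ : ℝ} (h0 : 0 < r₀) {u v : ℝ → ℝ}
    {γ : ℝ → Matrix (Fin d) (Fin d) ℝ} {F : Filter ℝ} (hF : F ≤ atTop)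
    (h : Tendsto (fun r => r ^ (d + 2) * deviation r₀ u v γ r) F (𝓝 0)) (i j : Idx d) :
    Tendsto (fun r => √(r ^ (d + 2)) * radialDiff r₀ u v γ i j r) F (𝓝 0) ∧
    Tendsto (fun r => √(r ^ (d + 2)) * (√(hmF d r₀ r) * deriv (radialDiff r₀ u v γ i j) r))
      F (𝓝 0) := by
  have hs := h.sqrt
  rw [Real.sqrt_zero] at hs
  have single : ∀ X : Idx d → Idx d → ℝ, X i j ^ 2 ≤ ∑ i, ∑ j, X i j ^ 2 := fun X =>
    (Finset.single_le_sum (f := fun j => X i j ^ 2) (fun _ _ => sq_nonneg _)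
      (Finset.mem_univ j)).trans (Finset.single_le_sum (f := fun i => ∑ j, X i j ^ 2)
      (fun _ _ => Finset.sum_nonneg fun _ _ => sq_nonneg _) (Finset.mem_univ i))
  have nonneg : ∀ X : Idx d → Idx d → ℝ, 0 ≤ ∑ i, ∑ j, X i j ^ 2 := fun X =>
    (sq_nonneg (X i j)).trans (single X)
  constructor
  · refine squeeze_zero_norm' ?_ hs
    filter_upwards [hF (eventually_gt_atTop r₀)] with r hr
    have hr0 := h0.trans hr
    have hf := hmF_pos (d := d) h0 hr
    refine Real.abs_le_sqrt ?_
    rw [mul_pow, Real.sq_sqrt (by positivity)]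
    refine mul_le_mul_of_nonneg_left ?_ (by positivity)
    exact (single fun i j => radialDiff r₀ u v γ i j r).trans
      (le_add_of_nonneg_right (mul_nonneg hf.le (nonneg _)))
  · refine squeeze_zero_norm' ?_ hs
    filter_upwards [hF (eventually_gt_atTop r₀)] with r hr
    have hr0 := h0.trans hr
    have hf := hmF_pos (d := d) h0 hr
    refine Real.abs_le_sqrt ?_
    rw [mul_pow, mul_pow, Real.sq_sqrt (by positivity), Real.sq_sqrt hf.le]
    refine mul_le_mul_of_nonneg_left ?_ (by positivity)
    exact (mul_le_mul_of_nonneg_left (single fun i j => deriv (radialDiff r₀ u v γ i j) r)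
      hf.le).trans (le_add_of_nonneg_left (nonneg _))

section
variable {a r₀ r : ℝ} (h0 : 0 < r₀) (hr : r₀ < r) (ha : a < r) {u v : ℝ → ℝ}
  {γ : ℝ → Matrix (Fin d) (Fin d) ℝ}
include h0 hr ha

/-- Logarithmic derivative of e^{2v} = f (1 + e_θθ). The function w only fills the unused dr² slot
of `radialDiff`. -/
theorem deriv_v_eq (hv : ContDiffOn ℝ ∞ v (Ioi a)) (w : ℝ → ℝ) :
    deriv v r = deriv (hmF d r₀) r / (2 * hmF d r₀ r)
      + deriv (radialDiff r₀ w v γ (ang d) (ang d)) r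
        / (2 * (1 + radialDiff r₀ w v γ (ang d) (ang d) r)) := by
  have hr0 := h0.trans hr
  have hf := hmF_pos (d := d) h0 hr
  have dF := (hmF_hasDerivAt (d := d) (r₀ := r₀) hr0.ne').differentiableAt.hasDerivAt
  have dv := hasDerivAt_of_contDiffOn isOpen_Ioi hv ha
  have e : radialDiff r₀ w v γ (ang d) (ang d) =ᶠ[𝓝 r]
      fun t => Real.exp (2 * v t) / hmF d r₀ t - 1 := by
    filter_upwards [Ioi_mem_nhds hr] with t ht using radialDiff_ang h0 ht w v γ
  rw [e.deriv_eq, (((dv.const_mul 2).exp.fun_div dF hf.ne').sub_const 1).deriv,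
    radialDiff_ang h0 hr]
  have := Real.exp_ne_zero (2 * v r)
  field_simp
  ring

theorem matDeriv_eq (hγ : ∀ i j, ContDiffOn ℝ ∞ (fun r => γ r i j) (Ioi a)) (A B : Fin d) :
    matDeriv γ r A B = 2 / r * γ r A B
      + r ^ 2 * deriv (radialDiff r₀ u v γ (Sum.inr A) (Sum.inr B)) r := by
  have hr0 := h0.trans hr
  have dγ := hasDerivAt_of_contDiffOn isOpen_Ioi (hγ A B) ha
  have e : radialDiff r₀ u v γ (Sum.inr A) (Sum.inr B) =ᶠ[𝓝 r]
      fun t => γ t A B / t ^ 2 - (1 : Matrix (Fin d) (Fin d) ℝ) A B := by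
    filter_upwards [Ioi_mem_nhds hr] with t ht using radialDiff_inr h0 ht u v γ A B
  rw [e.deriv_eq, ((dγ.fun_div (hasDerivAt_pow 2 r) (by positivity)).sub_const _).deriv]
  change deriv (fun t => γ t A B) r = _
  simp
  field_simp
  ring

/-- Put γ = r² S: the factor r² contributes 2d/r, and S⁻¹ S' the rest. The rescaled S is used
because it tends to 1. -/
theorem trace_mixedDeriv_eq (hγ : ∀ i j, ContDiffOn ℝ ∞ (fun r => γ r i j) (Ioi a))
    (hγ0 : ∀ r, a < r → (γ r).PosDef) :
    (mixedDeriv γ r).trace = 2 * d / r + ∑ A, ∑ B, ((r ^ 2)⁻¹ • γ r)⁻¹ A B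
      * deriv (radialDiff r₀ u v γ (Sum.inr B) (Sum.inr A)) r := by
  have hr0 := h0.trans hr
  have e1 : matDeriv γ r = (2 / r) • γ r + r ^ 2 • Matrix.of fun A B =>
      deriv (radialDiff r₀ u v γ (Sum.inr A) (Sum.inr B)) r := by
    ext A B
    simp [matDeriv_eq h0 hr ha (u := u) (v := v) hγ A B]
  have e2 : ((r ^ 2)⁻¹ • γ r)⁻¹ = r ^ 2 • (γ r)⁻¹ := by
    refine Matrix.inv_eq_right_inv ?_
    rw [Matrix.smul_mul, Matrix.mul_smul, smul_smul, inv_mul_cancel₀ (by positivity), one_smul,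
      Matrix.mul_nonsing_inv _ (hγ0 r ha).det_pos.ne'.isUnit]
  rw [mixedDeriv, e1, Matrix.mul_add, Matrix.mul_smul,
    Matrix.nonsing_inv_mul _ (hγ0 r ha).det_pos.ne'.isUnit, Matrix.mul_smul, ← Matrix.smul_mul,
    ← e2, Matrix.trace_add, Matrix.trace_smul, Matrix.trace_one]
  simp only [Matrix.trace, Matrix.diag, Matrix.mul_apply, Matrix.of_apply, Fintype.card_fin,
    smul_eq_mul]
  congr 1
  ring

theorem trace_inv_eq (hγ0 : ∀ r, a < r → (γ r).PosDef) :
    r ^ 2 * ((γ r)⁻¹).trace - d = - ∑ A, ∑ B, ((r ^ 2)⁻¹ • γ r)⁻¹ A B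
      * radialDiff r₀ u v γ (Sum.inr B) (Sum.inr A) r := by
  have hr0 := h0.trans hr
  have e2 : ((r ^ 2)⁻¹ • γ r)⁻¹ = r ^ 2 • (γ r)⁻¹ := by
    refine Matrix.inv_eq_right_inv ?_
    rw [Matrix.smul_mul, Matrix.mul_smul, smul_smul, inv_mul_cancel₀ (by positivity), one_smul,
      Matrix.mul_nonsing_inv _ (hγ0 r ha).det_pos.ne'.isUnit]
  have e3 : ∑ A, ∑ B, ((r ^ 2)⁻¹ • γ r)⁻¹ A B
      * radialDiff r₀ u v γ (Sum.inr B) (Sum.inr A) r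
      = (((r ^ 2)⁻¹ • γ r)⁻¹ * ((r ^ 2)⁻¹ • γ r - 1)).trace := by
    simp only [Matrix.trace, Matrix.diag, Matrix.mul_apply, radialDiff_inr h0 hr, Matrix.sub_apply,
      Matrix.smul_apply, smul_eq_mul, div_eq_inv_mul]
  rw [e3, e2, Matrix.mul_sub, Matrix.smul_mul, Matrix.mul_smul,
    Matrix.nonsing_inv_mul _ (hγ0 r ha).det_pos.ne'.isUnit, smul_smul,
    mul_inv_cancel₀ (by positivity), one_smul, Matrix.mul_one, Matrix.trace_sub, Matrix.trace_one,
    Matrix.trace_smul]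
  simp

end

/-- Up to o(1), the mass integral divided by the cross volume is -2 rⁿ (H - H₀), where H₀ is the
Horowitz-Myers mean curvature; adding the expansion of H₀ gives the limit. The other two limits are
the leading asymptotics of v and γ. -/
theorem exists_filter_tendsto (Λ : Module.Basis (Fin d) ℝ (Fin d → ℝ)) {r₀ a M : ℝ}
    (h0 : 0 < r₀) {u v : ℝ → ℝ} {γ : ℝ → Matrix (Fin d) (Fin d) ℝ}
    (hu : ContDiffOn ℝ ∞ u (Ioi a)) (hv : ContDiffOn ℝ ∞ v (Ioi a))
    (hγ : ∀ i j, ContDiffOn ℝ ∞ (fun r => γ r i j) (Ioi a)) (hγ0 : ∀ r, a < r → (γ r).PosDef)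
    (hM : HasTotalMass Λ r₀ (radialMetric u v γ) M) :
    ∃ F : Filter ℝ, F.NeBot ∧ F ≤ atTop ∧
      Tendsto (fun r => 2 * r ^ (d + 2) * (meanCurv u v γ r - (d + 1))) F
        (𝓝 (r₀ ^ (d + 2) - M / crossVolume Λ r₀)) ∧
      Tendsto (fun r => Real.exp (2 * v r) / r ^ 2) F (𝓝 1) ∧
      ∀ A B, Tendsto (fun r => γ r A B / r ^ 2) F
        (𝓝 ((1 : Matrix (Fin d) (Fin d) ℝ) A B)) := by
  obtain ⟨F, hne, hF, hdev⟩ := exists_filter_deviation Λ h0 hM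
  refine ⟨F, hne, hF, ?_⟩
  set K : ℝ → ℝ := fun r => √(r ^ (d + 2))
  set E : Idx d → Idx d → ℝ → ℝ := radialDiff r₀ u v γ
  have hE : ∀ i j, Tendsto (fun r => K r * E i j r) F (𝓝 0) := fun i j =>
    (radialDiff_tendsto h0 hF hdev i j).1
  have hE' : ∀ i j, Tendsto (fun r => K r * (√(hmF d r₀ r) * deriv (E i j) r)) F (𝓝 0) :=
    fun i j => (radialDiff_tendsto h0 hF hdev i j).2
  have hK : ∀ᶠ r in F, 1 ≤ K r ∧ K r ^ 2 = r ^ (d + 2) := by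
    filter_upwards [hF (eventually_ge_atTop 1)] with r hr
    exact ⟨Real.one_le_sqrt.2 (one_le_pow₀ hr), Real.sq_sqrt (by positivity)⟩
  have small : ∀ {X : ℝ → ℝ}, Tendsto (fun r => K r * X r) F (𝓝 0) → Tendsto X F (𝓝 0) := by
    intro X hX
    refine squeeze_zero_norm' ?_ (by simpa using hX.norm)
    filter_upwards [hK] with r hr
    simp only [Real.norm_eq_abs]
    rw [abs_of_nonneg (a := K r) (by linarith)]
    exact le_mul_of_one_le_left (abs_nonneg _) hr.1
  have hgt : ∀ᶠ r in F, r₀ < r ∧ a < r :=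
    hF ((eventually_gt_atTop r₀).and (eventually_gt_atTop a))
  have hfF := (tendsto_hmF_div_sq (d := d) r₀).mono_left hF
  have hHb := (tendsto_hmMeanCurv (d := d) h0).mono_left hF
  have hγlim : ∀ A B, Tendsto (fun r => γ r A B / r ^ 2) F
      (𝓝 ((1 : Matrix (Fin d) (Fin d) ℝ) A B)) := by
    intro A B
    have := (small (hE (Sum.inr A) (Sum.inr B))).add_const ((1 : Matrix (Fin d) (Fin d) ℝ) A B)
    rw [zero_add] at this
    refine this.congr' ?_
    filter_upwards [hgt] with r hr
    simp only [E, radialDiff_inr h0 hr.1, sub_add_cancel]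
  have hSinv : ∀ A B, Tendsto (fun r => ((r ^ 2)⁻¹ • γ r)⁻¹ A B) F
      (𝓝 ((1 : Matrix (Fin d) (Fin d) ℝ) A B)) := by
    intro A B
    refine tendsto_inv_apply_of_tendsto_one (S := fun r => (r ^ 2)⁻¹ • γ r) (fun i j => ?_) A B
    simpa [div_eq_inv_mul] using hγlim i j
  have hq : Tendsto (fun r => 1 + E (ang d) (ang d) r) F (𝓝 1) := by
    simpa using (small (hE (ang d) (ang d))).const_add 1
  -- The deviations of the lapse, of the inverse θ-coefficient, of the torus trace and of the mean
  -- curvature. Each is o(1/K), where K = r^{n/2}.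
  set p : ℝ → ℝ := fun r => Real.exp (-u r) / √(hmF d r₀ r) - 1
  set w : ℝ → ℝ := fun r => hmF d r₀ r * Real.exp (-v r) ^ 2 - 1
  set T : ℝ → ℝ := fun r => r ^ 2 * ((γ r)⁻¹).trace - d
  set δ : ℝ → ℝ := fun r => meanCurv u v γ r - hmMeanCurv d r₀ r
  have hp : Tendsto (fun r => K r * p r) F (𝓝 0) := by
    have hα : Tendsto (fun r => √(1 + E (rad d) (rad d) r)) F (𝓝 1) := by
      simpa using ((small (hE (rad d) (rad d))).const_add 1).sqrt
    -- If α = √(1 + e₁₁) = √f e^u, then p = 1/α - 1 = -e₁₁ / (α (1 + α)).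
    have h := ((hE (rad d) (rad d)).neg).div (hα.mul (hα.const_add 1)) (by norm_num)
    simp only [neg_zero, zero_div] at h
    refine h.congr' ?_
    filter_upwards [hgt] with r hr
    have hf := hmF_pos (d := d) h0 hr.1
    have hs := Real.sqrt_pos.2 hf
    have e1 : √(1 + E (rad d) (rad d) r) = √(hmF d r₀ r) * Real.exp (u r) := by
      simp only [E, radialDiff_rad h0 hr.1]
      rw [add_sub_cancel, Real.sqrt_mul hf.le, ← Real.exp_half]
      congr 2; ring
    have e2 : E (rad d) (rad d) r = (√(hmF d r₀ r) * Real.exp (u r)) ^ 2 - 1 := by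
      simp only [E, radialDiff_rad h0 hr.1]
      rw [mul_pow, Real.sq_sqrt hf.le, ← Real.exp_nat_mul]; norm_num
    simp only [Pi.div_apply, e1]
    simp only [p, e2, Real.exp_neg]
    have := Real.exp_pos (u r)
    generalize √(hmF d r₀ r) = s at *
    generalize Real.exp (u r) = y at *
    have : 1 + s * y ≠ 0 := by positivity
    field_simp
    ring
  have hw : Tendsto (fun r => K r * w r) F (𝓝 0) := by
    have h := ((hE (ang d) (ang d)).neg).div hq (by norm_num)
    simp only [neg_zero, zero_div] at h
    refine h.congr' ?_
    filter_upwards [hgt] with r hr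
    have hf := hmF_pos (d := d) h0 hr.1
    have e2 : Real.exp (2 * v r) = Real.exp (v r) ^ 2 := by
      rw [← Real.exp_nat_mul]; norm_num
    simp only [Pi.div_apply, w, E, radialDiff_ang h0 hr.1, Real.exp_neg, e2]
    have := Real.exp_pos (v r)
    rw [add_sub_cancel]
    field_simp
    ring
  have hT : Tendsto (fun r => K r * T r) F (𝓝 0) := by
    have h : Tendsto (fun r => - ∑ A, ∑ B, ((r ^ 2)⁻¹ • γ r)⁻¹ A B
        * (K r * E (Sum.inr B) (Sum.inr A) r)) F
        (𝓝 (- ∑ A, ∑ B, (1 : Matrix (Fin d) (Fin d) ℝ) A B * 0)) :=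
      (tendsto_finsetSum _ fun A _ => tendsto_finsetSum _ fun B _ =>
        (hSinv A B).mul (hE _ _)).neg
    simp only [mul_zero, Finset.sum_const_zero, neg_zero] at h
    refine h.congr' ?_
    filter_upwards [hgt] with r hr
    simp only [T, trace_inv_eq h0 hr.1 hr.2 (u := u) (v := v) hγ0, mul_neg, Finset.mul_sum]
    congr 1
    exact Finset.sum_congr rfl fun A _ => Finset.sum_congr rfl fun B _ => by ring
  have hδ : Tendsto (fun r => K r * δ r) F (𝓝 0) := by
    have h1 : Tendsto (fun r => ∑ A, ∑ B, ((r ^ 2)⁻¹ • γ r)⁻¹ A B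
        * (K r * (√(hmF d r₀ r) * deriv (E (Sum.inr B) (Sum.inr A)) r))) F
        (𝓝 (∑ A, ∑ B, (1 : Matrix (Fin d) (Fin d) ℝ) A B * 0)) :=
      (tendsto_finsetSum _ fun A _ => tendsto_finsetSum _ fun B _ =>
        (hSinv A B).mul (hE' _ _))
    simp only [mul_zero, Finset.sum_const_zero] at h1
    -- Since e^{-u} = √f (1 + p), one has δ = p H₀ + (1 + p) √f (e'_θθ / (2 (1 + e_θθ)) + tr(S⁻¹
    -- S')/2), with S = γ / r².
    have h := (hp.mul hHb).add (((small hp).const_add 1).mul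
      (((hE' (ang d) (ang d)).div (hq.const_mul 2) (by norm_num)).add (h1.const_mul (1 / 2))))
    simp only [zero_mul, zero_div, mul_zero, add_zero] at h
    refine h.congr' ?_
    filter_upwards [hgt] with r hr
    have hf := hmF_pos (d := d) h0 hr.1
    have hs := Real.sqrt_pos.2 hf
    have e1 : Real.exp (-u r) = √(hmF d r₀ r) * (1 + p r) := by
      simp only [p]; field_simp; ring
    have e2 : K r * δ r = K r * (√(hmF d r₀ r) * (1 + p r)
        * (deriv v r + 1 / 2 * (mixedDeriv γ r).trace) - hmMeanCurv d r₀ r) := by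
      simp only [δ, meanCurv, e1]
    rw [e2, deriv_v_eq h0 hr.1 hr.2 (γ := γ) hv u, trace_mixedDeriv_eq h0 hr.1 hr.2 (u := u) (v := v) hγ hγ0,
      hmMeanCurv]
    have e3 : ∑ A, ∑ B, ((r ^ 2)⁻¹ • γ r)⁻¹ A B
        * (K r * (√(hmF d r₀ r) * deriv (E (Sum.inr B) (Sum.inr A)) r))
        = K r * √(hmF d r₀ r) * ∑ A, ∑ B, ((r ^ 2)⁻¹ • γ r)⁻¹ A B
          * deriv (E (Sum.inr B) (Sum.inr A)) r := by
      simp only [Finset.mul_sum]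
      exact Finset.sum_congr rfl fun A _ => Finset.sum_congr rfl fun B _ => by ring
    simp only [Pi.div_apply]
    rw [e3]
    simp only [E]
    ring
  refine ⟨?_, ?_, hγlim⟩
  · have hI := tendsto_massIntegrand hF h0 (I := fun r => massIntegral Λ r₀ (radialMetric u v γ) r
        / crossVolume Λ r₀ / r ^ d) hK hp hw hT hδ (by
      filter_upwards [hgt] with r hr
      have hc := crossVolume_pos Λ h0
      have hr0 := h0.trans hr.1
      have hf := hmF_pos (d := d) h0 hr.1
      have hs := Real.sqrt_pos.2 hf
      rw [massIntegral_eq Λ h0 _ hr.1 (fun x hx => massVector_radialMetric isOpen_Ioi hu hv hγ hγ0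
        h0 hx hr.2 hr.1)]
      have e1 : Real.exp (-u r) = √(hmF d r₀ r) * (1 + p r) := by
        simp only [p]; field_simp; ring
      have e2 : hmF d r₀ r * Real.exp (-v r) ^ 2 = 1 + w r := by simp only [w]; ring
      have e3 : r ^ 2 * ((γ r)⁻¹).trace = d + T r := by simp only [T]; ring
      have e4 : meanCurv u v γ r = hmMeanCurv d r₀ r + δ r := by simp only [δ]; ring
      have e5 : √(hmF d r₀ r) ^ 2 = hmF d r₀ r := Real.sq_sqrt hf.le
      rw [mul_div_assoc, ← mul_div_assoc, mul_div_cancel_left₀ _ hc.ne', mul_div_cancel_right₀ _ (by positivity)]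
      rw [e1, e4]
      linear_combination (r * (1 + p r) ^ 2 * (deriv (hmF d r₀) r / (2 * hmF d r₀ r) + d / r)) * e5
        + (1 / 2 * r * deriv (hmF d r₀) r) * e2 + hmF d r₀ r * e3
        + (1 + p r) ^ 2 * (d + 1 - hmF d r₀ r * Real.exp (-v r) ^ 2
          - r ^ 2 * ((γ r)⁻¹).trace) * e5 - hmF d r₀ r * (1 + p r) ^ 2 * (e2 + e3))
    have hm := (hM.tendsto.mono_left hF).div_const (crossVolume Λ r₀)
    have h := (hI.sub hm).add ((tendsto_pow_mul_hmMeanCurv (d := d) h0).mono_left hF)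
    rw [show 0 - M / crossVolume Λ r₀ + r₀ ^ (d + 2)
      = r₀ ^ (d + 2) - M / crossVolume Λ r₀ by ring] at h
    refine h.congr' ?_
    filter_upwards [hgt] with r hr
    have hr0 := h0.trans hr.1
    have hc := crossVolume_pos Λ h0
    simp only [δ]
    field_simp
    ring
  · have h := hq.mul hfF
    rw [one_mul] at h
    refine h.congr' ?_
    filter_upwards [hgt] with r hr
    have hf := hmF_pos (d := d) h0 hr.1
    simp only [E, radialDiff_ang h0 hr.1]
    rw [add_sub_cancel]
    field_simp

end MassLimit

/-! ### Cauchy-Schwarz for the trace with respect to γ, with its equality case. -/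

section LinearAlgebra
variable {d : ℕ}

open scoped MatrixOrder Matrix.Norms.L2Operator in
theorem exists_inv_eq_transpose_mul {γ : Matrix (Fin d) (Fin d) ℝ} (hγ : γ.PosDef) :
    ∃ C : Matrix (Fin d) (Fin d) ℝ, γ⁻¹ = Cᵀ * C := by
  obtain ⟨C, hC⟩ := CStarAlgebra.nonneg_iff_eq_star_mul_self.1 hγ.inv.posSemidef.nonneg
  exact ⟨C, by rw [hC, Matrix.star_eq_conjTranspose, Matrix.conjTranspose_eq_transpose_of_trivial]⟩

/-- With γ⁻¹ = Cᵀ C, the matrix γ⁻¹ Y is turned into the symmetric C Y Cᵀ by cyclicity of the trace,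
and the trace becomes a Frobenius norm. -/
theorem trace_sq_eq_transpose_mul {γ C Y : Matrix (Fin d) (Fin d) ℝ}
    (hC : γ⁻¹ = Cᵀ * C) (hY : Yᵀ = Y) :
    (γ⁻¹ * Y * (γ⁻¹ * Y)).trace = ((C * Y * Cᵀ)ᵀ * (C * Y * Cᵀ)).trace := by
  simp only [Matrix.transpose_mul, Matrix.transpose_transpose, hY, hC]
  rw [show Cᵀ * C * Y * (Cᵀ * C * Y) = Cᵀ * (C * Y * Cᵀ * (C * Y)) by simp only [Matrix.mul_assoc],
    Matrix.trace_mul_comm]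
  simp only [Matrix.mul_assoc]

theorem trace_sq_nonneg {γ Y : Matrix (Fin d) (Fin d) ℝ} (hγ : γ.PosDef) (hY : Yᵀ = Y) :
    0 ≤ (γ⁻¹ * Y * (γ⁻¹ * Y)).trace := by
  obtain ⟨C, hC⟩ := exists_inv_eq_transpose_mul hγ
  rw [trace_sq_eq_transpose_mul hC hY]
  simpa using (Matrix.posSemidef_conjTranspose_mul_self (C * Y * Cᵀ)).trace_nonneg

theorem eq_zero_of_trace_sq_eq_zero {γ Y : Matrix (Fin d) (Fin d) ℝ} (hγ : γ.PosDef)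
    (hY : Yᵀ = Y) (h : (γ⁻¹ * Y * (γ⁻¹ * Y)).trace = 0) : Y = 0 := by
  obtain ⟨C, hC⟩ := exists_inv_eq_transpose_mul hγ
  rw [trace_sq_eq_transpose_mul hC hY, ← Matrix.conjTranspose_eq_transpose_of_trivial,
    Matrix.trace_conjTranspose_mul_self_eq_zero_iff] at h
  have hu := hγ.det_pos.ne'.isUnit
  have h1 : γ⁻¹ * Y * γ⁻¹ = 0 := by
    rw [hC, show Cᵀ * C * Y * (Cᵀ * C) = Cᵀ * (C * Y * Cᵀ) * C by simp only [Matrix.mul_assoc], h]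
    simp
  have h2 : γ * (γ⁻¹ * Y * γ⁻¹) * γ = Y := by
    rw [Matrix.mul_assoc γ⁻¹, Matrix.mul_nonsing_inv_cancel_left _ _ hu, Matrix.mul_assoc,
      Matrix.nonsing_inv_mul _ hu, Matrix.mul_one]
  rw [← h2, h1]; simp

/-- The squared norm of the trace-free part of X. Its nonnegativity is `sq_trace_le`, its vanishing
`eq_smul_of_sq_trace_eq`. -/
theorem trace_sq_sub_smul {γ X : Matrix (Fin d) (Fin d) ℝ} (hγ : γ.PosDef) (hd : d ≠ 0) :
    (γ⁻¹ * (X - ((γ⁻¹ * X).trace / d) • γ) * (γ⁻¹ * (X - ((γ⁻¹ * X).trace / d) • γ))).trace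
      = (γ⁻¹ * X * (γ⁻¹ * X)).trace - (γ⁻¹ * X).trace ^ 2 / d := by
  have hu := hγ.det_pos.ne'.isUnit
  have hd' : (d : ℝ) ≠ 0 := Nat.cast_ne_zero.2 hd
  rw [Matrix.mul_sub, Matrix.mul_smul, Matrix.nonsing_inv_mul _ hu]
  generalize γ⁻¹ * X = N
  simp only [Matrix.sub_mul, Matrix.mul_sub, Matrix.mul_smul, Matrix.smul_mul, Matrix.mul_one,
    Matrix.one_mul, Matrix.trace_sub, Matrix.trace_smul, Matrix.trace_one, smul_eq_mul,
    Fintype.card_fin]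
  field_simp
  ring

theorem sq_trace_le {γ X : Matrix (Fin d) (Fin d) ℝ} (hγ : γ.PosDef) (hX : Xᵀ = X) :
    (γ⁻¹ * X).trace ^ 2 / d ≤ (γ⁻¹ * X * (γ⁻¹ * X)).trace := by
  -- For d = 0 the quotient by d is 0 and all traces are empty.
  rcases eq_or_ne d 0 with rfl | hd
  · simp [Matrix.trace]
  have hγs : γᵀ = γ := by simpa using hγ.isHermitian.eq
  have := trace_sq_nonneg hγ (Y := X - ((γ⁻¹ * X).trace / d) • γ) (by simp [hX, hγs])
  rw [trace_sq_sub_smul hγ hd] at this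
  linarith

theorem eq_smul_of_sq_trace_eq {γ X : Matrix (Fin d) (Fin d) ℝ} (hγ : γ.PosDef) (hX : Xᵀ = X)
    (h : (γ⁻¹ * X * (γ⁻¹ * X)).trace = (γ⁻¹ * X).trace ^ 2 / d) :
    X = ((γ⁻¹ * X).trace / d) • γ := by
  rcases eq_or_ne d 0 with rfl | hd
  · ext i; exact i.elim0
  have hγs : γᵀ = γ := by simpa using hγ.isHermitian.eq
  refine sub_eq_zero.1 (eq_zero_of_trace_sq_eq_zero hγ (by simp [hX, hγs]) ?_)
  rw [trace_sq_sub_smul hγ hd, h, sub_self]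

end LinearAlgebra

/-! ### The comparison function c of H, and the algebra behind monotonicity. -/

section Comparison
variable {d : ℕ}

/-- After the last radius in [r₁, r₂] at which H ≤ d + 1, the function H exceeds d + 1, hence is
nonincreasing there and cannot have risen above d + 1. -/
theorem trapped_persists {H H' : ℝ → ℝ} {a : ℝ}
    (hH : ∀ r, a < r → HasDerivAt H (H' r) r)
    (hle : ∀ r, a < r → (d : ℝ) + 1 ≤ H r → H' r ≤ 0) {r₁ r₂ : ℝ} (h₁ : a < r₁)
    (h₁₂ : r₁ ≤ r₂) (h : H r₁ ≤ d + 1) : H r₂ ≤ d + 1 := by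
  by_contra hcon
  rw [not_le] at hcon
  have hcont : ContinuousOn H (Icc r₁ r₂) := fun r hr =>
    (hH r (h₁.trans_le hr.1)).continuousAt.continuousWithinAt
  have hcomp : IsCompact (Icc r₁ r₂ ∩ H ⁻¹' Iic ((d : ℝ) + 1)) :=
    isCompact_Icc.of_isClosed_subset (hcont.preimage_isClosed_of_isClosed isClosed_Icc isClosed_Iic)
      inter_subset_left
  obtain ⟨r₃, ⟨hr₃, hr₃'⟩, hmax⟩ := hcomp.exists_isGreatest ⟨r₁, ⟨le_rfl, h₁₂⟩, h⟩
  have hanti : AntitoneOn H (Icc r₃ r₂) := by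
    refine antitoneOn_of_deriv_nonpos (convex_Icc _ _) (hcont.mono (Icc_subset_Icc_left hr₃.1))
      (fun r hr => ?_) (fun r hr => ?_) <;> rw [interior_Icc] at hr
    · exact (hH r (h₁.trans_le (hr₃.1.trans hr.1.le))).differentiableAt.differentiableWithinAt
    · have ha := h₁.trans_le (hr₃.1.trans hr.1.le)
      rw [(hH r ha).deriv]
      refine hle r ha (le_of_not_ge fun hc => ?_)
      exact absurd (hmax ⟨⟨hr₃.1.trans hr.1.le, hr.2.le⟩, hc⟩) (not_le.2 hr.1)
  have := hanti ⟨le_rfl, hr₃.2⟩ ⟨hr₃.2, le_rfl⟩ hr₃.2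
  exact absurd (this.trans hr₃') (not_le.2 hcon)

/-- The value `c > 1` at which the Horowitz-Myers metric has mean curvature
`H = ((d + 2) c + d / c) / 2`. -/
def cothParam (d : ℕ) (H : ℝ) : ℝ := (H + √(H ^ 2 - (d + 2) * d)) / (d + 2)

theorem one_lt_sq_sub {H : ℝ} (h : (d : ℝ) + 1 < H) : 1 < H ^ 2 - (d + 2) * d := by
  have : (0 : ℝ) ≤ d := Nat.cast_nonneg d
  nlinarith

theorem one_lt_cothParam {H : ℝ} (h : (d : ℝ) + 1 < H) : 1 < cothParam d H := by
  have h1 : 1 < √(H ^ 2 - (d + 2) * d) := by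
    rw [Real.lt_sqrt zero_le_one]; simpa using one_lt_sq_sub h
  rw [cothParam, lt_div_iff₀ (by positivity)]
  linarith

/-- c is the larger root of (d + 2) c² - 2 H c + d = 0. -/
theorem cothParam_eq {H : ℝ} (h : (d : ℝ) + 1 < H) :
    H = ((d + 2) * cothParam d H + d / cothParam d H) / 2 := by
  have hc := one_lt_cothParam h
  have h2 : (d + 2) * cothParam d H - H = √(H ^ 2 - (d + 2) * d) := by
    rw [cothParam]; field_simp; ring
  have h3 := Real.sq_sqrt (zero_le_one.trans (one_lt_sq_sub h).le)
  rw [← h2] at h3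
  have : (0 : ℝ) < d + 2 := by positivity
  have hc0 : cothParam d H ≠ 0 := by positivity
  field_simp
  have h4 : (d + 2) * (2 * H * cothParam d H - ((d + 2) * cothParam d H ^ 2 + d)) = 0 := by
    linear_combination -h3
  have h5 := (mul_eq_zero.1 h4).resolve_left this.ne'
  linarith

/-- The discriminant is the square of ((d + 2) c - d/c) / 2, which is nonnegative for c > 1; so c is
indeed the larger root. -/
theorem cothParam_of_eq {c : ℝ} (hc : 1 < c) :
    cothParam d (((d + 2) * c + d / c) / 2) = c := by
  have hd : (0 : ℝ) ≤ d := Nat.cast_nonneg d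
  have e : (((d + 2) * c + d / c) / 2) ^ 2 - (d + 2) * d = (((d + 2) * c - d / c) / 2) ^ 2 := by
    field_simp; ring
  have h0 : 0 ≤ ((d + 2) * c - d / c) / 2 := by
    have : d / c ≤ d := div_le_self hd hc.le
    nlinarith
  rw [cothParam, e, Real.sqrt_sq h0]
  field_simp
  ring

theorem cothParam_hasDerivAt {H : ℝ} (h : (d : ℝ) + 1 < H) :
    HasDerivAt (cothParam d) (2 * cothParam d H
      / ((d + 2) * cothParam d H - d / cothParam d H)) H := by
  have h1 := one_lt_sq_sub h
  have h2 : HasDerivAt (fun x : ℝ => x ^ 2 - (d + 2) * d) (2 * H) H := by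
    simpa using (hasDerivAt_pow 2 H).sub_const ((d + 2) * d : ℝ)
  have h3 := ((hasDerivAt_id H).add (h2.sqrt (by linarith))).div_const ((d : ℝ) + 2)
  refine h3.congr_deriv ?_
  have hs : √(H ^ 2 - (d + 2) * d) = (d + 2) * cothParam d H - H := by
    rw [cothParam]; field_simp; ring
  have hs0 : 0 < √(H ^ 2 - (d + 2) * d) := Real.sqrt_pos.2 (by linarith)
  have hc := one_lt_cothParam h
  have e := cothParam_eq h
  rw [hs] at hs0 ⊢
  have e2 : (d + 2) * cothParam d H - d / cothParam d H = 2 * ((d + 2) * cothParam d H - H) := by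
    linarith
  rw [e2]
  field_simp
  ring

theorem contDiffOn_cothParam : ContDiffOn ℝ ∞ (cothParam d) (Ioi ((d : ℝ) + 1)) := by
  refine (contDiffOn_id.add (ContDiffOn.sqrt ?_ fun H hH => ?_)).div_const _
  · exact (contDiffOn_id.pow 2).sub contDiffOn_const
  · have := one_lt_sq_sub (d := d) hH
    linarith

/-- The quadratic relation factored at c = 1. It converts the decay of H - (d + 1) into that of c -
1. -/
theorem two_mul_cothParam_mul {H : ℝ} (h : (d : ℝ) + 1 < H) :
    2 * cothParam d H * (H - (d + 1)) = (cothParam d H - 1) * ((d + 2) * cothParam d H - d) := by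
  have hc := one_lt_cothParam h
  have e := cothParam_eq h
  have hc0 : cothParam d H ≠ 0 := by positivity
  field_simp at e
  linear_combination e

/-- The quantity `e^{n v} cᵈ (c² - 1)`, which is constant on the Horowitz-Myers metrics. -/
def hmQuantity (v H : ℝ → ℝ) (d : ℕ) (r : ℝ) : ℝ :=
  Real.exp ((d + 2) * v r) * (cothParam d (H r) ^ d * (cothParam d (H r) ^ 2 - 1))

theorem hmQuantity_pos {v H : ℝ → ℝ} {r : ℝ} (h : (d : ℝ) + 1 < H r) :
    0 < hmQuantity v H d r := by
  have hc := one_lt_cothParam h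
  have : 0 < cothParam d (H r) ^ 2 - 1 := by nlinarith
  unfold hmQuantity; positivity

/-- The logarithmic derivative of c^d (c² - 1) in c is ((d + 2) c² - d) / (c (c² - 1)); multiplied
by dc/dH it leaves 2c / (c² - 1). -/
theorem hmQuantity_hasDerivAt {v H : ℝ → ℝ} {v' H' r : ℝ} (h : (d : ℝ) + 1 < H r)
    (hv : HasDerivAt v v' r) (hH : HasDerivAt H H' r) :
    HasDerivAt (hmQuantity v H d) (hmQuantity v H d r * ((d + 2) * v'
      + 2 * H' * (cothParam d (H r) / (cothParam d (H r) ^ 2 - 1)))) r := by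
  have hc := one_lt_cothParam h
  have dc := (cothParam_hasDerivAt h).comp r hH
  have h1 := (hv.const_mul ((d : ℝ) + 2)).exp.mul ((dc.pow d).mul ((dc.pow 2).sub_const 1))
  refine h1.congr_deriv ?_
  simp only [hmQuantity, Function.comp, Pi.mul_apply, Pi.pow_apply]
  have h2 : 0 < cothParam d (H r) ^ 2 - 1 := by nlinarith
  have h3 : 0 < (d + 2) * cothParam d (H r) ^ 2 - d := by
    have : (0 : ℝ) ≤ d := Nat.cast_nonneg d
    nlinarith
  generalize cothParam d (H r) = c at *
  have hc0 : 0 < c := by linarith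
  have h4 : (d + 2) * c - d / c = ((d + 2) * c ^ 2 - d) / c := by field_simp
  rw [h4]
  -- The power rule produces the exponent d - 1, so d = 0 is separate.
  rcases d with _ | d
  · have h5 : (↑(0 : ℕ) : ℝ) = 0 := Nat.cast_zero
    rw [h5] at h3 ⊢
    simp only [zero_add, sub_zero, pow_zero, zero_mul, one_mul]
    have h6 : c ^ 2 - 1 ≠ 0 := h2.ne'
    field_simp
    ring
  · push_cast at *
    rw [pow_succ c d]
    have h6 : c ^ 2 - 1 ≠ 0 := h2.ne'
    have h7 := h3.ne'
    field_simp
    ring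

/-- Here p and y are the principal curvatures in the θ and mean torus directions, h the squared
shear. After eliminating p, the left side is quadratic in y with its maximum at the Horowitz-Myers
value y = 1/c; for h = 0 that maximum is 0. -/
theorem slope_identity {c p y h : ℝ} (hc : 1 < c)
    (hH : ((d + 2) * c + d / c) / 2 = p + d * y) :
    (d + 2) * p + ((d + 2) * (d + 1) - (p + d * y) ^ 2 - p ^ 2 - (d * y ^ 2 + h))
        * (c / (c ^ 2 - 1))
      = -((d * (d + 1) * (y - 1 / c) ^ 2 + h) * (c / (c ^ 2 - 1))) := by
  obtain rfl : p = ((d + 2) * c + d / c) / 2 - d * y := by linarith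
  have h2 : c ^ 2 - 1 ≠ 0 := by nlinarith
  have hc0 : c ≠ 0 := by linarith
  field_simp
  ring

end Comparison

/-! ### The Riccati inequality and the monotonicity of W. -/

section Monotonicity
variable {d : ℕ} {u v : ℝ → ℝ} {γ : ℝ → Matrix (Fin d) (Fin d) ℝ} {a : ℝ}

/-- The average principal curvature of the level sets in the torus directions. -/
def torusRate (u : ℝ → ℝ) (γ : ℝ → Matrix (Fin d) (Fin d) ℝ) (r : ℝ) : ℝ :=
  Real.exp (-u r) * (mixedDeriv γ r).trace / (2 * d)

/-- The squared norm of the trace-free second fundamental form in the torus directions. -/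
def torusShear (u : ℝ → ℝ) (γ : ℝ → Matrix (Fin d) (Fin d) ℝ) (r : ℝ) : ℝ :=
  (1 / 4) * Real.exp (-u r) ^ 2 *
    ((mixedDeriv γ r * mixedDeriv γ r).trace - (mixedDeriv γ r).trace ^ 2 / d)

theorem meanCurv_eq (u v : ℝ → ℝ) (γ : ℝ → Matrix (Fin d) (Fin d) ℝ) (r : ℝ) :
    meanCurv u v γ r = Real.exp (-u r) * deriv v r + d * torusRate u γ r := by
  rcases eq_or_ne d 0 with rfl | hd
  · simp [meanCurv, Matrix.trace]
  · have : (d : ℝ) ≠ 0 := Nat.cast_ne_zero.2 hd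
    rw [meanCurv, torusRate]; field_simp

/-- Splits the torus part of |A|² into its pure trace and trace-free parts. -/
theorem trace_mixedDeriv_sq (u : ℝ → ℝ) (γ : ℝ → Matrix (Fin d) (Fin d) ℝ) (r : ℝ) :
    Real.exp (-u r) ^ 2 * ((1 / 4) * (mixedDeriv γ r * mixedDeriv γ r).trace)
      = d * torusRate u γ r ^ 2 + torusShear u γ r := by
  rcases eq_or_ne d 0 with rfl | hd
  · simp [torusShear, Matrix.trace]
  · have : (d : ℝ) ≠ 0 := Nat.cast_ne_zero.2 hd
    rw [torusShear, torusRate]; field_simp; ring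

theorem matDeriv_transpose {γ : ℝ → Matrix (Fin d) (Fin d) ℝ}
    (hγ0 : ∀ r, a < r → (γ r).PosDef) {r : ℝ} (hr : a < r) :
    (matDeriv γ r)ᵀ = matDeriv γ r := by
  ext i j
  refine Filter.EventuallyEq.deriv_eq ?_
  filter_upwards [Ioi_mem_nhds hr] with t ht
  simpa using (hγ0 t ht).isHermitian.apply i j

theorem torusShear_nonneg (hγ0 : ∀ r, a < r → (γ r).PosDef) {r : ℝ} (hr : a < r) :
    0 ≤ torusShear u γ r :=
  mul_nonneg (by positivity) (sub_nonneg.2 (sq_trace_le (hγ0 r hr) (matDeriv_transpose hγ0 hr)))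

variable (hu : ContDiffOn ℝ ∞ u (Ioi a)) (hv : ContDiffOn ℝ ∞ v (Ioi a))
    (hγ : ∀ i j, ContDiffOn ℝ ∞ (fun r => γ r i j) (Ioi a)) (hγ0 : ∀ r, a < r → (γ r).PosDef)
    (hR : ∀ x : Idx d → ℝ, a < x (rad d) →
      -(((d : ℝ) + 2) * ((d : ℝ) + 1)) ≤ scalarCurvature (radialMetric u v γ) x)
include hu hv hγ hγ0

theorem meanCurv_hasDerivAt {r : ℝ} (hr : a < r) :
    HasDerivAt (meanCurv u v γ) (deriv (meanCurv u v γ) r) r :=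
  hasDerivAt_of_contDiffOn isOpen_Ioi (contDiffOn_meanCurv isOpen_Ioi hu hv hγ hγ0) hr

include hR

theorem riccati_le {r : ℝ} (hr : a < r) :
    2 * (Real.exp (-u r) * deriv (meanCurv u v γ) r)
      ≤ (d + 2) * (d + 1) - meanCurv u v γ r ^ 2 - (Real.exp (-u r) * deriv v r) ^ 2
        - (d * torusRate u γ r ^ 2 + torusShear u γ r) := by
  have h1 := hR (point r 0 0) hr
  rw [scalarCurvature_radialMetric isOpen_Ioi hu hv hγ hγ0 (by exact hr)] at h1
  change _ ≤ -2 * (Real.exp (-u r) * deriv (meanCurv u v γ) r) - meanCurv u v γ r ^ 2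
    - Real.exp (-u r) ^ 2 * (deriv v r ^ 2 + 1 / 4 * (mixedDeriv γ r * mixedDeriv γ r).trace) at h1
  have h2 := trace_mixedDeriv_sq u γ r
  rw [mul_pow]
  linarith

/-- Cauchy-Schwarz gives |A|² ≥ H²/(d + 1), so at H ≥ d + 1 the right side of the Riccati inequality
is at most (d + 2)(d + 1) - (d + 1)² - (d + 1) = 0. -/
theorem deriv_meanCurv_nonpos {r : ℝ} (hr : a < r) (h : (d : ℝ) + 1 ≤ meanCurv u v γ r) :
    deriv (meanCurv u v γ) r ≤ 0 := by
  have h1 := riccati_le hu hv hγ hγ0 hR hr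
  have h2 := torusShear_nonneg (u := u) hγ0 hr
  have h3 := meanCurv_eq u v γ r
  set p := Real.exp (-u r) * deriv v r
  set y := torusRate u γ r
  have hd : (0 : ℝ) ≤ d := Nat.cast_nonneg d
  have h4 : meanCurv u v γ r ^ 2 ≤ (d + 1) * (p ^ 2 + d * y ^ 2) := by
    rw [h3]; nlinarith [mul_nonneg hd (sq_nonneg (p - y))]
  have h5 : ((d : ℝ) + 1) ^ 2 ≤ meanCurv u v γ r ^ 2 := by gcongr
  have h6 : 2 * (Real.exp (-u r) * deriv (meanCurv u v γ) r) ≤ 0 := by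
    have h7 : (d + 1 : ℝ) ≤ p ^ 2 + d * y ^ 2 := by
      by_contra hc
      nlinarith
    nlinarith
  have h7 := Real.exp_pos (-u r)
  by_contra hc
  have := mul_pos h7 (not_le.1 hc)
  linarith

theorem meanCurv_le_of_le {r₁ r₂ : ℝ} (h₁ : a < r₁) (h₁₂ : r₁ ≤ r₂)
    (h : meanCurv u v γ r₁ ≤ d + 1) : meanCurv u v γ r₂ ≤ d + 1 :=
  trapped_persists (fun _ hr => meanCurv_hasDerivAt hu hv hγ hγ0 hr)
    (fun _ hr => deriv_meanCurv_nonpos hu hv hγ hγ0 hR hr) h₁ h₁₂ h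

/-- G is the logarithmic derivative of W. Its exact value is recorded next to the bound because the
rigidity argument needs both. -/
theorem exists_hmQuantity_hasDerivAt {r : ℝ} (hr : a < r) (h : (d : ℝ) + 1 < meanCurv u v γ r) :
    ∃ G, HasDerivAt (hmQuantity v (meanCurv u v γ) d) (hmQuantity v (meanCurv u v γ) d r * G) r ∧
      G = (d + 2) * deriv v r + 2 * deriv (meanCurv u v γ) r
        * (cothParam d (meanCurv u v γ r) / (cothParam d (meanCurv u v γ r) ^ 2 - 1)) ∧
      Real.exp (-u r) * G ≤ -((d * (d + 1) * (torusRate u γ r - 1 / cothParam d (meanCurv u v γ r)) ^ 2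
        + torusShear u γ r) * (cothParam d (meanCurv u v γ r)
          / (cothParam d (meanCurv u v γ r) ^ 2 - 1))) := by
  refine ⟨_, hmQuantity_hasDerivAt h (hasDerivAt_of_contDiffOn isOpen_Ioi hv hr)
    (meanCurv_hasDerivAt hu hv hγ hγ0 hr), rfl, ?_⟩
  have hc := one_lt_cothParam h
  have e := cothParam_eq h
  have h1 := riccati_le hu hv hγ hγ0 hR hr
  have h2 := slope_identity (h := torusShear u γ r) (d := d) hc
    (e.symm.trans (meanCurv_eq u v γ r))
  rw [← meanCurv_eq] at h2
  rw [← h2]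
  generalize cothParam d (meanCurv u v γ r) = c at *
  have h3 : 0 < c / (c ^ 2 - 1) := div_pos (by linarith) (by nlinarith)
  have h4 := mul_le_mul_of_nonneg_right h1 h3.le
  linarith

theorem hmQuantity_antitoneOn (h : ∀ r, a < r → (d : ℝ) + 1 < meanCurv u v γ r) :
    AntitoneOn (hmQuantity v (meanCurv u v γ) d) (Ioi a) := by
  refine antitoneOn_of_deriv_nonpos (convex_Ioi a) (fun r hr => ?_) (fun r hr => ?_)
    (fun r hr => ?_)
  · obtain ⟨G, hG, -⟩ := exists_hmQuantity_hasDerivAt hu hv hγ hγ0 hR hr (h r hr)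
    exact hG.continuousAt.continuousWithinAt
  · rw [interior_Ioi] at hr
    obtain ⟨G, hG, -⟩ := exists_hmQuantity_hasDerivAt hu hv hγ hγ0 hR hr (h r hr)
    exact hG.differentiableAt.differentiableWithinAt
  · rw [interior_Ioi] at hr
    obtain ⟨G, hG, -, hle⟩ := exists_hmQuantity_hasDerivAt hu hv hγ hγ0 hR hr (h r hr)
    rw [hG.deriv]
    refine mul_nonpos_of_nonneg_of_nonpos (hmQuantity_pos (h r hr)).le ?_
    have hc := one_lt_cothParam (h r hr)
    have h2 := torusShear_nonneg (u := u) hγ0 hr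
    have h3 : 0 < cothParam d (meanCurv u v γ r) / (cothParam d (meanCurv u v γ r) ^ 2 - 1) :=
      div_pos (by linarith) (by nlinarith)
    have h4 : Real.exp (-u r) * G ≤ 0 := hle.trans (neg_nonpos.2 (by positivity))
    by_contra hc
    have := mul_pos (Real.exp_pos (-u r)) (not_le.1 hc)
    linarith

end Monotonicity

/-! ### The limit of W at infinity. -/

section Limit
variable {d : ℕ}

/-- The hypothesis forces H → d + 1, where c = 1; c is continuous in H. -/
theorem tendsto_cothParam {F : Filter ℝ} (hF : F ≤ atTop) {H : ℝ → ℝ} {L : ℝ}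
    (h1 : Tendsto (fun r => 2 * r ^ (d + 2) * (H r - (d + 1))) F (𝓝 L)) :
    Tendsto (fun r => cothParam d (H r)) F (𝓝 1) := by
  have hpos : ∀ᶠ r in F, 0 < r := hF (eventually_gt_atTop 0)
  have hHlim : Tendsto H F (𝓝 (d + 1)) := by
    have hinv : Tendsto (fun r : ℝ => (2 * r ^ (d + 2))⁻¹) F (𝓝 0) :=
      (tendsto_inv_atTop_zero.comp (Tendsto.const_mul_atTop two_pos
        (tendsto_pow_atTop (by simp)))).mono_left hF
    have h := (h1.mul hinv).add_const ((d : ℝ) + 1)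
    rw [mul_zero, zero_add] at h
    refine h.congr' ?_
    filter_upwards [hpos] with r hr
    field_simp
    ring
  have hcont : Continuous (cothParam d) := by unfold cothParam; fun_prop
  have := (hcont.tendsto ((d : ℝ) + 1)).comp hHlim
  have e : cothParam d ((d : ℝ) + 1) = 1 := by
    rw [cothParam, show ((d : ℝ) + 1) ^ 2 - (d + 2) * d = 1 by ring, Real.sqrt_one]
    field_simp; ring
  rwa [e] at this

/-- The limit of `hmQuantity` at infinity is determined by the asymptotics of the mean
curvature. -/
theorem tendsto_hmQuantity {F : Filter ℝ} (hF : F ≤ atTop) {v H : ℝ → ℝ} {L : ℝ}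
    (hH : ∀ᶠ r in F, (d : ℝ) + 1 < H r)
    (h1 : Tendsto (fun r => 2 * r ^ (d + 2) * (H r - (d + 1))) F (𝓝 L))
    (h2 : Tendsto (fun r => Real.exp (2 * v r) / r ^ 2) F (𝓝 1)) :
    Tendsto (hmQuantity v H d) F (𝓝 L) := by
  have hpos : ∀ᶠ r in F, 0 < r := hF (eventually_gt_atTop 0)
  have hc := tendsto_cothParam hF h1
  have hv : Tendsto (fun r => (Real.exp (v r) / r) ^ (d + 2)) F (𝓝 1) := by
    have h := (h2.sqrt).pow (d + 2)
    rw [Real.sqrt_one, one_pow] at h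
    refine h.congr' ?_
    filter_upwards [hpos] with r hr
    rw [Real.sqrt_div (Real.exp_pos _).le, Real.sqrt_sq hr.le, ← Real.exp_half]
    congr 3; ring
  have hden : Tendsto (fun r => ((d : ℝ) + 2) * cothParam d (H r) - d) F (𝓝 2) := by
    have := (hc.const_mul ((d : ℝ) + 2)).sub_const (d : ℝ)
    rwa [show ((d : ℝ) + 2) * 1 - d = 2 by ring] at this
  -- By `two_mul_cothParam_mul`, W = (e^v/r)ⁿ c^d · 2 rⁿ (H - (d + 1)) · c (c + 1) / ((d + 2) c -
  -- d), and the last factor tends to 1.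
  have h := (hv.mul (hc.pow d)).mul (h1.mul ((hc.mul (hc.add_const 1)).div hden two_ne_zero))
  rw [show (1 : ℝ) * 1 ^ d * (L * (1 * (1 + 1) / 2)) = L by norm_num] at h
  refine h.congr' ?_
  filter_upwards [hpos, hH] with r hr hHr
  have e := two_mul_cothParam_mul hHr
  have hc1 := one_lt_cothParam hHr
  simp only [Pi.div_apply, hmQuantity]
  have e2 : Real.exp ((d + 2) * v r) = Real.exp (v r) ^ (d + 2) := by
    rw [← Real.exp_nat_mul]; push_cast; rfl
  rw [e2, div_pow]
  have hd : (0 : ℝ) ≤ d := Nat.cast_nonneg d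
  generalize cothParam d (H r) = c at *
  have h3 : (d + 2) * c - d ≠ 0 := by nlinarith
  have h4 : r ^ (d + 2) ≠ 0 := by positivity
  generalize (d + 2) * c - d = D at *
  field_simp
  linear_combination (c + 1) * e

end Limit

/-! ### Pull-backs by radial and polar maps, and the scaling limit at the axis. -/

section Axis
variable {d : ℕ}

theorem pullback_apply {I : Type*} [Fintype I] [DecidableEq I] {Φ : (I → ℝ) → (I → ℝ)}
    {g : (I → ℝ) → Matrix I I ℝ} {x : I → ℝ} {J : Matrix I I ℝ}
    (hJ : ∀ i j, pderiv j (fun y => Φ y i) x = J i j) :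
    pullback Φ g x = Jᵀ * g (Φ x) * J := by
  have : (Matrix.of fun i j => pderiv j (fun y => Φ y i) x) = J := by ext i j; exact hJ i j
  simp only [pullback, this]

theorem pullback_radialMap {χ : ℝ → ℝ} {c : ℝ} {g : (Idx d → ℝ) → Matrix (Idx d) (Idx d) ℝ}
    (x : Idx d → ℝ) :
    pullback (radialMap χ c) g x
      = (Matrix.fromBlocks (Matrix.diagonal ![deriv χ (x (rad d)), c]) 0 0 1)ᵀ
        * g (radialMap χ c x)
        * Matrix.fromBlocks (Matrix.diagonal ![deriv χ (x (rad d)), c]) 0 0 1 := by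
  refine pullback_apply fun i j => ?_
  rcases i with i | i <;> rcases j with j | j
  · fin_cases i <;> fin_cases j <;> simp [pderiv, radialMap, point, Function.update]
  · fin_cases i <;> simp [pderiv, radialMap, point, Function.update]
  · fin_cases j <;> simp [pderiv, radialMap, point, Function.update]
  · by_cases hij : i = j
    · subst hij; simp [pderiv, radialMap, point]
    · simp [pderiv, radialMap, point, Function.update, hij]

theorem pullback_polarMap {g : (Idx d → ℝ) → Matrix (Idx d) (Idx d) ℝ} (x : Idx d → ℝ) :
    pullback polarMap g x
      = (Matrix.fromBlocks !![Real.cos (x (ang d)), -(x (rad d) * Real.sin (x (ang d)));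
          Real.sin (x (ang d)), x (rad d) * Real.cos (x (ang d))] 0 0 1)ᵀ
        * g (polarMap x)
        * Matrix.fromBlocks !![Real.cos (x (ang d)), -(x (rad d) * Real.sin (x (ang d)));
          Real.sin (x (ang d)), x (rad d) * Real.cos (x (ang d))] 0 0 1 := by
  refine pullback_apply fun i j => ?_
  rcases i with i | i <;> rcases j with j | j
  · fin_cases i <;> fin_cases j <;> simp [pderiv, polarMap, point, Function.update]
  · fin_cases i <;> simp [pderiv, polarMap, point, Function.update]
  · fin_cases j <;> simp [pderiv, polarMap, point, Function.update]
  · by_cases hij : i = j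
    · subst hij; simp [pderiv, polarMap, point]
    · simp [pderiv, polarMap, point, Function.update, hij]

theorem pullback_radialMap_blockMat {χ A B : ℝ → ℝ} {γ : ℝ → Matrix (Fin d) (Fin d) ℝ} {c : ℝ}
    (x : Idx d → ℝ) :
    pullback (radialMap χ c) (fun y => blockMat A B γ (y (rad d))) x
      = Matrix.fromBlocks (Matrix.diagonal ![A (χ (x (rad d))) * deriv χ (x (rad d)) ^ 2,
        B (χ (x (rad d))) * c ^ 2]) 0 0 (γ (χ (x (rad d)))) := by
  rw [pullback_radialMap]
  change _ * Matrix.fromBlocks (Matrix.diagonal ![A (χ (x (rad d))), B (χ (x (rad d)))]) 0 0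
    (γ (χ (x (rad d)))) * _ = _
  simp only [Matrix.fromBlocks_transpose, Matrix.fromBlocks_multiply, Matrix.diagonal_transpose,
    Matrix.diagonal_mul_diagonal, Matrix.transpose_zero, Matrix.transpose_one, Matrix.mul_zero,
    Matrix.zero_mul, add_zero, zero_add, Matrix.one_mul, Matrix.mul_one]
  congr 2
  funext i; fin_cases i <;> simp <;> ring

theorem pullback_radialMap_radialMetric {χ u v : ℝ → ℝ} {γ : ℝ → Matrix (Fin d) (Fin d) ℝ} {c : ℝ}
    (x : Idx d → ℝ) :
    pullback (radialMap χ c) (radialMetric u v γ) x = Matrix.fromBlocks (Matrix.diagonal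
      ![Real.exp (2 * u (χ (x (rad d)))) * deriv χ (x (rad d)) ^ 2,
        Real.exp (2 * v (χ (x (rad d)))) * c ^ 2]) 0 0 (γ (χ (x (rad d)))) :=
  pullback_radialMap_blockMat (A := fun r => Real.exp (2 * u r))
    (B := fun r => Real.exp (2 * v r)) x

theorem pullback_radialMap_hmMetric {χ : ℝ → ℝ} {r₀ : ℝ} (x : Idx d → ℝ) :
    pullback (radialMap χ 1) (hmMetric d r₀) x = Matrix.fromBlocks (Matrix.diagonal
      ![deriv χ (x (rad d)) ^ 2 / hmF d r₀ (χ (x (rad d))), hmF d r₀ (χ (x (rad d)))]) 0 0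
        (χ (x (rad d)) ^ 2 • 1) := by
  refine (pullback_radialMap_blockMat (A := fun r => 1 / hmF d r₀ r) (B := hmF d r₀)
    (γ := fun r => r ^ 2 • (1 : Matrix (Fin d) (Fin d) ℝ)) x).trans ?_
  rw [one_pow, mul_one, one_div_mul_eq_div]

theorem polarMap_zero (r : ℝ) :
    (polarMap (point r 0 0) : Idx d → ℝ) = point r 0 0 := by
  funext i
  rcases i with i | i
  · fin_cases i <;> simp [polarMap, point]
  · rfl

theorem polarMap_pi_div_two (r : ℝ) :
    (polarMap (point r (Real.pi / 2) 0) : Idx d → ℝ) = point 0 r 0 := by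
  funext i
  rcases i with i | i
  · fin_cases i <;> simp [polarMap, point]
  · rfl

/-- Near the axis e^v ~ (E/k) ρ and H ~ 1/(E ρ), so c ~ 2H/(d + 2). The powers of ρ cancel in W, as
do those of E, and only k remains. -/
theorem tendsto_rescaled {F : Filter ℝ} {A C ρ : ℝ → ℝ} {E k : ℝ} (hE : 0 < E) (hk : 0 < k)
    (hρ : Tendsto ρ F (𝓝 0)) (hρ0 : ∀ᶠ t in F, 0 < ρ t)
    (hA : Tendsto (fun t => Real.exp (A t) / ρ t) F (𝓝 (E / k)))
    (hC : Tendsto (fun t => ρ t * C t) F (𝓝 (1 / E))) :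
    Tendsto (fun t => Real.exp ((d + 2) * A t) * (cothParam d (C t) ^ d
      * (cothParam d (C t) ^ 2 - 1))) F (𝓝 ((2 / ((d + 2) * k)) ^ (d + 2))) := by
  have hc : Tendsto (fun t => ρ t * cothParam d (C t)) F (𝓝 (2 / ((d + 2) * E))) := by
    have h := (hC.add ((hC.pow 2).sub ((hρ.pow 2).mul_const ((d + 2) * d : ℝ))).sqrt).div_const
      ((d : ℝ) + 2)
    have e : (1 / E + √((1 / E) ^ 2 - 0 ^ 2 * ((d + 2) * d))) / ((d : ℝ) + 2)
        = 2 / ((d + 2) * E) := by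
      rw [show (1 / E) ^ 2 - 0 ^ 2 * (((d : ℝ) + 2) * d) = (1 / E) ^ 2 by ring,
        Real.sqrt_sq (by positivity)]
      field_simp; ring
    rw [e] at h
    refine h.congr' ?_
    filter_upwards [hρ0] with t ht
    rw [cothParam, show (ρ t * C t) ^ 2 - ρ t ^ 2 * ((d + 2) * d)
      = ρ t ^ 2 * (C t ^ 2 - (d + 2) * d) by ring, Real.sqrt_mul (by positivity),
      Real.sqrt_sq ht.le]
    ring
  have h := (hA.pow (d + 2)).mul ((hc.pow d).mul ((hc.pow 2).sub (hρ.pow 2)))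
  have e : (E / k) ^ (d + 2) * ((2 / ((d + 2) * E)) ^ d * ((2 / ((d + 2) * E)) ^ 2 - 0 ^ 2))
      = (2 / (((d : ℝ) + 2) * k)) ^ (d + 2) := by
    rw [show (0 : ℝ) ^ 2 = 0 by norm_num, sub_zero, ← pow_add, ← mul_pow]
    congr 1
    field_simp
  rw [e] at h
  refine h.congr' ?_
  filter_upwards [hρ0] with t ht
  have e2 : Real.exp ((d + 2) * A t) = Real.exp (A t) ^ (d + 2) := by
    rw [← Real.exp_nat_mul]; push_cast; rfl
  rw [e2, div_pow, mul_pow, mul_pow, pow_add (ρ t)]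
  field_simp

end Axis

/-! ### The limit of W at the axis. -/

section Axis
variable {d : ℕ}

theorem contDiff_point_left (θ : ℝ) : ContDiff ℝ ∞ (fun r : ℝ => (point r θ 0 : Idx d → ℝ)) := by
  refine contDiff_pi.2 fun i => ?_
  rcases i with i | i
  · fin_cases i
    · exact contDiff_id
    · exact contDiff_const
  · exact contDiff_const

theorem contDiff_point_right (r : ℝ) : ContDiff ℝ ∞ (fun θ : ℝ => (point r θ 0 : Idx d → ℝ)) := by
  refine contDiff_pi.2 fun i => ?_
  rcases i with i | i
  · fin_cases i
    · exact contDiff_const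
    · exact contDiff_id
  · exact contDiff_const

variable {r₀ a : ℝ} {u v : ℝ → ℝ} {γ : ℝ → Matrix (Fin d) (Fin d) ℝ}

theorem pullback_polarMap_zero (G : (Idx d → ℝ) → Matrix (Idx d) (Idx d) ℝ) (ρ : ℝ) :
    pullback polarMap G (point ρ 0 0) (rad d) (rad d) = G (point ρ 0 0) (rad d) (rad d) ∧
    pullback polarMap G (point ρ 0 0) (ang d) (ang d) = ρ ^ 2 * G (point ρ 0 0) (ang d) (ang d) ∧
    ∀ A B, pullback polarMap G (point ρ 0 0) (Sum.inr A) (Sum.inr B)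
      = G (point ρ 0 0) (Sum.inr A) (Sum.inr B) := by
  rw [pullback_polarMap, polarMap_zero]
  simp only [point, Sum.elim_inl, Matrix.cons_val_zero, Matrix.cons_val_one, Real.cos_zero,
    Real.sin_zero]
  refine ⟨?_, ?_, fun A B => ?_⟩
  · simp [Matrix.mul_apply, Fintype.sum_sum_type, Fin.sum_univ_two]
  · simp [Matrix.mul_apply, Fintype.sum_sum_type, Fin.sum_univ_two]
    ring
  · simp [Matrix.mul_apply, Fintype.sum_sum_type, Matrix.one_apply]

/-- On the ray φ = π/2 the radial vector is the second Cartesian vector; this gives access to the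
other diagonal entry of G. -/
theorem pullback_polarMap_pi_div_two (G : (Idx d → ℝ) → Matrix (Idx d) (Idx d) ℝ) (ρ : ℝ) :
    pullback polarMap G (point ρ (Real.pi / 2) 0) (rad d) (rad d)
      = G (point 0 ρ 0) (ang d) (ang d) := by
  rw [pullback_polarMap, polarMap_pi_div_two]
  simp [point, Matrix.mul_apply, Fintype.sum_sum_type, Fin.sum_univ_two]

theorem IsRadialDiffeo.strictMonoOn {χ : ℝ → ℝ} {a b : ℝ} (h : IsRadialDiffeo χ a b) :
    StrictMonoOn χ (Ioi a) :=
  strictMonoOn_of_deriv_pos (convex_Ioi a) h.smooth.continuousOn fun r hr => by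
    rw [interior_Ioi] at hr; exact h.deriv_pos r hr

/-- The limit of `hmQuantity` at the axis. -/
theorem exists_tendsto_hmQuantity_axis (h0 : 0 < r₀) (hg : IsSmoothMetric r₀ a u v γ) :
    ∃ χ, IsRadialDiffeo χ 0 a ∧
      Tendsto (fun ρ => hmQuantity v (meanCurv u v γ) d (χ ρ)) (𝓝[>] 0) (𝓝 (r₀ ^ (d + 2))) ∧
      Tendsto (fun ρ => Real.exp (v (χ ρ))) (𝓝[>] 0) (𝓝 0) := by
  obtain ⟨χ, G, hχ, hG, hpos, hpull⟩ := hg.polar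
  refine ⟨χ, hχ, ?_⟩
  set k := hmPeriod d r₀ / (2 * Real.pi)
  have hk : 0 < k := div_pos (hmPeriod_pos h0) Real.two_pi_pos
  have hχmem : ∀ ρ, 0 < ρ → a < χ ρ := fun ρ hρ => hχ.bijOn.mapsTo hρ
  set g11 : ℝ → ℝ := fun ρ => G (point ρ 0 0) (rad d) (rad d)
  set g22 : ℝ → ℝ := fun ρ => G (point ρ 0 0) (ang d) (ang d)
  set gT : ℝ → Matrix (Fin d) (Fin d) ℝ := fun ρ => (G (point ρ 0 0)).submatrix Sum.inr Sum.inr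
  have s11 : ContDiff ℝ ∞ g11 := (hG _ _).comp (contDiff_point_left 0)
  have s22 : ContDiff ℝ ∞ g22 := (hG _ _).comp (contDiff_point_left 0)
  have sT : ∀ A B, ContDiff ℝ ∞ (fun ρ => gT ρ A B) := fun A B =>
    (hG _ _).comp (contDiff_point_left 0)
  have pT : ∀ ρ, (gT ρ).PosDef := fun ρ => (hpos _).submatrix Sum.inr_injective
  have p11 : ∀ ρ, 0 < g11 ρ := fun ρ => (hpos _).diag_pos
  have p22 : ∀ ρ, 0 < g22 ρ := fun ρ => (hpos _).diag_pos
  have h11 : ∀ ρ, 0 < ρ → g11 ρ = Real.exp (2 * u (χ ρ)) * deriv χ ρ ^ 2 := by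
    intro ρ hρ
    have h1 := congrFun₂ (hpull (point ρ 0 0) hρ) (rad d) (rad d)
    rw [(pullback_polarMap_zero G ρ).1, pullback_radialMap_radialMetric] at h1
    simpa [g11, point] using h1
  have h22 : ∀ ρ, 0 < ρ → ρ ^ 2 * g22 ρ = Real.exp (2 * v (χ ρ)) * k ^ 2 := by
    intro ρ hρ
    have h1 := congrFun₂ (hpull (point ρ 0 0) hρ) (ang d) (ang d)
    rw [(pullback_polarMap_zero G ρ).2.1, pullback_radialMap_radialMetric] at h1
    simpa [g22, point] using h1
  have hT : ∀ ρ, 0 < ρ → gT ρ = γ (χ ρ) := by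
    intro ρ hρ
    ext A B
    have h1 := congrFun₂ (hpull (point ρ 0 0) hρ) (Sum.inr A) (Sum.inr B)
    rw [(pullback_polarMap_zero G ρ).2.2, pullback_radialMap_radialMetric] at h1
    simpa [gT, point] using h1
  have h22' : ∀ ρ, 0 < ρ → G (point 0 ρ 0) (ang d) (ang d) = g11 ρ := by
    intro ρ hρ
    have h1 := congrFun₂ (hpull (point ρ (Real.pi / 2) 0) hρ) (rad d) (rad d)
    rw [pullback_polarMap_pi_div_two, pullback_radialMap_radialMetric] at h1
    rw [h11 ρ hρ]
    simpa [point] using h1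
  -- The length of ∂_ρ does not depend on φ. Comparing the rays φ = 0 and φ = π/2 as ρ → 0 makes G
  -- isotropic at the axis on these entries: there is no cone angle.
  have e0 : g22 0 = g11 0 := by
    have c1 : Tendsto (fun ρ => G (point 0 ρ 0) (ang d) (ang d)) (𝓝[>] 0) (𝓝 (g22 0)) :=
      (((hG (ang d) (ang d)).comp (contDiff_point_right 0)).continuous.tendsto 0).mono_left
        nhdsWithin_le_nhds
    have c2 : Tendsto g11 (𝓝[>] 0) (𝓝 (g11 0)) :=
      (s11.continuous.tendsto 0).mono_left nhdsWithin_le_nhds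
    refine tendsto_nhds_unique c1 (c2.congr' ?_)
    filter_upwards [self_mem_nhdsWithin] with ρ hρ using (h22' ρ hρ).symm
  have hid : Tendsto (fun ρ : ℝ => ρ) (𝓝[>] 0) (𝓝 0) := nhdsWithin_le_nhds
  have t11 : Tendsto (fun ρ => √(g11 ρ)) (𝓝[>] 0) (𝓝 √(g11 0)) :=
    (s11.continuous.sqrt.tendsto 0).mono_left nhdsWithin_le_nhds
  have t22 : Tendsto (fun ρ => √(g22 ρ)) (𝓝[>] 0) (𝓝 √(g11 0)) := by
    rw [← e0]
    exact (s22.continuous.sqrt.tendsto 0).mono_left nhdsWithin_le_nhds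
  have hE : 0 < √(g11 0) := Real.sqrt_pos.2 (p11 0)
  -- The period 4π/(n r₀) is exactly what makes k = 2/(n r₀), hence the limit r₀ⁿ.
  have hval : 2 / (((d : ℝ) + 2) * k) = r₀ := by
    have : (0 : ℝ) < Real.pi := Real.pi_pos
    simp only [k, hmPeriod]
    field_simp
    norm_num
  rw [← hval]
  have hA : Tendsto (fun ρ => Real.exp (v (χ ρ)) / ρ) (𝓝[>] 0) (𝓝 (√(g11 0) / k)) := by
    refine (t22.div_const k).congr' ?_
    filter_upwards [self_mem_nhdsWithin] with ρ hρ
    have hρ' : 0 < ρ := hρ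
    have e1 := congrArg Real.sqrt (h22 ρ hρ)
    rw [Real.sqrt_mul (by positivity), Real.sqrt_mul (by positivity), Real.sqrt_sq hρ'.le,
      Real.sqrt_sq hk.le, ← Real.exp_half, mul_div_cancel_left₀ _ two_ne_zero] at e1
    field_simp
    linarith
  constructor
  · refine tendsto_rescaled (A := fun ρ => v (χ ρ)) (C := fun ρ => meanCurv u v γ (χ ρ)) hE hk hid
      self_mem_nhdsWithin hA ?_
    have dg : Continuous (deriv g22) := s22.continuous_deriv (by simp)
    have dT : Continuous fun ρ => (mixedDeriv gT ρ).trace := by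
      rw [← continuousOn_univ]
      exact (contDiffOn_trace_mixedDeriv isOpen_univ (fun i j => (sT i j).contDiffOn)
        fun ρ _ => pT ρ).continuousOn
    -- This function is ρ H: the 1 comes from the factor ρ² in the θ-coefficient, and the bracket is
    -- bounded near the axis because G is smooth.
    have hlim : Tendsto (fun ρ => (1 + ρ * (deriv g22 ρ / (2 * g22 ρ)
        + 1 / 2 * (mixedDeriv gT ρ).trace)) / √(g11 ρ)) (𝓝[>] 0)
        (𝓝 ((1 + 0 * (deriv g22 0 / (2 * g22 0) + 1 / 2 * (mixedDeriv gT 0).trace)) / √(g11 0))) := by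
      refine Tendsto.div ((hid.mul ?_).const_add 1) t11 hE.ne'
      refine Tendsto.mono_left (Continuous.tendsto ?_ 0) nhdsWithin_le_nhds
      exact (dg.div (continuous_const.mul s22.continuous) fun ρ => (mul_pos two_pos (p22 ρ)).ne').add
        (continuous_const.mul dT)
    rw [zero_mul, add_zero] at hlim
    refine hlim.congr' ?_
    filter_upwards [self_mem_nhdsWithin] with ρ hρ
    have hρ' : 0 < ρ := hρ
    have dχ := hasDerivAt_of_contDiffOn isOpen_Ioi hχ.smooth hρ
    have hχ' := hχ.deriv_pos ρ hρ
    have dv := (hasDerivAt_of_contDiffOn isOpen_Ioi hg.v_smooth (hχmem ρ hρ)).comp ρ dχ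
    have d22 : HasDerivAt g22 (deriv g22 ρ) ρ := (s22.differentiable (by simp)).differentiableAt.hasDerivAt
    have hnb : ∀ᶠ t in 𝓝 ρ, 0 < t := Ioi_mem_nhds hρ'
    -- Logarithmic derivative of ρ² g₂₂ = k² e^{2v}.
    have ev : deriv v (χ ρ) * deriv χ ρ = 1 / ρ + deriv g22 ρ / (2 * g22 ρ) := by
      have a1 := ((hasDerivAt_pow 2 ρ).mul d22)
      have a2 := ((dv.const_mul 2).exp.mul_const (k ^ 2))
      have a3 : ((fun x : ℝ => x ^ 2) * g22) =ᶠ[𝓝 ρ]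
          fun t => Real.exp (2 * (v ∘ χ) t) * k ^ 2 := by
        filter_upwards [hnb] with t ht using h22 t ht
      have a4 := a1.unique (a2.congr_of_eventuallyEq a3)
      have a5 := h22 ρ hρ
      have := p22 ρ
      simp only [Function.comp] at a4
      field_simp
      have a6 : Real.exp (2 * v (χ ρ)) * k ^ 2 ≠ 0 := by positivity
      rw [show Real.exp (2 * v (χ ρ)) * (2 * (deriv v (χ ρ) * deriv χ ρ)) * k ^ 2
        = ρ ^ 2 * g22 ρ * (2 * (deriv v (χ ρ) * deriv χ ρ)) by rw [a5]; ring] at a4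
      refine mul_left_cancel₀ hρ'.ne' ?_
      norm_num at a4
      linarith
    have eT : mixedDeriv gT ρ = deriv χ ρ • mixedDeriv γ (χ ρ) := by
      have : matDeriv gT ρ = deriv χ ρ • matDeriv γ (χ ρ) := by
        ext A B
        have a1 := (hasDerivAt_of_contDiffOn isOpen_Ioi (hg.γ_smooth A B) (hχmem ρ hρ)).comp ρ dχ
        have a3 : (fun t => gT t A B) =ᶠ[𝓝 ρ] ((fun r => γ r A B) ∘ χ) := by
          filter_upwards [hnb] with t ht
          rw [hT t ht]; rfl
        rw [Matrix.smul_apply, smul_eq_mul, mul_comm]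
        exact a3.deriv_eq.trans a1.deriv
      rw [mixedDeriv, mixedDeriv, this, hT ρ hρ, Matrix.mul_smul]
    have eu : √(g11 ρ) = Real.exp (u (χ ρ)) * deriv χ ρ := by
      rw [h11 ρ hρ, Real.sqrt_mul (Real.exp_pos _).le, Real.sqrt_sq hχ'.le, ← Real.exp_half,
        mul_div_cancel_left₀ _ two_ne_zero]
    rw [eu, eT, Matrix.trace_smul, smul_eq_mul, meanCurv, Real.exp_neg]
    have e3 : deriv v (χ ρ) = (1 / ρ + deriv g22 ρ / (2 * g22 ρ)) / deriv χ ρ := by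
      rw [← ev]; field_simp
    rw [e3]
    have := p22 ρ
    have := Real.exp_pos (u (χ ρ))
    field_simp
    ring
  · have h := hA.mul hid
    rw [mul_zero] at h
    refine h.congr' ?_
    filter_upwards [self_mem_nhdsWithin] with ρ hρ
    have hρ' : 0 < ρ := hρ
    field_simp

/-- A nonincreasing function lies below its limit at the axis. -/
theorem hmQuantity_le (h0 : 0 < r₀) (hg : IsSmoothMetric r₀ a u v γ)
    (hanti : AntitoneOn (hmQuantity v (meanCurv u v γ) d) (Ioi a)) {r : ℝ} (hr : a < r) :
    hmQuantity v (meanCurv u v γ) d r ≤ r₀ ^ (d + 2) := by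
  obtain ⟨χ, hχ, hlim, -⟩ := exists_tendsto_hmQuantity_axis h0 hg
  obtain ⟨ρ₁, hρ₁, rfl⟩ := hχ.bijOn.surjOn hr
  refine ge_of_tendsto hlim ?_
  filter_upwards [Ioo_mem_nhdsGT hρ₁] with ρ hρ
  exact hanti (hχ.bijOn.mapsTo hρ.1) hr (hχ.strictMonoOn hρ.1 hρ₁ hρ.2).le

end Axis

/-! ### The model case and the equality case. -/

section Rigidity
variable {d : ℕ} {r₀ a : ℝ} {u v : ℝ → ℝ} {γ : ℝ → Matrix (Fin d) (Fin d) ℝ}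

theorem lt_of_eq_cothParam {c H : ℝ} (hc : 1 < c) (h : H = ((d + 2) * c + d / c) / 2) :
    (d : ℝ) + 1 < H := by
  have hd : (0 : ℝ) ≤ d := Nat.cast_nonneg d
  have e : H - (d + 1) = (c - 1) * ((d + 2) * c - d) / (2 * c) := by
    rw [h]; field_simp; ring
  have : 0 < (c - 1) * ((d + 2) * c - d) / (2 * c) :=
    div_pos (mul_pos (by linarith) (by nlinarith)) (by linarith)
  linarith

theorem radialMetric_eq_pullback_iff (r₀ : ℝ) (ψ : ℝ → ℝ) (x : Idx d → ℝ) :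
    radialMetric u v γ x = pullback (radialMap ψ 1) (hmMetric d r₀) x ↔
      Real.exp (2 * u (x (rad d))) = deriv ψ (x (rad d)) ^ 2 / hmF d r₀ (ψ (x (rad d))) ∧
      Real.exp (2 * v (x (rad d))) = hmF d r₀ (ψ (x (rad d))) ∧
      γ (x (rad d)) = ψ (x (rad d)) ^ 2 • 1 := by
  rw [pullback_radialMap_hmMetric, radialMetric, Matrix.fromBlocks_inj]
  simp only [true_and, ← and_assoc]
  refine and_congr_left fun _ => ?_
  rw [Matrix.diagonal_injective.eq_iff]
  constructor
  · intro h
    exact ⟨congrFun h 0, congrFun h 1⟩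
  · rintro ⟨h1, h2⟩
    rw [h1, h2]

/-- In the Horowitz-Myers metric `hmQuantity` is constant. -/
theorem hmQuantity_of_coincides (h0 : 0 < r₀) (hv : ContDiffOn ℝ ∞ v (Ioi a))
    (h : CoincidesWithHM r₀ a (radialMetric u v γ)) {r : ℝ} (hr : a < r) :
    (d : ℝ) + 1 < meanCurv u v γ r ∧ hmQuantity v (meanCurv u v γ) d r = r₀ ^ (d + 2) := by
  obtain ⟨ψ, hψ, hg⟩ := h
  have heq : ∀ t, a < t → Real.exp (2 * u t) = deriv ψ t ^ 2 / hmF d r₀ (ψ t) ∧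
      Real.exp (2 * v t) = hmF d r₀ (ψ t) ∧ γ t = ψ t ^ 2 • 1 := fun t ht =>
    (radialMetric_eq_pullback_iff r₀ ψ (point t 0 0)).1 (hg (point t 0 0) ht)
  obtain ⟨eu, ev, eγ⟩ := heq r hr
  have hψr : r₀ < ψ r := hψ.bijOn.mapsTo hr
  have hψ0 := h0.trans hψr
  have hf := hmF_pos (d := d) h0 hψr
  have hψ' := hψ.deriv_pos r hr
  have dψ := hasDerivAt_of_contDiffOn isOpen_Ioi hψ.smooth hr
  have dv := hasDerivAt_of_contDiffOn isOpen_Ioi hv hr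
  have dF := ((hmF_hasDerivAt (d := d) (r₀ := r₀) hψ0.ne').differentiableAt.hasDerivAt).comp r dψ
  have hnb : ∀ᶠ t in 𝓝 r, a < t := Ioi_mem_nhds hr
  have ev' : deriv v r = deriv (hmF d r₀) (ψ r) * deriv ψ r / (2 * hmF d r₀ (ψ r)) := by
    have a1 := (dv.const_mul 2).exp
    have a2 : (fun t => Real.exp (2 * v t)) =ᶠ[𝓝 r] (hmF d r₀ ∘ ψ) := by
      filter_upwards [hnb] with t ht using (heq t ht).2.1
    have a3 := a1.unique (dF.congr_of_eventuallyEq a2)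
    rw [ev] at a3
    field_simp
    linarith
  have eN : (mixedDeriv γ r).trace = 2 * d * deriv ψ r / ψ r := by
    have a1 : matDeriv γ r = (2 * ψ r * deriv ψ r) • 1 := by
      ext A B
      have a2 : (fun t => γ t A B) =ᶠ[𝓝 r]
          fun t => ψ t ^ 2 * (1 : Matrix (Fin d) (Fin d) ℝ) A B := by
        filter_upwards [hnb] with t ht
        rw [(heq t ht).2.2]; rfl
      refine a2.deriv_eq.trans ?_
      rw [((dψ.fun_pow 2).mul_const _).deriv]
      simp
    have a2 : (γ r)⁻¹ = (ψ r ^ 2)⁻¹ • 1 := by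
      rw [eγ]
      refine Matrix.inv_eq_right_inv ?_
      rw [Matrix.smul_mul, Matrix.one_mul, smul_smul, mul_inv_cancel₀ (by positivity), one_smul]
    rw [mixedDeriv, a1, a2, Matrix.smul_mul, Matrix.one_mul, smul_smul, Matrix.trace_smul,
      Matrix.trace_one, smul_eq_mul, Fintype.card_fin]
    field_simp
  have eu' : Real.exp (-u r) = √(hmF d r₀ (ψ r)) / deriv ψ r := by
    have : Real.exp (-u r) ^ 2 = (√(hmF d r₀ (ψ r)) / deriv ψ r) ^ 2 := by
      rw [div_pow, Real.sq_sqrt hf.le, Real.exp_neg, inv_pow, ← Real.exp_nat_mul]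
      push_cast
      rw [eu, inv_div]
    exact (pow_left_inj₀ (Real.exp_pos _).le (by positivity) two_ne_zero).1 this
  have eH : meanCurv u v γ r = hmMeanCurv d r₀ (ψ r) := by
    rw [meanCurv, hmMeanCurv, eu', ev', eN]
    field_simp
  have hz : 0 < 1 - (r₀ / ψ r) ^ (d + 2) := by
    rw [hmF_eq] at hf; exact pos_of_mul_pos_right hf (by positivity)
  have hs := Real.sq_sqrt hz.le
  have hs0 := Real.sqrt_pos.2 hz
  have hs1 : √(1 - (r₀ / ψ r) ^ (d + 2)) < 1 := by
    rw [Real.sqrt_lt' one_pos]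
    have : 0 < (r₀ / ψ r) ^ (d + 2) := by positivity
    linarith
  have evv : Real.exp (v r) = ψ r * √(1 - (r₀ / ψ r) ^ (d + 2)) := by
    rw [← sqrt_hmF hψ0, ← ev, ← Real.exp_half, mul_div_cancel_left₀ _ two_ne_zero]
  have hH := hmMeanCurv_eq (d := d) h0 hψr
  have hzr : r₀ ^ (d + 2) = (r₀ / ψ r) ^ (d + 2) * ψ r ^ (d + 2) := by
    rw [← mul_pow]; field_simp
  rw [← eH] at hH
  have e2 : Real.exp ((d + 2) * v r) = Real.exp (v r) ^ (d + 2) := by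
    rw [← Real.exp_nat_mul]; push_cast; rfl
  rw [hmQuantity, e2, evv, hzr]
  generalize (r₀ / ψ r) ^ (d + 2) = z at *
  generalize √(1 - z) = s at *
  obtain rfl : z = 1 - s ^ 2 := by linarith
  -- In the model c = 1/s with s = √(1 - (r₀/ψ)ⁿ), and e^v = ψ s, so W reduces to ψⁿ (1 - s²) = r₀ⁿ.
  have hc : 1 < s⁻¹ := (one_lt_inv₀ hs0).2 hs1
  have e3 : meanCurv u v γ r = ((d + 2) * s⁻¹ + d / s⁻¹) / 2 := by
    rw [hH]; field_simp; ring
  refine ⟨lt_of_eq_cothParam hc e3, ?_⟩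
  rw [e3, cothParam_of_eq hc, mul_pow, pow_add s, inv_pow, inv_pow]
  field_simp

theorem hmF_mono (h0 : 0 < r₀) {x y : ℝ} (hx : r₀ < x) (hxy : x ≤ y) :
    hmF d r₀ x ≤ hmF d r₀ y := by
  have hx0 := h0.trans hx
  have hz := hmF_pos (d := d) h0 hx
  rw [hmF_eq] at hz
  have h1 : 0 < 1 - (r₀ / x) ^ (d + 2) := pos_of_mul_pos_right hz (by positivity)
  have hy0 := hx0.trans_le hxy
  rw [hmF_eq, hmF_eq]
  gcongr

/-- If `hmQuantity` takes everywhere the value of the Horowitz-Myers metric, then the metric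
coincides with it. -/
theorem coincides_of_hmQuantity_eq (h0 : 0 < r₀) (hg : IsSmoothMetric r₀ a u v γ)
    (hR : ∀ x : Idx d → ℝ, a < x (rad d) →
      -(((d : ℝ) + 2) * ((d : ℝ) + 1)) ≤ scalarCurvature (radialMetric u v γ) x)
    (hH : ∀ r, a < r → (d : ℝ) + 1 < meanCurv u v γ r)
    (hW : ∀ r, a < r → hmQuantity v (meanCurv u v γ) d r = r₀ ^ (d + 2))
    {F : Filter ℝ} [F.NeBot] (hF : F ≤ atTop)
    (hc : Tendsto (fun r => cothParam d (meanCurv u v γ r)) F (𝓝 1))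
    (hv : Tendsto (fun r => Real.exp (2 * v r) / r ^ 2) F (𝓝 1))
    (hγ : ∀ A B, Tendsto (fun r => γ r A B / r ^ 2) F
      (𝓝 ((1 : Matrix (Fin d) (Fin d) ℝ) A B))) :
    CoincidesWithHM r₀ a (radialMetric u v γ) := by
  set c : ℝ → ℝ := fun r => cothParam d (meanCurv u v γ r)
  have hc1 : ∀ r, a < r → 1 < c r := fun r hr => one_lt_cothParam (hH r hr)
  have hHsmooth := contDiffOn_meanCurv isOpen_Ioi hg.u_smooth hg.v_smooth hg.γ_smooth hg.γ_posDef
  have hcsmooth : ContDiffOn ℝ ∞ c (Ioi a) := contDiffOn_cothParam.comp hHsmooth hH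
  -- Constancy of W makes its logarithmic derivative 0, so the square and the shear, both
  -- nonnegative, must vanish. The middle claim carries a factor d so that it also holds for d = 0.
  have hG : ∀ r, a < r →
      (d + 2) * deriv v r + 2 * deriv (meanCurv u v γ) r * (c r / (c r ^ 2 - 1)) = 0 ∧
      d * torusRate u γ r = d / c r ∧ torusShear u γ r = 0 := by
    intro r hr
    obtain ⟨G, hGd, hGe, hGle⟩ := exists_hmQuantity_hasDerivAt hg.u_smooth hg.v_smooth hg.γ_smooth
      hg.γ_posDef hR hr (hH r hr)
    have hconst : hmQuantity v (meanCurv u v γ) d =ᶠ[𝓝 r] fun _ => r₀ ^ (d + 2) := by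
      filter_upwards [Ioi_mem_nhds hr] with t ht using hW t ht
    have h1 := hGd.unique ((hasDerivAt_const r _).congr_of_eventuallyEq hconst)
    have hG0 : G = 0 := (mul_eq_zero.1 h1).resolve_left (hmQuantity_pos (hH r hr)).ne'
    have hcr := hc1 r hr
    have h3 : 0 < c r / (c r ^ 2 - 1) := div_pos (by linarith) (by nlinarith)
    have hs := torusShear_nonneg (u := u) hg.γ_posDef hr
    rw [hG0, mul_zero, neg_nonneg] at hGle
    have h4 := nonpos_of_mul_nonpos_left hGle h3
    have h5 : 0 ≤ d * (d + 1) * (torusRate u γ r - 1 / c r) ^ 2 := by positivity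
    have h6 : d * (d + 1) * (torusRate u γ r - 1 / c r) ^ 2 = 0 := by
      change d * (d + 1) * (torusRate u γ r - 1 / c r) ^ 2 + _ ≤ 0 at h4
      linarith
    refine ⟨by rw [← hG0]; exact hGe.symm, ?_, ?_⟩
    · rcases mul_eq_zero.1 h6 with h7 | h7
      · have hd : (d : ℝ) = 0 := (mul_eq_zero.1 h7).resolve_right (by positivity)
        rw [hd]; simp
      · have h8 := sub_eq_zero.1 (pow_eq_zero_iff two_ne_zero |>.1 h7)
        rw [h8]; ring
    · change d * (d + 1) * (torusRate u γ r - 1 / c r) ^ 2 + _ ≤ 0 at h4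
      linarith
  have hp : ∀ r, a < r → deriv v r = Real.exp (u r) * (((d + 2) * c r - d / c r) / 2) := by
    intro r hr
    have h1 := meanCurv_eq u v γ r
    have h2 := cothParam_eq (hH r hr)
    change _ = ((d + 2) * c r + d / c r) / 2 at h2
    rw [(hG r hr).2.1, Real.exp_neg] at h1
    have h3 : (Real.exp (u r))⁻¹ * deriv v r = ((d + 2) * c r - d / c r) / 2 := by linarith
    rw [← h3]
    have := Real.exp_pos (u r)
    field_simp
  -- In arc length this is c' = -(n/2)(c² - 1), the equation of coth; it follows from W' = 0 and the
  -- value of v'.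
  have dc : ∀ r, a < r → HasDerivAt c (-((d + 2) / 2 * Real.exp (u r) * (c r ^ 2 - 1))) r := by
    intro r hr
    refine ((cothParam_hasDerivAt (hH r hr)).comp r (meanCurv_hasDerivAt hg.u_smooth hg.v_smooth
      hg.γ_smooth hg.γ_posDef hr)).congr_deriv ?_
    change 2 * c r / ((d + 2) * c r - d / c r) * _ = _
    have h1 := (hG r hr).1
    have hcr := hc1 r hr
    have h2 : c r ^ 2 - 1 ≠ 0 := by nlinarith
    have hd : (0 : ℝ) ≤ d := Nat.cast_nonneg d
    have h3 : (d + 2) * c r - d / c r ≠ 0 := by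
      have : d / c r ≤ d := div_le_self hd hcr.le
      nlinarith
    rw [hp r hr] at h1
    generalize (d + 2) * c r - d / c r = D at *
    field_simp at h1 ⊢
    linarith
  -- The Horowitz-Myers radius, recovered from e^v = ψ √(1 - (r₀/ψ)ⁿ) = ψ / c.
  set ψ : ℝ → ℝ := fun r => Real.exp (v r) * c r
  have hψpos : ∀ r, a < r → 0 < ψ r := fun r hr =>
    mul_pos (Real.exp_pos _) (by have := hc1 r hr; linarith)
  have dψ : ∀ r, a < r → HasDerivAt ψ (Real.exp (u r) * Real.exp (v r)) r := by
    intro r hr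
    refine ((hasDerivAt_of_contDiffOn isOpen_Ioi hg.v_smooth hr).exp.mul (dc r hr)).congr_deriv ?_
    have hcr := hc1 r hr
    rw [hp r hr]
    field_simp
    ring
  have hfψ : ∀ r, a < r → (r₀ / ψ r) ^ (d + 2) = 1 - 1 / c r ^ 2 := by
    intro r hr
    have e2 : Real.exp ((d + 2) * v r) = Real.exp (v r) ^ (d + 2) := by
      rw [← Real.exp_nat_mul]; push_cast; rfl
    have hcr := hc1 r hr
    rw [div_pow, ← hW r hr, hmQuantity, e2]
    change Real.exp (v r) ^ (d + 2) * (c r ^ d * (c r ^ 2 - 1)) / (Real.exp (v r) * c r) ^ (d + 2) = _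
    rw [mul_pow, pow_add (c r)]
    have := Real.exp_pos (v r)
    field_simp
  have hF2 : ∀ r, a < r → Real.exp (2 * v r) = hmF d r₀ (ψ r) := by
    intro r hr
    have hcr := hc1 r hr
    rw [hmF_eq, hfψ r hr, mul_pow, ← Real.exp_nat_mul]
    push_cast
    field_simp
    ring
  have hψgt : ∀ r, a < r → r₀ < ψ r := by
    intro r hr
    have h1 : (r₀ / ψ r) ^ (d + 2) < 1 := by
      rw [hfψ r hr]
      have : 0 < c r := by have := hc1 r hr; linarith
      have : 0 < 1 / c r ^ 2 := by positivity
      linarith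
    have h2 := (pow_lt_one_iff_of_nonneg (div_nonneg h0.le (hψpos r hr).le) (by simp)).1 h1
    exact (div_lt_one (hψpos r hr)).1 h2
  have hψlim : Tendsto (fun r => ψ r ^ 2 / r ^ 2) F (𝓝 1) := by
    have h := hv.mul (hc.pow 2)
    rw [one_pow, one_mul] at h
    refine h.congr fun r => ?_
    simp only [ψ, c, mul_pow]
    rw [← Real.exp_nat_mul]
    push_cast
    ring
  have hmono : StrictMonoOn ψ (Ioi a) := by
    refine strictMonoOn_of_deriv_pos (convex_Ioi a)
      (fun r hr => (dψ r hr).continuousAt.continuousWithinAt) fun r hr => ?_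
    rw [interior_Ioi] at hr
    rw [(dψ r hr).deriv]
    positivity
  refine ⟨ψ, ⟨hg.v_smooth.exp.mul hcsmooth, fun r hr => ?_, hψgt, hmono.injOn, ?_⟩, ?_⟩
  · rw [(dψ r hr).deriv]
    positivity
  · intro y hy
    have hy' : r₀ < y := hy
    -- Surjectivity onto (r₀, ∞) by the intermediate value theorem. Large values come from ψ/r → 1
    -- along F; any bound below 1 on ψ²/r² would do in place of 1/4.
    obtain ⟨r₂, hr₂, hyr₂⟩ : ∃ r, a < r ∧ y ≤ ψ r := by
      have h1 : ∀ᶠ r in F, 1 / 4 < ψ r ^ 2 / r ^ 2 := hψlim.eventually_const_lt (by norm_num)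
      have h2 := hF (eventually_gt_atTop (max a (2 * y)))
      obtain ⟨r, hr1, hr2⟩ := (h1.and h2).exists
      have hra : a < r := (le_max_left _ _).trans_lt hr2
      have hry : 2 * y < r := (le_max_right _ _).trans_lt hr2
      have hr0 : 0 < r := by linarith
      refine ⟨r, hra, ?_⟩
      rw [lt_div_iff₀ (by positivity)] at hr1
      have h3 : y ^ 2 ≤ ψ r ^ 2 := by nlinarith
      exact (pow_le_pow_iff_left₀ (by linarith) (hψpos r hra).le two_ne_zero).1 h3
    -- Small values come from the axis, where f(ψ) = e^{2v} → 0 while f is monotone beyond r₀.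
    obtain ⟨r₁, hr₁, hyr₁⟩ : ∃ r, a < r ∧ ψ r ≤ y := by
      obtain ⟨χ, hχ, -, hlim⟩ := exists_tendsto_hmQuantity_axis h0 hg
      have h1 := hlim.pow 2
      rw [zero_pow two_ne_zero] at h1
      obtain ⟨ρ, hρ1, hρ2⟩ :=
        ((h1.eventually_lt_const (hmF_pos (d := d) h0 hy')).and self_mem_nhdsWithin).exists
      have hra : a < χ ρ := hχ.bijOn.mapsTo hρ2
      refine ⟨χ ρ, hra, ?_⟩
      by_contra hcon
      have h2 := hmF_mono (d := d) h0 hy' (not_le.1 hcon).le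
      rw [← hF2 _ hra] at h2
      rw [← Real.exp_nat_mul] at hρ1
      push_cast at hρ1
      linarith
    exact isPreconnected_Ioi.intermediate_value hr₁ hr₂
      (fun r hr => (dψ r hr).continuousAt.continuousWithinAt) ⟨hyr₁, hyr₂⟩
  · intro x hx
    rw [radialMetric_eq_pullback_iff]
    generalize x (rad d) = r at hx
    refine ⟨?_, hF2 r hx, ?_⟩
    · rw [(dψ r hx).deriv, ← hF2 r hx, mul_pow, ← Real.exp_nat_mul, ← Real.exp_nat_mul]
      push_cast
      field_simp
    · ext A B
      have hd : (d : ℝ) ≠ 0 := Nat.cast_ne_zero.2 A.pos.ne'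
      -- Zero shear makes γ' a multiple of γ, with the same logarithmic derivative as ψ². Hence γ/ψ²
      -- is constant, and the asymptotics identify the constant as the identity.
      have hder : ∀ t, a < t → HasDerivAt (fun t => γ t A B / ψ t ^ 2) 0 t := by
        intro t ht
        have h1 := (hG t ht).2.2
        have h2 : (mixedDeriv γ t * mixedDeriv γ t).trace = (mixedDeriv γ t).trace ^ 2 / d :=
          sub_eq_zero.1 ((mul_eq_zero.1 h1).resolve_left (by positivity))
        have h3 := eq_smul_of_sq_trace_eq (hg.γ_posDef t ht)
          (matDeriv_transpose hg.γ_posDef ht) h2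
        have h4 := (hG t ht).2.1
        change matDeriv γ t = ((mixedDeriv γ t).trace / d) • γ t at h3
        rw [torusRate, Real.exp_neg] at h4
        have hcr := hc1 t ht
        have h5 : (mixedDeriv γ t).trace / d = 2 * Real.exp (u t) / c t := by
          have := Real.exp_pos (u t)
          field_simp at h4 ⊢
          linarith
        have h6 : matDeriv γ t A B = 2 * Real.exp (u t) / c t * γ t A B := by
          rw [h3, h5]; rfl
        have dγ : HasDerivAt (fun t => γ t A B) (matDeriv γ t A B) t :=
          hasDerivAt_of_contDiffOn isOpen_Ioi (hg.γ_smooth A B) ht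
        have hψt := hψpos t ht
        refine (dγ.fun_div ((dψ t ht).fun_pow 2) (by positivity)).congr_deriv ?_
        rw [h6]
        have e : ψ t = Real.exp (v t) * c t := rfl
        rw [e]
        field_simp
        push_cast
        ring
      have hconst : ∀ t, a < t → γ t A B / ψ t ^ 2 = γ r A B / ψ r ^ 2 := by
        intro t ht
        refine (convex_Ioi a).is_const_of_fderivWithin_eq_zero (𝕜 := ℝ)
          (f := fun t => γ t A B / ψ t ^ 2)
          (fun s hs => (hder s hs).differentiableAt.differentiableWithinAt) (fun s hs => ?_) ht hx
        rw [fderivWithin_of_isOpen isOpen_Ioi hs]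
        simpa using (hder s hs).hasFDerivAt.fderiv
      have hlim := (hγ A B).div hψlim one_ne_zero
      rw [div_one] at hlim
      have hlim2 : Tendsto (fun _ : ℝ => γ r A B / ψ r ^ 2) F
          (𝓝 ((1 : Matrix (Fin d) (Fin d) ℝ) A B)) := by
        refine hlim.congr' ?_
        filter_upwards [hF (eventually_gt_atTop a), hF (eventually_gt_atTop 0)] with t ht ht0
        have := hψpos t ht
        rw [← hconst t ht]
        simp only [Pi.div_apply]
        field_simp
      have h7 := tendsto_nhds_unique tendsto_const_nhds hlim2
      have := hψpos r hx
      rw [Matrix.smul_apply, smul_eq_mul, ← h7]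
      field_simp

end Rigidity
end HorowitzMyers
end

/-! ### The main theorem. -/

open HorowitzMyers
theorem mainTheorem1 (d : ℕ) (Λ : Module.Basis (Fin d) ℝ (Fin d → ℝ))
    (r₀ : ℝ) (hr₀ : 0 < r₀) (a : ℝ) (u v : ℝ → ℝ) (γ : ℝ → Matrix (Fin d) (Fin d) ℝ)
    (hg : IsSmoothMetric r₀ a u v γ)
    (M : ℝ) (hM : HasTotalMass Λ r₀ (radialMetric u v γ) M)
    (hR : ∀ x : Idx d → ℝ, a < x (rad d) →
      -(((d : ℝ) + 2) * ((d : ℝ) + 1)) ≤ scalarCurvature (radialMetric u v γ) x) :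
    0 ≤ M ∧ (M = 0 ↔ CoincidesWithHM r₀ a (radialMetric u v γ)) := by
  obtain ⟨F, hne, hF, hlimH, hlimv, hlimγ⟩ := exists_filter_tendsto Λ hr₀ hg.u_smooth hg.v_smooth
    hg.γ_smooth hg.γ_posDef hM
  have hκ := crossVolume_pos Λ hr₀
  have hgt : ∀ᶠ r in F, a < r := hF (eventually_gt_atTop a)
  have hback : CoincidesWithHM r₀ a (radialMetric u v γ) → M = 0 := by
    intro h
    have h1 := tendsto_hmQuantity hF (hgt.mono fun r hr =>
      (hmQuantity_of_coincides hr₀ hg.v_smooth h hr).1) hlimH hlimv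
    have h2 : Tendsto (hmQuantity v (meanCurv u v γ) d) F (𝓝 (r₀ ^ (d + 2))) :=
      tendsto_const_nhds.congr' (hgt.mono fun r hr =>
        (hmQuantity_of_coincides hr₀ hg.v_smooth h hr).2.symm)
    have h3 := tendsto_nhds_unique h1 h2
    have h4 : M / crossVolume Λ r₀ = 0 := by linarith
    exact (div_eq_zero_iff.1 h4).resolve_right hκ.ne'
  -- Either some level set has H ≤ n - 1, which forces M > 0, or c and W are defined everywhere.
  by_cases htr : ∃ r, a < r ∧ meanCurv u v γ r ≤ d + 1
  · obtain ⟨r₁, hr₁, hle⟩ := htr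
    have hL : r₀ ^ (d + 2) - M / crossVolume Λ r₀ ≤ 0 := by
      refine le_of_tendsto hlimH ?_
      filter_upwards [hF (eventually_ge_atTop r₁), hF (eventually_gt_atTop 0)] with r hr hr0
      have := meanCurv_le_of_le hg.u_smooth hg.v_smooth hg.γ_smooth hg.γ_posDef hR hr₁ hr hle
      exact mul_nonpos_of_nonneg_of_nonpos (by positivity) (by linarith)
    have hpos : 0 < M / crossVolume Λ r₀ := by
      have : 0 < r₀ ^ (d + 2) := by positivity
      linarith
    have hMpos : 0 < M := (div_pos_iff_of_pos_right hκ).1 hpos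
    exact ⟨hMpos.le, fun h => absurd h hMpos.ne', hback⟩
  · push Not at htr
    have hanti := hmQuantity_antitoneOn hg.u_smooth hg.v_smooth hg.γ_smooth hg.γ_posDef hR htr
    have hlim := tendsto_hmQuantity hF (hgt.mono htr) hlimH hlimv
    have hle : ∀ r, a < r → hmQuantity v (meanCurv u v γ) d r ≤ r₀ ^ (d + 2) :=
      fun r hr => hmQuantity_le hr₀ hg hanti hr
    have hL := le_of_tendsto hlim (hgt.mono hle)
    have hM0 : 0 ≤ M := by
      have : 0 ≤ M / crossVolume Λ r₀ := by linarith
      exact le_of_not_gt fun h => absurd (div_neg_of_neg_of_pos h hκ) (not_lt.2 this)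
    refine ⟨hM0, fun h => ?_, hback⟩
    rw [h, zero_div, sub_zero] at hlim hlimH
    -- For M = 0 the limits of W at the axis and at infinity agree, so the monotone W is constant.
    refine coincides_of_hmQuantity_eq hr₀ hg hR htr (fun r hr => le_antisymm (hle r hr) ?_) hF
      (tendsto_cothParam hF hlimH) hlimv hlimγ
    refine le_of_tendsto hlim ?_
    filter_upwards [hF (eventually_ge_atTop r)] with t ht
    exact hanti hr (lt_of_lt_of_le hr ht) ht
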